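/- Let $N\ge 2$, let $E^0,\Delta E\in C^4(\mathbb R^N)$, and let $I_c=\{3,\dots,N\}$. Suppose that, as $x\to 0$, $$E^0(x)=\cos\alpha^0\,x_1+\sin\alpha^0\,x_2+\tfrac{\lambda^0}{2}(x_1^2+x_2^2)+\tfrac12(x_1^3+x_1x_2^2)+\tfrac12\sum_{i,j\in I_c}H_{ij}x_ix_j+\tfrac16\sum_{i,j,k\in I_c}G_{ijk}x_ix_jx_k+O(\|x\|^4),$$ where $\lambda^0\in\mathbb R$, $\cos\alpha^0>0$, $\sin\alpha^0\ne 0$, the $G_{ijk}$ are real, and $H=(H_{ij})_{i,j\in I_c}$ is a real symmetric matrix such that $H-\max(0,\lambda^0)I$ is positive definite. For $\delta>0$ put $E^\delta=E^0+\delta\,\Delta E$. For $\varepsilon>0$ the $\varepsilon$-GAD (gentlest ascent dynamics) for an energy $E$ is the system $$\dot x=-(I-2v\otimes v)\nabla E(x),\qquad \varepsilon^2\dot v=-(I-v\otimes v)\nabla^2E(x)v .$$ Then there are constants $\delta_0,\varepsilon_0,m,M>0$ such that for every $\delta\in(0,\delta_0)$ there is a point $z^\delta\in\mathbb R^N$ with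 the following properties. 1. $\|z^\delta\|\le M\delta$; the lowest eigenvalue of $\nabla^2E^\delta(z^\delta)$ has multiplicity exactly two (that is, $\lambda_1=\lambda_2$, and $\lambda_2<\lambda_3$ if $N\ge3$); and $\nabla E^\delta(z^\delta)$ belongs to the corresponding two-dimensional eigenspace $V^\delta$. 2. For every $\varepsilon\in(0,\varepsilon_0)$ and every $x_0\in z^\delta+V^\delta$ with $\|x_0-z^\delta\|=\varepsilon/\sqrt{2\cos\alpha^0}$ there is a unit vector $v_0\in\mathbb R^N$ such that, for all initial data $(x(0),v(0))$ with $\|x(0)-x_0\|\le m\varepsilon(\delta+\varepsilon)$, $\|v(0)-v_0\|\le m\varepsilon(\delta+\varepsilon)$ and $\|v(0)\|=1$, the $\varepsilon$-GAD for $E^\delta$ has a solution $(x,v)$ on $[0,\infty)$ with these initial data. It is unique: every solution with the same initial data on an interval $[0,T)$, $T>0$, coincides with it there. Moreover, $\|v(t)\|=1$ and $$\Bigl|\,\|x(t)-z^\delta\|-\frac{\varepsilon}{\sqrt{2\cos\alpha^0}}\,\Bigr|\le M\varepsilon(\varepsilon+\delta)\qquad\text{for all }t\ge 0 .$$ -/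

import Mathlib

noncomputable section

/-- The Hessian `∇²E(x)`, as a linear operator: the derivative of the gradient. -/
def hessian {N : ℕ} (E : EuclideanSpace ℝ (Fin N) → ℝ) (x : EuclideanSpace ℝ (Fin N)) :
    EuclideanSpace ℝ (Fin N) →L[ℝ] EuclideanSpace ℝ (Fin N) :=
  fderiv ℝ (gradient E) x

/-- The eigenspace of the Hessian `∇²E(x)` for the value `μ`. -/
def hessianEigenspace {N : ℕ} (E : EuclideanSpace ℝ (Fin N) → ℝ)
    (x : EuclideanSpace ℝ (Fin N)) (μ : ℝ) : Submodule ℝ (EuclideanSpace ℝ (Fin N)) :=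
  Module.End.eigenspace (hessian E x : Module.End ℝ (EuclideanSpace ℝ (Fin N))) μ

/-- `μ` is the lowest eigenvalue of the Hessian `∇²E(x)`. -/
def IsLowestHessianEigenvalue {N : ℕ} (E : EuclideanSpace ℝ (Fin N) → ℝ)
    (x : EuclideanSpace ℝ (Fin N)) (μ : ℝ) : Prop :=
  IsLeast {ν : ℝ | Module.End.HasEigenvalue
    (hessian E x : Module.End ℝ (EuclideanSpace ℝ (Fin N))) ν} μ

/-- The pair `(x, v)` solves the gentlest ascent dynamics
`x' = -(I - 2 v ⊗ v) ∇E(x)`, `ε² v' = -(I - v ⊗ v) ∇²E(x) v` on the time set `s`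
(one-sided derivatives at the end points that belong to `s`). -/
def IsGADSolutionOn {N : ℕ} (E : EuclideanSpace ℝ (Fin N) → ℝ) (ε : ℝ)
    (x v : ℝ → EuclideanSpace ℝ (Fin N)) (s : Set ℝ) : Prop :=
  ∀ t ∈ s,
    HasDerivWithinAt x
      (-(gradient E (x t) - (2 * inner ℝ (v t) (gradient E (x t))) • v t)) s t ∧
    HasDerivWithinAt v
      ((ε ^ 2)⁻¹ • -(hessian E (x t) (v t) - (inner ℝ (v t) (hessian E (x t) (v t))) • v t)) s t

/-- The cubic polynomial of the isotropic singular form on `ℝᴺ`, `N = n + 2`. The coordinates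
`x₁, x₂` of the usual notation are `x 0, x 1`; the remaining `n` coordinates `x₃, …, x_N` are
`x i.succ.succ` for `i : Fin n`. -/
def isotropicCubic {n : ℕ} (α lam : ℝ) (H : Matrix (Fin n) (Fin n) ℝ)
    (G : Fin n → Fin n → Fin n → ℝ) (x : EuclideanSpace ℝ (Fin (n + 2))) : ℝ :=
  (Real.cos α * x 0 + Real.sin α * x 1)
    + lam / 2 * (x 0 ^ 2 + x 1 ^ 2)
    + 1 / 2 * (x 0 ^ 3 + x 0 * x 1 ^ 2)
    + 1 / 2 * ∑ i : Fin n, ∑ j : Fin n, H i j * x i.succ.succ * x j.succ.succ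
    + 1 / 6 * ∑ i : Fin n, ∑ j : Fin n, ∑ k : Fin n,
        G i j k * x i.succ.succ * x j.succ.succ * x k.succ.succ

/-- `E` is of the isotropic singular form at the origin: it agrees with the cubic polynomial up to
`O(‖x‖⁴)` as `x → 0`. -/
def HasIsotropicForm {n : ℕ} (E : EuclideanSpace ℝ (Fin (n + 2)) → ℝ) (α lam : ℝ)
    (H : Matrix (Fin n) (Fin n) ℝ) (G : Fin n → Fin n → Fin n → ℝ) : Prop :=
  (fun x => E x - isotropicCubic α lam H G x) =O[nhds 0] (fun x => ‖x‖ ^ 4)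

end

section

open Set Filter Topology Asymptotics

/-- The component of `v` orthogonal to the orthonormal vectors `f₁`, `f₂`. -/
def planePerp {X : Type*} [NormedAddCommGroup X] [InnerProductSpace ℝ X] (f₁ f₂ v : X) : X :=
  v - inner ℝ f₁ v • f₁ - inner ℝ f₂ v • f₂

section PlanePerp

variable {X : Type*} [NormedAddCommGroup X] [InnerProductSpace ℝ X] {f₁ f₂ : X}

theorem eq_add_planePerp (f₁ f₂ v : X) :
    v = inner ℝ f₁ v • f₁ + inner ℝ f₂ v • f₂ + planePerp f₁ f₂ v := by
  unfold planePerp; abel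

theorem inner_left_planePerp (h₁ : ‖f₁‖ = 1) (h : inner ℝ f₁ f₂ = 0) (v : X) :
    inner ℝ f₁ (planePerp f₁ f₂ v) = 0 := by
  simp [planePerp, inner_sub_right, inner_smul_right, h, h₁]

theorem inner_right_planePerp (h₂ : ‖f₂‖ = 1) (h : inner ℝ f₁ f₂ = 0) (v : X) :
    inner ℝ f₂ (planePerp f₁ f₂ v) = 0 := by
  have h' : inner ℝ f₂ f₁ = 0 := by rw [real_inner_comm]; exact h
  simp [planePerp, inner_sub_right, inner_smul_right, h', h₂]

theorem inner_planePerp_self (h₁ : ‖f₁‖ = 1) (h₂ : ‖f₂‖ = 1) (h : inner ℝ f₁ f₂ = 0) (v : X) :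
    inner ℝ (planePerp f₁ f₂ v) v = ‖planePerp f₁ f₂ v‖ ^ 2 := by
  conv_lhs => rw [eq_add_planePerp f₁ f₂ v]
  have e₁ := inner_left_planePerp h₁ h v
  have e₂ := inner_right_planePerp h₂ h v
  rw [real_inner_comm] at e₁ e₂
  rw [← eq_add_planePerp f₁ f₂ v]
  nth_rewrite 2 [eq_add_planePerp f₁ f₂ v]
  simp only [inner_add_right, inner_smul_right, e₁, e₂, real_inner_self_eq_norm_sq]
  ring

theorem norm_sq_eq_add_planePerp (h₁ : ‖f₁‖ = 1) (h₂ : ‖f₂‖ = 1) (h : inner ℝ f₁ f₂ = 0)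
    (v : X) :
    ‖v‖ ^ 2 = inner ℝ f₁ v ^ 2 + inner ℝ f₂ v ^ 2 + ‖planePerp f₁ f₂ v‖ ^ 2 := by
  rw [← inner_planePerp_self h₁ h₂ h v, ← real_inner_self_eq_norm_sq]
  simp only [planePerp, inner_sub_left, inner_smul_left, RCLike.conj_to_real]
  ring

theorem norm_planePerp_le (h₁ : ‖f₁‖ = 1) (h₂ : ‖f₂‖ = 1) (h : inner ℝ f₁ f₂ = 0) (v : X) :
    ‖planePerp f₁ f₂ v‖ ≤ ‖v‖ := by
  have := norm_sq_eq_add_planePerp h₁ h₂ h v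
  nlinarith [norm_nonneg v, norm_nonneg (planePerp f₁ f₂ v), sq_nonneg (inner ℝ f₁ v),
    sq_nonneg (inner ℝ f₂ v)]

theorem abs_inner_le_of_norm_eq_one (h₁ : ‖f₁‖ = 1) (v : X) : |inner ℝ f₁ v| ≤ ‖v‖ := by
  simpa [h₁] using abs_real_inner_le_norm f₁ v

end PlanePerp

/-- Quantitative description, on the ball of radius `R` around `z`, of a gradient field `g` with
Hessian `B` near an isotropic index-1 singularity `z`: the plane spanned by the orthonormal vectors
`f₁`, `f₂` is an eigenspace of `B z` for `μ`, it contains `g z`, and the constants `C`, `κ`, `γ`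
control the errors relative to the model energy up to the perturbation size `δ`. -/
structure IsNearIsotropic {X : Type*} [NormedAddCommGroup X] [InnerProductSpace ℝ X]
    (g : X → X) (B : X → X →L[ℝ] X) (z f₁ f₂ : X) (μ κ γ c s C R δ : ℝ) : Prop where
  norm_left : ‖f₁‖ = 1
  norm_right : ‖f₂‖ = 1
  orth : inner ℝ f₁ f₂ = 0
  gap : μ + γ ≤ κ
  grad_mem : ∀ w, inner ℝ f₁ w = 0 → inner ℝ f₂ w = 0 → inner ℝ w (g z) = 0
  grad_near : ‖g z - (c • f₁ + s • f₂)‖ ≤ C * δ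
  eig_left : B z f₁ = μ • f₁
  eig_right : B z f₂ = μ • f₂
  bound : ∀ y, ‖y‖ ≤ R → ‖B (z + y)‖ ≤ C
  coercive : ∀ y, ‖y‖ ≤ R → ∀ w, inner ℝ f₁ w = 0 → inner ℝ f₂ w = 0 →
    κ * ‖w‖ ^ 2 ≤ inner ℝ w (B (z + y) w)
  grad_taylor : ∀ y, ‖y‖ ≤ R → ‖g (z + y) - g z - B z y‖ ≤ C * ‖y‖ ^ 2
  hess_left : ∀ y, ‖y‖ ≤ R →
    ‖B (z + y) f₁ - μ • f₁ - ((3 * inner ℝ f₁ y) • f₁ + inner ℝ f₂ y • f₂)‖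
      ≤ C * ‖y‖ * (‖y‖ + δ)
  hess_right : ∀ y, ‖y‖ ≤ R →
    ‖B (z + y) f₂ - μ • f₂ - (inner ℝ f₂ y • f₁ + inner ℝ f₁ y • f₂)‖
      ≤ C * ‖y‖ * (‖y‖ + δ)

namespace IsNearIsotropic

variable {X : Type*} [NormedAddCommGroup X] [InnerProductSpace ℝ X]
  {g : X → X} {B : X → X →L[ℝ] X} {z f₁ f₂ : X} {μ κ γ c s C R δ : ℝ}

theorem abs_eigenvalue_le (h : IsNearIsotropic g B z f₁ f₂ μ κ γ c s C R δ) (hR : 0 ≤ R) :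
    |μ| ≤ C := by
  have h1 := h.bound 0 (by simpa using hR)
  have h2 := (B (z + 0)).le_opNorm f₁
  rw [add_zero] at h1 h2
  rw [h.eig_left, norm_smul, h.norm_left, mul_one, mul_one, Real.norm_eq_abs] at h2
  exact h2.trans h1

/-- The planar part of the Hessian at `z + y` applied to `v`, to first order in `y`. -/
theorem exists_hessian_apply_eq (h : IsNearIsotropic g B z f₁ f₂ μ κ γ c s C R δ)
    (hC : 0 ≤ C) (hδ : 0 ≤ δ) {ε D : ℝ} (hε : 0 ≤ ε) (hD : 1 ≤ D) {y v : X} (hv : ‖v‖ = 1)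
    (hy : ‖y‖ ≤ D * ε) (hyR : ‖y‖ ≤ R) :
    ∃ r : X, ‖r‖ ≤ 2 * C * D ^ 2 * (ε * (ε + δ)) ∧
      B (z + y) v = μ • v
        + ((3 * inner ℝ f₁ v * inner ℝ f₁ y + inner ℝ f₂ v * inner ℝ f₂ y) • f₁
          + (inner ℝ f₁ v * inner ℝ f₂ y + inner ℝ f₂ v * inner ℝ f₁ y) • f₂) + r
        + (B (z + y) (planePerp f₁ f₂ v) - μ • planePerp f₁ f₂ v) := by
  set r₁ := B (z + y) f₁ - μ • f₁ - ((3 * inner ℝ f₁ y) • f₁ + inner ℝ f₂ y • f₂) with hr₁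
  set r₂ := B (z + y) f₂ - μ • f₂ - (inner ℝ f₂ y • f₁ + inner ℝ f₁ y • f₂) with hr₂
  have key : C * ‖y‖ * (‖y‖ + δ) ≤ C * D ^ 2 * (ε * (ε + δ)) := by
    have h1 : ‖y‖ + δ ≤ D * (ε + δ) := by nlinarith
    calc C * ‖y‖ * (‖y‖ + δ) ≤ C * (D * ε) * (D * (ε + δ)) := by gcongr
      _ = _ := by ring
  have b₁ : ‖r₁‖ ≤ C * D ^ 2 * (ε * (ε + δ)) := (h.hess_left y hyR).trans key
  have b₂ : ‖r₂‖ ≤ C * D ^ 2 * (ε * (ε + δ)) := (h.hess_right y hyR).trans key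
  have v₁ : |inner ℝ f₁ v| ≤ 1 := hv ▸ abs_inner_le_of_norm_eq_one h.norm_left v
  have v₂ : |inner ℝ f₂ v| ≤ 1 := hv ▸ abs_inner_le_of_norm_eq_one h.norm_right v
  refine ⟨inner ℝ f₁ v • r₁ + inner ℝ f₂ v • r₂, ?_, ?_⟩
  · refine (norm_add_le _ _).trans ?_
    rw [norm_smul, norm_smul, Real.norm_eq_abs, Real.norm_eq_abs]
    nlinarith [norm_nonneg r₁, norm_nonneg r₂]
  · have e : B (z + y) v = inner ℝ f₁ v • B (z + y) f₁ + inner ℝ f₂ v • B (z + y) f₂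
        + B (z + y) (planePerp f₁ f₂ v) := by
      conv_lhs => rw [eq_add_planePerp f₁ f₂ v]
      simp only [map_add, map_smul]
    have e₁ : B (z + y) f₁ = r₁ + μ • f₁ + ((3 * inner ℝ f₁ y) • f₁ + inner ℝ f₂ y • f₂) := by
      rw [hr₁]; abel
    have e₂ : B (z + y) f₂ = r₂ + μ • f₂ + (inner ℝ f₂ y • f₁ + inner ℝ f₁ y • f₂) := by
      rw [hr₂]; abel
    have e₃ : μ • v = (μ * inner ℝ f₁ v) • f₁ + (μ * inner ℝ f₂ v) • f₂
        + μ • planePerp f₁ f₂ v := by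
      conv_lhs => rw [eq_add_planePerp f₁ f₂ v]
      simp only [smul_add, smul_smul]
    rw [e, e₁, e₂, e₃]
    module

/-- The first order part of the Hessian has size `O(ε)`. -/
theorem norm_planar_le (h : IsNearIsotropic g B z f₁ f₂ μ κ γ c s C R δ) {L : ℝ} {y v : X}
    (hv : ‖v‖ = 1) (hy : ‖y‖ ≤ L) :
    |3 * inner ℝ f₁ v * inner ℝ f₁ y + inner ℝ f₂ v * inner ℝ f₂ y| ≤ 4 * L ∧
      |inner ℝ f₁ v * inner ℝ f₂ y + inner ℝ f₂ v * inner ℝ f₁ y| ≤ 2 * L := by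
  have v₁ : |inner ℝ f₁ v| ≤ 1 := hv ▸ abs_inner_le_of_norm_eq_one h.norm_left v
  have v₂ : |inner ℝ f₂ v| ≤ 1 := hv ▸ abs_inner_le_of_norm_eq_one h.norm_right v
  have y₁ : |inner ℝ f₁ y| ≤ L := (abs_inner_le_of_norm_eq_one h.norm_left y).trans hy
  have y₂ : |inner ℝ f₂ y| ≤ L := (abs_inner_le_of_norm_eq_one h.norm_right y).trans hy
  have m : ∀ a b : ℝ, |a| ≤ 1 → |b| ≤ L → |a * b| ≤ L := fun a b ha hb => by
    rw [abs_mul]; nlinarith [abs_nonneg a, abs_nonneg b]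
  constructor
  · have := m _ _ v₁ y₁; have := m _ _ v₂ y₂
    rw [abs_le] at *; constructor <;> nlinarith
  · have := m _ _ v₁ y₂; have := m _ _ v₂ y₁
    rw [abs_le] at *; constructor <;> nlinarith

/-- Contraction of the component of `v` orthogonal to the plane. -/
theorem perp_velocity_le (h : IsNearIsotropic g B z f₁ f₂ μ κ γ c s C R δ)
    (hC : 1 ≤ C) (hδ : 0 ≤ δ) {ε D : ℝ} (hε : 0 ≤ ε) (hD : 1 ≤ D) (hεδ : ε + δ ≤ 1) {y v : X}
    (hv : ‖v‖ = 1) (hy : ‖y‖ ≤ D * ε) (hyR : ‖y‖ ≤ R) (hw : ‖planePerp f₁ f₂ v‖ ≤ ε)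
    (hsmall : ε * (6 * D + 2 * C * D ^ 2 + 2 * C) ≤ γ / 2) :
    -inner ℝ (planePerp f₁ f₂ v) (B (z + y) v)
        + inner ℝ v (B (z + y) v) * ‖planePerp f₁ f₂ v‖ ^ 2
      ≤ ‖planePerp f₁ f₂ v‖
        * (-(γ / 2) * ‖planePerp f₁ f₂ v‖ + 2 * C * D ^ 2 * (ε * (ε + δ))) := by
  obtain ⟨r, hr, e⟩ := h.exists_hessian_apply_eq (by linarith) hδ hε hD hv hy hyR
  obtain ⟨s₁, s₂⟩ := h.norm_planar_le hv hy
  have hμ := h.abs_eigenvalue_le ((norm_nonneg y).trans hyR)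
  have hB := h.bound y hyR
  have hBw : ‖B (z + y) (planePerp f₁ f₂ v)‖ ≤ C * ‖planePerp f₁ f₂ v‖ :=
    (B (z + y)).le_of_opNorm_le hB _
  have hco := h.coercive y hyR _ (inner_left_planePerp h.norm_left h.orth v)
    (inner_right_planePerp h.norm_right h.orth v)
  have w₁ := inner_left_planePerp h.norm_left h.orth v
  have w₂ := inner_right_planePerp h.norm_right h.orth v
  have wv := inner_planePerp_self h.norm_left h.norm_right h.orth v
  rw [real_inner_comm] at w₁ w₂
  have v₁ : |inner ℝ f₁ v| ≤ 1 := hv ▸ abs_inner_le_of_norm_eq_one h.norm_left v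
  have v₂ : |inner ℝ f₂ v| ≤ 1 := hv ▸ abs_inner_le_of_norm_eq_one h.norm_right v
  set w := planePerp f₁ f₂ v
  set S₁ := 3 * inner ℝ f₁ v * inner ℝ f₁ y + inner ℝ f₂ v * inner ℝ f₂ y
  set S₂ := inner ℝ f₁ v * inner ℝ f₂ y + inner ℝ f₂ v * inner ℝ f₁ y
  have i₁ : inner ℝ w (B (z + y) v) = inner ℝ w r + inner ℝ w (B (z + y) w) := by
    rw [e]
    simp only [inner_add_right, inner_sub_right, inner_smul_right, w₁, w₂, wv,
      real_inner_self_eq_norm_sq]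
    ring
  have i₂ : inner ℝ v (B (z + y) v) = μ + (S₁ * inner ℝ f₁ v + S₂ * inner ℝ f₂ v)
      + inner ℝ v r + inner ℝ v (B (z + y) w - μ • w) := by
    conv_lhs => rw [e]
    simp only [inner_add_right, inner_smul_right, real_inner_self_eq_norm_sq, hv,
      real_inner_comm v]
    ring
  have j₁ : |inner ℝ w r| ≤ ‖w‖ * (2 * C * D ^ 2 * (ε * (ε + δ))) :=
    (abs_real_inner_le_norm _ _).trans (by gcongr)
  have j₂ : |inner ℝ v r| ≤ 2 * C * D ^ 2 * (ε * (ε + δ)) := by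
    have := abs_real_inner_le_norm v r; rw [hv, one_mul] at this; exact this.trans hr
  have j₃ : |inner ℝ v (B (z + y) w - μ • w)| ≤ 2 * C * ε := by
    have := abs_real_inner_le_norm v (B (z + y) w - μ • w)
    rw [hv, one_mul] at this
    refine this.trans ((norm_sub_le _ _).trans ?_)
    rw [norm_smul, Real.norm_eq_abs]
    have k₁ : |μ| * ‖w‖ ≤ C * ‖w‖ := by gcongr
    have k₂ : C * ‖w‖ ≤ C * ε := by gcongr
    linarith
  have j₄ : S₁ * inner ℝ f₁ v + S₂ * inner ℝ f₂ v ≤ 6 * (D * ε) := by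
    have k₁ : |S₁ * inner ℝ f₁ v| ≤ 4 * (D * ε) := by
      rw [abs_mul]; nlinarith [abs_nonneg S₁, abs_nonneg (inner ℝ f₁ v)]
    have k₂ : |S₂ * inner ℝ f₂ v| ≤ 2 * (D * ε) := by
      rw [abs_mul]; nlinarith [abs_nonneg S₂, abs_nonneg (inner ℝ f₂ v)]
    linarith [le_abs_self (S₁ * inner ℝ f₁ v), le_abs_self (S₂ * inner ℝ f₂ v)]
  have j₅ : 2 * C * D ^ 2 * (ε * (ε + δ)) ≤ 2 * C * D ^ 2 * ε := by
    gcongr; nlinarith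
  have hvB : inner ℝ v (B (z + y) v) ≤ κ - γ / 2 := by
    rw [i₂]
    have := h.gap
    linarith [(abs_le.1 j₂).2, (abs_le.1 j₃).2]
  have : inner ℝ v (B (z + y) v) * ‖w‖ ^ 2 ≤ (κ - γ / 2) * ‖w‖ ^ 2 := by gcongr
  have e' : ‖w‖ * (-(γ / 2) * ‖w‖ + 2 * C * D ^ 2 * (ε * (ε + δ)))
      = -(γ / 2) * ‖w‖ ^ 2 + ‖w‖ * (2 * C * D ^ 2 * (ε * (ε + δ))) := by ring
  rw [i₁, e']
  linarith [(abs_le.1 j₁).1]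

end IsNearIsotropic

namespace IsNearIsotropic

variable {X : Type*} [NormedAddCommGroup X] [InnerProductSpace ℝ X]
  {g : X → X} {B : X → X →L[ℝ] X} {z f₁ f₂ : X} {μ κ γ c s C R δ : ℝ}

theorem norm_grad_sub_le (h : IsNearIsotropic g B z f₁ f₂ μ κ γ c s C R δ)
    (hC : 0 ≤ C) (hδ : 0 ≤ δ) {ε D : ℝ} (hε : 0 ≤ ε) (hD : 1 ≤ D) (hεδ : ε + δ ≤ 1) {y : X}
    (hy : ‖y‖ ≤ D * ε) (hyR : ‖y‖ ≤ R) :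
    ‖g (z + y) - (c • f₁ + s • f₂)‖ ≤ 3 * C * D ^ 2 * (ε + δ) := by
  have hB := h.bound 0 (by simpa using (norm_nonneg y).trans hyR)
  rw [add_zero] at hB
  have k₁ : ‖B z y‖ ≤ C * (D * ε) := ((B z).le_of_opNorm_le hB y).trans (by gcongr)
  have k₂ : ‖g (z + y) - g z - B z y‖ ≤ C * (D * ε) ^ 2 :=
    (h.grad_taylor y hyR).trans (by gcongr)
  have e : g (z + y) - (c • f₁ + s • f₂)
      = (g (z + y) - g z - B z y) + B z y + (g z - (c • f₁ + s • f₂)) := by abel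
  rw [e]
  have hD2 : D ≤ D ^ 2 := by nlinarith
  have l₁ : C * (D * ε) ≤ C * D ^ 2 * (ε + δ) := by
    calc C * (D * ε) ≤ C * (D ^ 2 * (ε + δ)) := by gcongr; linarith
      _ = _ := by ring
  have l₂ : C * (D * ε) ^ 2 ≤ C * D ^ 2 * (ε + δ) := by
    have : ε ^ 2 ≤ ε + δ := by nlinarith
    calc C * (D * ε) ^ 2 = C * D ^ 2 * ε ^ 2 := by ring
      _ ≤ _ := by gcongr
  have l₃ : C * δ ≤ C * D ^ 2 * (ε + δ) := by
    have : δ ≤ D ^ 2 * (ε + δ) := by nlinarith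
    calc C * δ ≤ C * (D ^ 2 * (ε + δ)) := by gcongr
      _ = _ := by ring
  refine (norm_add₃_le).trans ?_
  linarith [h.grad_near]

/-- Contraction of the component of `y` orthogonal to the plane. -/
theorem perp_position_le (h : IsNearIsotropic g B z f₁ f₂ μ κ γ c s C R δ)
    (hC : 1 ≤ C) (hδ : 0 ≤ δ) (hc : |c| ≤ 1) (hs : |s| ≤ 1) {ε D : ℝ} (hε : 0 ≤ ε) (hD : 1 ≤ D)
    (hεδ : ε + δ ≤ 1) {y v : X} (hv : ‖v‖ = 1) (hy : ‖y‖ ≤ D * ε) (hyR : ‖y‖ ≤ R) :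
    inner ℝ (planePerp f₁ f₂ y) (-(g (z + y) - (2 * inner ℝ v (g (z + y))) • v))
      ≤ ‖planePerp f₁ f₂ y‖ * (-κ * ‖planePerp f₁ f₂ y‖ + C * D ^ 2 * ε ^ 2
          + 10 * C * D ^ 2 * ‖planePerp f₁ f₂ v‖) := by
  have hG := h.norm_grad_sub_le (by linarith) hδ hε hD hεδ hy hyR
  have hD2 : 1 ≤ C * D ^ 2 := by nlinarith
  have hGn : ‖g (z + y)‖ ≤ 5 * C * D ^ 2 := by
    have e : g (z + y) = (g (z + y) - (c • f₁ + s • f₂)) + c • f₁ + s • f₂ := by abel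
    rw [e]
    refine (norm_add₃_le).trans ?_
    rw [norm_smul, norm_smul, h.norm_left, h.norm_right, Real.norm_eq_abs, Real.norm_eq_abs]
    have : 3 * C * D ^ 2 * (ε + δ) ≤ 3 * C * D ^ 2 * 1 := by gcongr
    linarith
  have hp : |inner ℝ v (g (z + y))| ≤ 5 * C * D ^ 2 := by
    have := abs_real_inner_le_norm v (g (z + y)); rw [hv, one_mul] at this
    exact this.trans hGn
  have y₁ := inner_left_planePerp h.norm_left h.orth y
  have y₂ := inner_right_planePerp h.norm_right h.orth y
  have hco := h.coercive 0 (by simpa using (norm_nonneg y).trans hyR) _ y₁ y₂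
  have hmem := h.grad_mem _ y₁ y₂
  have hT := h.grad_taylor y hyR
  rw [real_inner_comm] at y₁ y₂
  rw [add_zero] at hco
  set w := planePerp f₁ f₂ y
  set u := planePerp f₁ f₂ v
  set p := inner ℝ v (g (z + y))
  have i₁ : inner ℝ w (B z y) = inner ℝ w (B z w) := by
    conv_lhs => rw [eq_add_planePerp f₁ f₂ y]
    simp only [map_add, map_smul, h.eig_left, h.eig_right, inner_add_right, inner_smul_right,
      y₁, y₂]
    ring
  have i₂ : inner ℝ w v = inner ℝ w u := by
    conv_lhs => rw [eq_add_planePerp f₁ f₂ v]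
    simp only [inner_add_right, inner_smul_right, y₁, y₂]
    ring
  have i₃ : inner ℝ w (g (z + y)) = inner ℝ w (g (z + y) - g z - B z y) + inner ℝ w (B z w) := by
    rw [inner_sub_right, inner_sub_right, hmem, i₁]; ring
  have k₁ : |inner ℝ w (g (z + y) - g z - B z y)| ≤ ‖w‖ * (C * D ^ 2 * ε ^ 2) := by
    refine (abs_real_inner_le_norm _ _).trans ?_
    gcongr
    calc _ ≤ C * ‖y‖ ^ 2 := hT
      _ ≤ C * (D * ε) ^ 2 := by gcongr
      _ = _ := by ring
  have k₂ : |2 * p * inner ℝ w u| ≤ ‖w‖ * (10 * C * D ^ 2 * ‖u‖) := by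
    rw [abs_mul, abs_mul, abs_two]
    calc 2 * |p| * |inner ℝ w u| ≤ 2 * (5 * C * D ^ 2) * (‖w‖ * ‖u‖) := by
          gcongr; exact abs_real_inner_le_norm _ _
      _ = _ := by ring
  have e : inner ℝ w (-(g (z + y) - (2 * p) • v))
      = -inner ℝ w (g (z + y)) + 2 * p * inner ℝ w u := by
    rw [inner_neg_right, inner_sub_right, inner_smul_right, i₂]; ring
  have e' : ‖w‖ * (-κ * ‖w‖ + C * D ^ 2 * ε ^ 2 + 10 * C * D ^ 2 * ‖u‖)
      = -(κ * ‖w‖ ^ 2) + ‖w‖ * (C * D ^ 2 * ε ^ 2) + ‖w‖ * (10 * C * D ^ 2 * ‖u‖) := by ring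
  rw [e, e', i₃]
  linarith [(abs_le.1 k₁).1, (abs_le.1 k₂).2]

/-- The planar components of the position equation. -/
theorem planar_position_velocity (h : IsNearIsotropic g B z f₁ f₂ μ κ γ c s C R δ)
    (hC : 1 ≤ C) (hδ : 0 ≤ δ) (hc : |c| ≤ 1) (hs : |s| ≤ 1) {ε D : ℝ} (hε : 0 ≤ ε) (hD : 1 ≤ D)
    (hεδ : ε + δ ≤ 1) {y v : X} (hv : ‖v‖ = 1) (hy : ‖y‖ ≤ D * ε) (hyR : ‖y‖ ≤ R)
    (hw : ‖planePerp f₁ f₂ v‖ ^ 2 ≤ ε + δ) :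
    |inner ℝ f₁ (-(g (z + y) - (2 * inner ℝ v (g (z + y))) • v))
        - ((inner ℝ f₁ v ^ 2 - inner ℝ f₂ v ^ 2) * c + 2 * inner ℝ f₁ v * inner ℝ f₂ v * s)|
      ≤ 10 * C * D ^ 2 * (ε + δ) ∧
    |inner ℝ f₂ (-(g (z + y) - (2 * inner ℝ v (g (z + y))) • v))
        - (2 * inner ℝ f₁ v * inner ℝ f₂ v * c - (inner ℝ f₁ v ^ 2 - inner ℝ f₂ v ^ 2) * s)|
      ≤ 10 * C * D ^ 2 * (ε + δ) := by
  have hG := h.norm_grad_sub_le (by linarith) hδ hε hD hεδ hy hyR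
  have hD2 : 1 ≤ C * D ^ 2 := by nlinarith
  set r := g (z + y) - (c • f₁ + s • f₂) with hr
  have e : g (z + y) = c • f₁ + s • f₂ + r := by rw [hr]; abel
  have v₁ : |inner ℝ f₁ v| ≤ 1 := hv ▸ abs_inner_le_of_norm_eq_one h.norm_left v
  have v₂ : |inner ℝ f₂ v| ≤ 1 := hv ▸ abs_inner_le_of_norm_eq_one h.norm_right v
  have hvr : |inner ℝ v r| ≤ 3 * C * D ^ 2 * (ε + δ) :=
    (abs_inner_le_of_norm_eq_one hv r).trans hG
  have hr₁ := (abs_inner_le_of_norm_eq_one h.norm_left r).trans hG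
  have hr₂ := (abs_inner_le_of_norm_eq_one h.norm_right r).trans hG
  have hn := norm_sq_eq_add_planePerp h.norm_left h.norm_right h.orth v
  have ho' : inner ℝ f₂ f₁ = 0 := by rw [real_inner_comm]; exact h.orth
  set W := ‖planePerp f₁ f₂ v‖ ^ 2
  have hW : 0 ≤ W := by positivity
  have hWθ : W ≤ C * D ^ 2 * (ε + δ) := by nlinarith
  rw [hv] at hn
  have hp : inner ℝ v (g (z + y)) = c * inner ℝ f₁ v + s * inner ℝ f₂ v + inner ℝ v r := by
    rw [e, inner_add_right, inner_add_right, inner_smul_right, inner_smul_right,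
      real_inner_comm f₁ v, real_inner_comm f₂ v]
  have hg₁ : inner ℝ f₁ (g (z + y)) = c + inner ℝ f₁ r := by
    rw [e]
    simp [inner_add_right, inner_smul_right, h.norm_left, h.orth]
  have hg₂ : inner ℝ f₂ (g (z + y)) = s + inner ℝ f₂ r := by
    rw [e]
    simp [inner_add_right, inner_smul_right, h.norm_right, ho']
  simp only [inner_neg_right, inner_sub_right, inner_smul_right, hp, hg₁, hg₂]
  set a := inner ℝ f₁ v
  set b := inner ℝ f₂ v
  have m : ∀ t τ : ℝ, |t| ≤ 1 → |τ| ≤ 3 * C * D ^ 2 * (ε + δ) →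
      |τ * t| ≤ 3 * C * D ^ 2 * (ε + δ) := fun t τ h₁ h₂ => by
    rw [abs_mul]; nlinarith [abs_nonneg t, abs_nonneg τ]
  have m₁ := m _ _ v₁ hvr
  have m₂ := m _ _ v₂ hvr
  have m₃ : |c * W| ≤ W := by rw [abs_mul, abs_of_nonneg hW]; nlinarith
  have m₄ : |s * W| ≤ W := by rw [abs_mul, abs_of_nonneg hW]; nlinarith
  constructor
  · have i : -(c + inner ℝ f₁ r - 2 * (c * a + s * b + inner ℝ v r) * a)
        - ((a ^ 2 - b ^ 2) * c + 2 * a * b * s)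
        = -(c * W) - inner ℝ f₁ r + 2 * (inner ℝ v r * a) := by
      linear_combination -c * hn
    rw [i]
    rw [abs_le] at *
    constructor <;> linarith
  · have i : -(s + inner ℝ f₂ r - 2 * (c * a + s * b + inner ℝ v r) * b)
        - (2 * a * b * c - (a ^ 2 - b ^ 2) * s)
        = -(s * W) - inner ℝ f₂ r + 2 * (inner ℝ v r * b) := by
      linear_combination -s * hn
    rw [i]
    rw [abs_le] at *
    constructor <;> linarith

/-- The planar components of the direction equation. -/
theorem planar_direction_velocity (h : IsNearIsotropic g B z f₁ f₂ μ κ γ c s C R δ)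
    (hC : 1 ≤ C) (hδ : 0 ≤ δ) {ε D K : ℝ} (hε : 0 ≤ ε) (hD : 1 ≤ D)
    {y v : X} (hv : ‖v‖ = 1) (hy : ‖y‖ ≤ D * ε) (hyR : ‖y‖ ≤ R)
    (hw : ‖planePerp f₁ f₂ v‖ ^ 2 ≤ ε + δ) (hwK : ‖planePerp f₁ f₂ v‖ ≤ K * (ε * (ε + δ))) :
    |inner ℝ f₁ (-(B (z + y) v - inner ℝ v (B (z + y) v) • v))
        + inner ℝ f₂ v * (2 * inner ℝ f₁ v * inner ℝ f₂ v * inner ℝ f₁ y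
            - (inner ℝ f₁ v ^ 2 - inner ℝ f₂ v ^ 2) * inner ℝ f₂ y)|
      ≤ (8 * C * D ^ 2 + 4 * C * K) * (ε * (ε + δ)) ∧
    |inner ℝ f₂ (-(B (z + y) v - inner ℝ v (B (z + y) v) • v))
        - inner ℝ f₁ v * (2 * inner ℝ f₁ v * inner ℝ f₂ v * inner ℝ f₁ y
            - (inner ℝ f₁ v ^ 2 - inner ℝ f₂ v ^ 2) * inner ℝ f₂ y)|
      ≤ (8 * C * D ^ 2 + 4 * C * K) * (ε * (ε + δ)) := by
  obtain ⟨r, hr, e⟩ := h.exists_hessian_apply_eq (by linarith) hδ hε hD hv hy hyR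
  obtain ⟨s₁, s₂⟩ := h.norm_planar_le hv hy
  have hμ := h.abs_eigenvalue_le ((norm_nonneg y).trans hyR)
  have hBw : ‖B (z + y) (planePerp f₁ f₂ v)‖ ≤ C * ‖planePerp f₁ f₂ v‖ :=
    (B (z + y)).le_of_opNorm_le (h.bound y hyR) _
  have v₁ : |inner ℝ f₁ v| ≤ 1 := hv ▸ abs_inner_le_of_norm_eq_one h.norm_left v
  have v₂ : |inner ℝ f₂ v| ≤ 1 := hv ▸ abs_inner_le_of_norm_eq_one h.norm_right v
  have hn := norm_sq_eq_add_planePerp h.norm_left h.norm_right h.orth v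
  have ho' : inner ℝ f₂ f₁ = 0 := by rw [real_inner_comm]; exact h.orth
  set w := planePerp f₁ f₂ v
  set r' := r + (B (z + y) w - μ • w) with hr'
  have hrn : ‖r'‖ ≤ (2 * C * D ^ 2 + 2 * C * K) * (ε * (ε + δ)) := by
    have k₀ : ‖μ • w‖ ≤ C * ‖w‖ := by rw [norm_smul, Real.norm_eq_abs]; gcongr
    have k₁ : C * ‖w‖ ≤ C * (K * (ε * (ε + δ))) := by gcongr
    refine (norm_add_le _ _).trans ?_
    have k₂ := norm_sub_le (B (z + y) w) (μ • w)
    calc _ ≤ 2 * C * D ^ 2 * (ε * (ε + δ)) + 2 * (C * (K * (ε * (ε + δ)))) := by linarith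
      _ = _ := by ring
  rw [add_assoc _ r, ← hr'] at e
  have hvr := (abs_inner_le_of_norm_eq_one hv r').trans hrn
  have hr₁ := (abs_inner_le_of_norm_eq_one h.norm_left r').trans hrn
  have hr₂ := (abs_inner_le_of_norm_eq_one h.norm_right r').trans hrn
  rw [hv] at hn
  set S₁ := 3 * inner ℝ f₁ v * inner ℝ f₁ y + inner ℝ f₂ v * inner ℝ f₂ y with hS₁
  set S₂ := inner ℝ f₁ v * inner ℝ f₂ y + inner ℝ f₂ v * inner ℝ f₁ y with hS₂
  clear_value S₁ S₂ r'
  have hp : inner ℝ v (B (z + y) v)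
      = μ + S₁ * inner ℝ f₁ v + S₂ * inner ℝ f₂ v + inner ℝ v r' := by
    conv_lhs => rw [e]
    rw [inner_add_right, inner_add_right, inner_add_right, inner_smul_right, inner_smul_right,
      inner_smul_right, real_inner_comm f₁ v, real_inner_comm f₂ v, real_inner_self_eq_norm_sq, hv]
    ring
  have hg₁ : inner ℝ f₁ (B (z + y) v) = μ * inner ℝ f₁ v + S₁ + inner ℝ f₁ r' := by
    rw [e]
    simp [inner_add_right, inner_smul_right, h.norm_left, h.orth]
  have hg₂ : inner ℝ f₂ (B (z + y) v) = μ * inner ℝ f₂ v + S₂ + inner ℝ f₂ r' := by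
    rw [e]
    simp [inner_add_right, inner_smul_right, h.norm_right, ho']
  simp only [inner_neg_right, inner_sub_right, inner_smul_right, hp, hg₁, hg₂]
  set a := inner ℝ f₁ v
  set b := inner ℝ f₂ v
  set Y₁ := inner ℝ f₁ y
  set Y₂ := inner ℝ f₂ y
  set W := ‖w‖ ^ 2
  have hW : 0 ≤ W := by positivity
  set E := (2 * C * D ^ 2 + 2 * C * K) * (ε * (ε + δ)) with hE
  have m : ∀ t τ : ℝ, |t| ≤ 1 → |τ| ≤ E → |τ * t| ≤ E := fun t τ h₁ h₂ => by
    rw [abs_mul]; nlinarith [abs_nonneg t, abs_nonneg τ]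
  have m₁ := m _ _ v₁ hvr
  have m₂ := m _ _ v₂ hvr
  have hb : W * (4 * (D * ε)) ≤ 4 * C * D ^ 2 * (ε * (ε + δ)) := by
    have : 4 * (D * ε) ≤ 4 * (C * D ^ 2 * ε) := by
      have : D ≤ C * D ^ 2 := by nlinarith
      gcongr
    calc W * (4 * (D * ε)) ≤ (ε + δ) * (4 * (C * D ^ 2 * ε)) := by gcongr
      _ = _ := by ring
  have m₃ : |W * S₁| ≤ 4 * C * D ^ 2 * (ε * (ε + δ)) := by
    rw [abs_mul, abs_of_nonneg hW]
    exact (mul_le_mul_of_nonneg_left s₁ hW).trans hb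
  have m₄ : |W * S₂| ≤ 4 * C * D ^ 2 * (ε * (ε + δ)) := by
    rw [abs_mul, abs_of_nonneg hW]
    refine (mul_le_mul_of_nonneg_left s₂ hW).trans (le_trans ?_ hb)
    gcongr; norm_num
  have hE2 : 4 * C * D ^ 2 * (ε * (ε + δ)) + 2 * E
      = (8 * C * D ^ 2 + 4 * C * K) * (ε * (ε + δ)) := by rw [hE]; ring
  rw [← hE2]
  clear_value a b Y₁ Y₂ W E
  have n₁ := abs_le.1 m₁
  have n₂ := abs_le.1 m₂
  have n₃ := abs_le.1 m₃
  have n₄ := abs_le.1 m₄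
  constructor
  · have i : -(μ * a + S₁ + inner ℝ f₁ r' - (μ + S₁ * a + S₂ * b + inner ℝ v r') * a)
        + b * (2 * a * b * Y₁ - (a ^ 2 - b ^ 2) * Y₂)
        = -(W * S₁) - inner ℝ f₁ r' + inner ℝ v r' * a := by
      linear_combination -S₁ * hn - b ^ 2 * hS₁ + a * b * hS₂
    have n₅ := abs_le.1 hr₁
    rw [i, abs_le]
    constructor <;> linarith
  · have i : -(μ * b + S₂ + inner ℝ f₂ r' - (μ + S₁ * a + S₂ * b + inner ℝ v r') * b)
        - a * (2 * a * b * Y₁ - (a ^ 2 - b ^ 2) * Y₂)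
        = -(W * S₂) - inner ℝ f₂ r' + inner ℝ v r' * b := by
      linear_combination -S₂ * hn - a ^ 2 * hS₂ + a * b * hS₁
    have n₅ := abs_le.1 hr₂
    rw [i, abs_le]
    constructor <;> linarith

end IsNearIsotropic

/-- If finitely many functions start negative and each of them decreases strictly whenever it
vanishes while the others are nonpositive, then all of them stay negative. -/
theorem forall_neg_of_barrier {ι : Type*} [Finite ι] (φ φ' : ι → ℝ → ℝ)
    (hc : ∀ i, ContinuousOn (φ i) (Ici 0)) (h0 : ∀ i, φ i 0 < 0)
    (hφ : ∀ t, 0 < t → (∀ j, φ j t ≤ 0) → ∀ i, φ i t = 0 →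
      HasDerivAt (φ i) (φ' i t) t ∧ φ' i t < 0) :
    ∀ t, 0 ≤ t → ∀ i, φ i t < 0 := by
  by_contra! hcon
  obtain ⟨t₁, ht₁, i₁, hi₁⟩ := hcon
  set S : Set ℝ := ⋃ i, (Ici 0 ∩ φ i ⁻¹' Ici 0) with hS
  have hclosed : IsClosed S :=
    isClosed_iUnion_of_finite fun i => (hc i).preimage_isClosed_of_isClosed isClosed_Ici isClosed_Ici
  have hne : S.Nonempty := ⟨t₁, mem_iUnion.2 ⟨i₁, ht₁, hi₁⟩⟩
  have hbdd : BddBelow S := ⟨0, fun t ht => by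
    obtain ⟨i, hi, -⟩ := mem_iUnion.1 ht; exact hi⟩
  set T := sInf S
  obtain ⟨i, hT0, hiT⟩ := mem_iUnion.1 (hclosed.csInf_mem hne hbdd)
  change 0 ≤ T at hT0
  change 0 ≤ φ i T at hiT
  have hTpos : 0 < T := lt_of_le_of_ne hT0 fun h => by
    rw [← h] at hiT; exact absurd (h0 i) (not_lt.2 hiT)
  have hbefore : ∀ j, ∀ t, 0 ≤ t → t < T → φ j t < 0 := fun j t ht htT => by
    by_contra! hj
    exact absurd (csInf_le hbdd (mem_iUnion.2 ⟨j, ht, hj⟩)) (not_le.2 htT)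
  have hle : ∀ j, φ j T ≤ 0 := fun j => by
    have hcT : Tendsto (φ j) (𝓝[<] T) (𝓝 (φ j T)) :=
      ((hc j).continuousAt (Ici_mem_nhds hTpos)).mono_left nhdsWithin_le_nhds
    refine le_of_tendsto hcT ?_
    filter_upwards [Ioo_mem_nhdsLT hTpos] with t ht using (hbefore j t ht.1.le ht.2).le
  have hi0 : φ i T = 0 := le_antisymm (hle i) hiT
  obtain ⟨hd, hneg⟩ := hφ T hTpos hle i hi0
  have hslope := (hasDerivAt_iff_tendsto_slope.1 hd).mono_left
    (nhdsWithin_mono T (fun t (ht : t < T) => ht.ne) : 𝓝[<] T ≤ 𝓝[≠] T)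
  have : 0 ≤ φ' i T := by
    refine ge_of_tendsto hslope ?_
    filter_upwards [Ioo_mem_nhdsLT hTpos] with t ht
    rw [slope_def_field, hi0]
    exact div_nonneg_of_nonpos (by linarith [hbefore i t ht.1.le ht.2]) (by linarith [ht.2])
  linarith

/-- The stable fixed point of the planar model system `a' = c - 2 b²`, `b' = -s + 2 a b`. -/
theorem exists_planar_fixedPoint {c s : ℝ} (hc : 0 < c) (hs : s ≠ 0) (hcs : c ^ 2 + s ^ 2 = 1) :
    ∃ a b : ℝ, 2 * b ^ 2 = c ∧ 2 * a * b = s ∧ a < 0 ∧ b ≠ 0 ∧ a ^ 2 + b ^ 2 = 1 / (2 * c) := by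
  have key : ∀ b : ℝ, b ^ 2 = c / 2 → b * s < 0 →
      ∃ a b : ℝ, 2 * b ^ 2 = c ∧ 2 * a * b = s ∧ a < 0 ∧ b ≠ 0 ∧ a ^ 2 + b ^ 2 = 1 / (2 * c) := by
    intro b hb hbs
    have hb0 : b ≠ 0 := fun h => by simp [h] at hbs
    refine ⟨s / (2 * b), b, by linarith, by field_simp, ?_, hb0, ?_⟩
    · have : s / (2 * b) = (b * s) / c := by
        rw [div_eq_div_iff (by simpa using hb0) hc.ne']; rw [show c = 2 * b ^ 2 by linarith]; ring
      rw [this]; exact div_neg_of_neg_of_pos hbs hc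
    · rw [div_pow, mul_pow, hb]
      field_simp
      linarith
  have hq : √(c / 2) ^ 2 = c / 2 := Real.sq_sqrt (by linarith)
  have hpos : 0 < √(c / 2) := Real.sqrt_pos.2 (by linarith)
  rcases lt_or_gt_of_ne hs with h | h
  · exact key _ hq (by nlinarith)
  · exact key (-√(c / 2)) (by rw [neg_sq, hq]) (by nlinarith)

/-- A quadratic Lyapunov function of the linearisation at the fixed point. -/
theorem exists_planar_lyapunov {a b : ℝ} (ha : a < 0) (hb : b ≠ 0) :
    ∃ k η : ℝ, |k| ≤ 1 / 2 ∧ 0 < η ∧ ∀ u h : ℝ,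
      2 * u * (-4 * b * h) + 4 * h * (2 * b * u + 2 * a * h)
        + 2 * k * ((-4 * b * h) * h + u * (2 * b * u + 2 * a * h)) ≤ -η * (u ^ 2 + h ^ 2) := by
  have hb2 : 0 < b ^ 2 := by positivity
  have ha2 : 0 < a ^ 2 := by nlinarith
  obtain ⟨τ, hτ, hτ1, hτ2⟩ : ∃ τ : ℝ, 0 < τ ∧ τ * |b| ≤ 1 / 2 ∧ τ * (8 * b ^ 2 + 2 * a ^ 2) ≤ -4 * a := by
    have hb' : 0 < |b| := abs_pos.2 hb
    refine ⟨min (1 / (2 * |b|)) (-4 * a / (8 * b ^ 2 + 2 * a ^ 2)), ?_, ?_, ?_⟩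
    · refine lt_min (by positivity) (div_pos (by linarith) (by positivity))
    · calc _ ≤ 1 / (2 * |b|) * |b| := by gcongr; exact min_le_left _ _
        _ = 1 / 2 := by field_simp
    · calc _ ≤ -4 * a / (8 * b ^ 2 + 2 * a ^ 2) * (8 * b ^ 2 + 2 * a ^ 2) := by
            gcongr; exact min_le_right _ _
        _ = -4 * a := by field_simp
  refine ⟨-τ * b, min (2 * τ * b ^ 2) (-4 * a), ?_, ?_, ?_⟩
  · rw [abs_mul, abs_neg, abs_of_pos hτ]; exact hτ1
  · exact lt_min (by positivity) (by linarith)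
  · intro u h
    have m₁ := min_le_left (2 * τ * b ^ 2) (-4 * a)
    have m₂ := min_le_right (2 * τ * b ^ 2) (-4 * a)
    have s₁ : min (2 * τ * b ^ 2) (-4 * a) * u ^ 2 ≤ 2 * τ * b ^ 2 * u ^ 2 := by gcongr
    have s₂ : min (2 * τ * b ^ 2) (-4 * a) * h ^ 2 ≤ -4 * a * h ^ 2 := by gcongr
    have s₃ : τ * (8 * b ^ 2 + 2 * a ^ 2) * h ^ 2 ≤ -4 * a * h ^ 2 := by gcongr
    have s₄ : 0 ≤ 2 * τ * (b * u + a * h) ^ 2 := by positivity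
    nlinarith

/-- Near the fixed point, the Lyapunov function decreases along perturbed trajectories as soon as
it exceeds the square of the perturbation size. -/
theorem planar_lyapunov_deriv_neg {a b c s k η : ℝ} (hc : 2 * b ^ 2 = c) (hs : 2 * a * b = s)
    (hk : |k| ≤ 1 / 2)
    (hη : ∀ u h : ℝ, 2 * u * (-4 * b * h) + 4 * h * (2 * b * u + 2 * a * h)
        + 2 * k * ((-4 * b * h) * h + u * (2 * b * u + 2 * a * h)) ≤ -η * (u ^ 2 + h ^ 2))
    {u h p r A Bd : ℝ} (hr : 0 < r) (hu : |u| ≤ 2 * r) (hh : |h| ≤ 2 * r)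
    (hQ : u ^ 2 + 2 * h ^ 2 + 2 * k * u * h = r ^ 2)
    (hA : |A - (c - 2 * (b + h) ^ 2)| ≤ p) (hB : |Bd - (-s + 2 * (a + u) * (b + h))| ≤ p)
    (hsmall : 128 * r ^ 2 + 16 * p < η / 3 * r) :
    2 * u * A + 4 * h * Bd + 2 * k * (A * h + u * Bd) < 0 := by
  obtain ⟨e, he⟩ : ∃ e, e = A - (c - 2 * (b + h) ^ 2) := ⟨_, rfl⟩
  obtain ⟨f, hf⟩ : ∃ f, f = Bd - (-s + 2 * (a + u) * (b + h)) := ⟨_, rfl⟩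
  rw [← he] at hA
  rw [← hf] at hB
  have hA' : A = -4 * b * h + (e - 2 * h ^ 2) := by rw [he, ← hc]; ring
  have hB' : Bd = 2 * b * u + 2 * a * h + (f + 2 * u * h) := by rw [hf, ← hs]; ring
  have hp : 0 ≤ p := (abs_nonneg _).trans hA
  have hη0 : 0 < η := by
    have : 0 < η / 3 * r := lt_of_le_of_lt (by positivity) hsmall
    linarith [pos_of_mul_pos_left this hr.le]
  have hlow : r ^ 2 ≤ 3 * (u ^ 2 + h ^ 2) := by
    have : 2 * k * u * h ≤ u ^ 2 + h ^ 2 := by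
      have h1 : |k * (u * h)| ≤ 1 / 2 * |u * h| := by rw [abs_mul]; gcongr
      have h2 : |u * h| ≤ (u ^ 2 + h ^ 2) / 2 := by
        rw [abs_le]; constructor <;> nlinarith [sq_nonneg (u + h), sq_nonneg (u - h)]
      nlinarith [le_abs_self (k * (u * h)), sq_nonneg u, sq_nonneg h]
    nlinarith [sq_nonneg u]
  have hE : |e - 2 * h ^ 2| ≤ p + 8 * r ^ 2 := by
    have : h ^ 2 ≤ (2 * r) ^ 2 := sq_le_sq' (abs_le.1 hh).1 (abs_le.1 hh).2
    rw [abs_le] at hA ⊢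
    constructor <;> linarith [sq_nonneg h]
  have hF : |f + 2 * u * h| ≤ p + 8 * r ^ 2 := by
    have : |u * h| ≤ 2 * r * (2 * r) := by rw [abs_mul]; gcongr
    rw [abs_le] at hB this ⊢
    constructor <;> linarith
  set E := e - 2 * h ^ 2
  set F := f + 2 * u * h
  have t₁ : |u * E| ≤ 2 * r * (p + 8 * r ^ 2) := by rw [abs_mul]; gcongr
  have t₂ : |h * F| ≤ 2 * r * (p + 8 * r ^ 2) := by rw [abs_mul]; gcongr
  have t₃ : |k * (h * E)| ≤ 1 / 2 * (2 * r * (p + 8 * r ^ 2)) := by rw [abs_mul, abs_mul]; gcongr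
  have t₄ : |k * (u * F)| ≤ 1 / 2 * (2 * r * (p + 8 * r ^ 2)) := by rw [abs_mul, abs_mul]; gcongr
  have main := hη u h
  have hlow' : η * r ^ 2 ≤ 3 * (η * (u ^ 2 + h ^ 2)) := by
    linarith [mul_le_mul_of_nonneg_left hlow hη0.le]
  have fin : 16 * (r * (p + 8 * r ^ 2)) < η / 3 * r ^ 2 := by
    linarith [mul_lt_mul_of_pos_left hsmall hr]
  clear_value E F
  rw [hA', hB']
  have e₁ : 2 * u * (-4 * b * h + E) + 4 * h * (2 * b * u + 2 * a * h + F)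
      + 2 * k * ((-4 * b * h + E) * h + u * (2 * b * u + 2 * a * h + F))
      = (2 * u * (-4 * b * h) + 4 * h * (2 * b * u + 2 * a * h)
        + 2 * k * ((-4 * b * h) * h + u * (2 * b * u + 2 * a * h)))
        + 2 * (u * E) + 4 * (h * F) + 2 * (k * (h * E)) + 2 * (k * (u * F)) := by ring
  rw [e₁]
  linarith [le_abs_self (u * E), le_abs_self (h * F), le_abs_self (k * (h * E)),
    le_abs_self (k * (u * F))]

/-- Real part of `ζ / v²`, where `ζ = y / ε` and the projections of `y`, `v` to the plane of
`f₁`, `f₂` are read as complex numbers (`v` of modulus one). -/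
noncomputable def planarRe {X : Type*} [NormedAddCommGroup X] [InnerProductSpace ℝ X]
    (f₁ f₂ : X) (ε : ℝ) (y v : X) : ℝ :=
  ε⁻¹ * (inner ℝ f₁ y * (inner ℝ f₁ v ^ 2 - inner ℝ f₂ v ^ 2)
    + inner ℝ f₂ y * (2 * inner ℝ f₁ v * inner ℝ f₂ v))

/-- Imaginary part of `ζ / v²`, see `planarRe`. -/
noncomputable def planarIm {X : Type*} [NormedAddCommGroup X] [InnerProductSpace ℝ X]
    (f₁ f₂ : X) (ε : ℝ) (y v : X) : ℝ :=
  ε⁻¹ * (inner ℝ f₂ y * (inner ℝ f₁ v ^ 2 - inner ℝ f₂ v ^ 2)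
    - inner ℝ f₁ y * (2 * inner ℝ f₁ v * inner ℝ f₂ v))

theorem exists_half_angle {p q : ℝ} (h : p ^ 2 + q ^ 2 = 1) :
    ∃ a b : ℝ, a ^ 2 + b ^ 2 = 1 ∧ a ^ 2 - b ^ 2 = p ∧ 2 * a * b = q := by
  have hp : -1 ≤ p ∧ p ≤ 1 := abs_le.1 (by rw [← sq_le_one_iff_abs_le_one]; nlinarith)
  have h₁ : √((1 + p) / 2) ^ 2 = (1 + p) / 2 := Real.sq_sqrt (by linarith)
  have h₂ : √((1 - p) / 2) ^ 2 = (1 - p) / 2 := Real.sq_sqrt (by linarith)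
  have h₃ : (2 * √((1 + p) / 2) * √((1 - p) / 2)) ^ 2 = q ^ 2 := by
    rw [mul_pow, mul_pow, h₁, h₂]; linarith
  rcases sq_eq_sq_iff_eq_or_eq_neg.1 h₃ with h₄ | h₄
  · exact ⟨_, _, by rw [h₁, h₂]; ring, by rw [h₁, h₂]; ring, h₄⟩
  · exact ⟨√((1 + p) / 2), -√((1 - p) / 2), by rw [neg_sq, h₁, h₂]; ring,
      by rw [neg_sq, h₁, h₂]; ring, by linarith⟩

set_option maxHeartbeats 1000000 in
/-- The perturbed planar model system in the rotating coordinates. -/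
theorem planar_model_velocity {c s D p W ζ₁ ζ₂ a b Y₁ Y₂ N₁ N₂ : ℝ}
    (hc : |c| ≤ 1) (hs : |s| ≤ 1) (hD : 0 ≤ D)
    (hζ₁ : |ζ₁| ≤ D) (hζ₂ : |ζ₂| ≤ D) (hW : 0 ≤ W) (hWp : W ≤ p) (hab : 1 = a ^ 2 + b ^ 2 + W)
    (hY₁ : |Y₁ - ((a ^ 2 - b ^ 2) * c + 2 * a * b * s)| ≤ p)
    (hY₂ : |Y₂ - (2 * a * b * c - (a ^ 2 - b ^ 2) * s)| ≤ p)
    (hN₁ : |N₁ + b * (2 * a * b * ζ₁ - (a ^ 2 - b ^ 2) * ζ₂)| ≤ p)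
    (hN₂ : |N₂ - a * (2 * a * b * ζ₁ - (a ^ 2 - b ^ 2) * ζ₂)| ≤ p) :
    |Y₁ * (a ^ 2 - b ^ 2) + Y₂ * (2 * a * b) + ζ₁ * (2 * (a * N₁ - b * N₂))
        + ζ₂ * (2 * (a * N₂ + b * N₁))
        - (c - 2 * (ζ₂ * (a ^ 2 - b ^ 2) - ζ₁ * (2 * a * b)) ^ 2)| ≤ (4 + 8 * D) * p ∧
    |Y₂ * (a ^ 2 - b ^ 2) - Y₁ * (2 * a * b) + ζ₂ * (2 * (a * N₁ - b * N₂))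
        - ζ₁ * (2 * (a * N₂ + b * N₁))
        - (-s + 2 * (ζ₁ * (a ^ 2 - b ^ 2) + ζ₂ * (2 * a * b))
            * (ζ₂ * (a ^ 2 - b ^ 2) - ζ₁ * (2 * a * b)))| ≤ (4 + 8 * D) * p := by
  have hp : 0 ≤ p := hW.trans hWp
  obtain ⟨e₁, he₁⟩ : ∃ e, e = Y₁ - ((a ^ 2 - b ^ 2) * c + 2 * a * b * s) := ⟨_, rfl⟩
  obtain ⟨e₂, he₂⟩ : ∃ e, e = Y₂ - (2 * a * b * c - (a ^ 2 - b ^ 2) * s) := ⟨_, rfl⟩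
  obtain ⟨n₁, hn₁⟩ : ∃ e, e = N₁ + b * (2 * a * b * ζ₁ - (a ^ 2 - b ^ 2) * ζ₂) := ⟨_, rfl⟩
  obtain ⟨n₂, hn₂⟩ : ∃ e, e = N₂ - a * (2 * a * b * ζ₁ - (a ^ 2 - b ^ 2) * ζ₂) := ⟨_, rfl⟩
  rw [← he₁] at hY₁
  rw [← he₂] at hY₂
  rw [← hn₁] at hN₁
  rw [← hn₂] at hN₂
  obtain ⟨q₁, hq₁⟩ : ∃ e, e = a ^ 2 - b ^ 2 := ⟨_, rfl⟩
  obtain ⟨q₂, hq₂⟩ : ∃ e, e = 2 * a * b := ⟨_, rfl⟩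
  have hq : q₁ ^ 2 + q₂ ^ 2 = 1 - W * (2 - W) := by
    have : a ^ 2 + b ^ 2 = 1 - W := by linarith
    rw [hq₁, hq₂, show (a ^ 2 - b ^ 2) ^ 2 + (2 * a * b) ^ 2 = (a ^ 2 + b ^ 2) ^ 2 by ring, this]
    ring
  have hW1 : W ≤ 1 := by nlinarith [sq_nonneg a, sq_nonneg b]
  have ha : |a| ≤ 1 := by rw [← sq_le_one_iff_abs_le_one]; nlinarith [sq_nonneg b]
  have hb : |b| ≤ 1 := by rw [← sq_le_one_iff_abs_le_one]; nlinarith [sq_nonneg a]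
  have hq₁' : |q₁| ≤ 1 := by rw [← sq_le_one_iff_abs_le_one]; nlinarith [sq_nonneg q₂]
  have hq₂' : |q₂| ≤ 1 := by rw [← sq_le_one_iff_abs_le_one]; nlinarith [sq_nonneg q₁]
  have mq : ∀ e q : ℝ, |e| ≤ p → |q| ≤ 1 → |e * q| ≤ p := fun e q h₁ h₂ => by
    rw [abs_mul]; nlinarith [abs_nonneg e, abs_nonneg q]
  have mW : ∀ e : ℝ, |e| ≤ 1 → |e * (W * (2 - W))| ≤ 2 * p := fun e h₁ => by
    rw [abs_mul, abs_of_nonneg (mul_nonneg hW (by linarith) : 0 ≤ W * (2 - W))]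
    nlinarith [abs_nonneg e, mul_nonneg hW (by linarith : 0 ≤ 2 - W)]
  have mz : ∀ ζ n v : ℝ, |ζ| ≤ D → |n| ≤ p → |v| ≤ 1 → |ζ * (n * v)| ≤ D * p :=
    fun ζ n v h₁ h₂ h₃ => by
      rw [abs_mul]; exact mul_le_mul h₁ (mq n v h₂ h₃) (abs_nonneg _) hD
  have x₁ := abs_le.1 (mq _ _ hY₁ hq₁')
  have x₂ := abs_le.1 (mq _ _ hY₁ hq₂')
  have x₃ := abs_le.1 (mq _ _ hY₂ hq₁')
  have x₄ := abs_le.1 (mq _ _ hY₂ hq₂')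
  have w₁ := abs_le.1 (mW _ hc)
  have w₂ := abs_le.1 (mW _ hs)
  have z₁ := abs_le.1 (mz _ _ _ hζ₁ hN₁ ha)
  have z₂ := abs_le.1 (mz _ _ _ hζ₁ hN₁ hb)
  have z₃ := abs_le.1 (mz _ _ _ hζ₁ hN₂ ha)
  have z₄ := abs_le.1 (mz _ _ _ hζ₁ hN₂ hb)
  have z₅ := abs_le.1 (mz _ _ _ hζ₂ hN₁ ha)
  have z₆ := abs_le.1 (mz _ _ _ hζ₂ hN₁ hb)
  have z₇ := abs_le.1 (mz _ _ _ hζ₂ hN₂ ha)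
  have z₈ := abs_le.1 (mz _ _ _ hζ₂ hN₂ hb)
  have hY₁' : Y₁ = q₁ * c + q₂ * s + e₁ := by rw [he₁, hq₁, hq₂]; ring
  have hY₂' : Y₂ = q₂ * c - q₁ * s + e₂ := by rw [he₂, hq₁, hq₂]; ring
  have hN₁' : N₁ = -b * (q₂ * ζ₁ - q₁ * ζ₂) + n₁ := by rw [hn₁, hq₁, hq₂]; ring
  have hN₂' : N₂ = a * (q₂ * ζ₁ - q₁ * ζ₂) + n₂ := by rw [hn₂, hq₁, hq₂]; ring
  rw [← hq₁, ← hq₂]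
  have i₁ : a * N₁ - b * N₂ = -q₂ * (q₂ * ζ₁ - q₁ * ζ₂) + (n₁ * a - n₂ * b) := by
    rw [hN₁', hN₂', hq₂]; ring
  have i₂ : a * N₂ + b * N₁ = q₁ * (q₂ * ζ₁ - q₁ * ζ₂) + (n₂ * a + n₁ * b) := by
    rw [hN₁', hN₂', hq₁]; ring
  rw [i₁, i₂, hY₁', hY₂']
  constructor
  · rw [show (q₁ * c + q₂ * s + e₁) * q₁ + (q₂ * c - q₁ * s + e₂) * q₂
        + ζ₁ * (2 * (-q₂ * (q₂ * ζ₁ - q₁ * ζ₂) + (n₁ * a - n₂ * b)))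
        + ζ₂ * (2 * (q₁ * (q₂ * ζ₁ - q₁ * ζ₂) + (n₂ * a + n₁ * b)))
        - (c - 2 * (ζ₂ * q₁ - ζ₁ * q₂) ^ 2)
        = -(c * (W * (2 - W))) + e₁ * q₁ + e₂ * q₂ + 2 * (ζ₁ * (n₁ * a)) - 2 * (ζ₁ * (n₂ * b))
          + 2 * (ζ₂ * (n₂ * a)) + 2 * (ζ₂ * (n₁ * b)) by linear_combination c * hq]
    rw [abs_le]
    constructor <;> linarith
  · rw [show (q₂ * c - q₁ * s + e₂) * q₁ - (q₁ * c + q₂ * s + e₁) * q₂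
        + ζ₂ * (2 * (-q₂ * (q₂ * ζ₁ - q₁ * ζ₂) + (n₁ * a - n₂ * b)))
        - ζ₁ * (2 * (q₁ * (q₂ * ζ₁ - q₁ * ζ₂) + (n₂ * a + n₁ * b)))
        - (-s + 2 * (ζ₁ * q₁ + ζ₂ * q₂) * (ζ₂ * q₁ - ζ₁ * q₂))
        = s * (W * (2 - W)) + e₂ * q₁ - e₁ * q₂ + 2 * (ζ₂ * (n₁ * a)) - 2 * (ζ₂ * (n₂ * b))
          - 2 * (ζ₁ * (n₂ * a)) - 2 * (ζ₁ * (n₁ * b)) by linear_combination -s * hq]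
    rw [abs_le]
    constructor <;> linarith

section Coordinates

variable {X : Type*} [NormedAddCommGroup X] [InnerProductSpace ℝ X] {f₁ f₂ : X}

/-- The rotating coordinates determine the length of the planar component of `y`. -/
theorem planar_norm_eq (h₁ : ‖f₁‖ = 1) (h₂ : ‖f₂‖ = 1) (h : inner ℝ f₁ f₂ = 0) {ε : ℝ}
    (hε : 0 < ε) {y v : X} (hv : ‖v‖ = 1) :
    √(inner ℝ f₁ y ^ 2 + inner ℝ f₂ y ^ 2) * (1 - ‖planePerp f₁ f₂ v‖ ^ 2)
      = ε * √(planarRe f₁ f₂ ε y v ^ 2 + planarIm f₁ f₂ ε y v ^ 2) := by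
  have hn := norm_sq_eq_add_planePerp h₁ h₂ h v
  rw [hv] at hn
  have e : planarRe f₁ f₂ ε y v ^ 2 + planarIm f₁ f₂ ε y v ^ 2
      = (inner ℝ f₁ y ^ 2 + inner ℝ f₂ y ^ 2) * (ε⁻¹ * (inner ℝ f₁ v ^ 2 + inner ℝ f₂ v ^ 2)) ^ 2 := by
    unfold planarRe planarIm; ring
  rw [e, Real.sqrt_mul (by positivity), Real.sqrt_sq (by positivity)]
  have : 1 - ‖planePerp f₁ f₂ v‖ ^ 2 = inner ℝ f₁ v ^ 2 + inner ℝ f₂ v ^ 2 := by linarith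
  rw [this]
  field_simp

theorem abs_sqrt_sub_sqrt_le (a b a₀ b₀ : ℝ) :
    |√(a ^ 2 + b ^ 2) - √(a₀ ^ 2 + b₀ ^ 2)| ≤ |a - a₀| + |b - b₀| := by
  have n : ∀ x y : ℝ, ‖(⟨x, y⟩ : ℂ)‖ = √(x ^ 2 + y ^ 2) := fun x y => by
    rw [Complex.norm_eq_sqrt_sq_add_sq]
  rw [← n, ← n]
  refine (abs_norm_sub_norm_le _ _).trans ?_
  exact Complex.norm_le_abs_re_add_abs_im _

/-- The radius is controlled by the rotating coordinates and the transversal components. -/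
theorem abs_norm_sub_radius_le (h₁ : ‖f₁‖ = 1) (h₂ : ‖f₂‖ = 1) (h : inner ℝ f₁ f₂ = 0) {ε : ℝ}
    (hε : 0 < ε) {y v : X} (hv : ‖v‖ = 1) (a₀ b₀ : ℝ) :
    |‖y‖ - ε * √(a₀ ^ 2 + b₀ ^ 2)| ≤ ε * (|planarRe f₁ f₂ ε y v - a₀|
      + |planarIm f₁ f₂ ε y v - b₀|) + ‖y‖ * ‖planePerp f₁ f₂ v‖ ^ 2 + ‖planePerp f₁ f₂ y‖ := by
  have hn := planar_norm_eq h₁ h₂ h hε (y := y) hv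
  have hs := abs_sqrt_sub_sqrt_le (planarRe f₁ f₂ ε y v) (planarIm f₁ f₂ ε y v) a₀ b₀
  have hy := norm_sq_eq_add_planePerp h₁ h₂ h y
  set r := √(inner ℝ f₁ y ^ 2 + inner ℝ f₂ y ^ 2) with hr
  have hr0 : 0 ≤ r := Real.sqrt_nonneg _
  have hr2 : r ^ 2 = inner ℝ f₁ y ^ 2 + inner ℝ f₂ y ^ 2 := Real.sq_sqrt (by positivity)
  set P := ‖planePerp f₁ f₂ y‖
  have hP : 0 ≤ P := norm_nonneg _
  rw [← hr2] at hy
  have l₁ : r ≤ ‖y‖ := by nlinarith [norm_nonneg y]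
  have l₂ : ‖y‖ ≤ r + P := by nlinarith [norm_nonneg y]
  set W := ‖planePerp f₁ f₂ v‖ ^ 2
  have hW : 0 ≤ W := by positivity
  have l₃ : r * W ≤ ‖y‖ * W := by gcongr
  have l₄ : |ε * √(planarRe f₁ f₂ ε y v ^ 2 + planarIm f₁ f₂ ε y v ^ 2)
      - ε * √(a₀ ^ 2 + b₀ ^ 2)| ≤ ε * (|planarRe f₁ f₂ ε y v - a₀|
      + |planarIm f₁ f₂ ε y v - b₀|) := by
    rw [← mul_sub, abs_mul, abs_of_pos hε]; gcongr
  rw [← hn] at l₄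
  have l₅ := abs_le.1 l₄
  have l₆ : 0 ≤ r * W := by positivity
  rw [abs_le]
  constructor <;> nlinarith

theorem planarRe_sub_le (h₁ : ‖f₁‖ = 1) (h₂ : ‖f₂‖ = 1) {ε θ L : ℝ} (hε : 0 < ε) (hε1 : ε ≤ 1)
    (hθ : 0 ≤ θ) (hL : 0 ≤ L) {y y₀ v v₀ : X} (hv : ‖v‖ = 1) (hv₀ : ‖v₀‖ = 1) (hy₀ : ‖y₀‖ ≤ L * ε)
    (hy : ‖y - y₀‖ ≤ ε * θ) (hvv : ‖v - v₀‖ ≤ ε * θ) :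
    |planarRe f₁ f₂ ε y v - planarRe f₁ f₂ ε y₀ v₀| ≤ (3 + 8 * L) * θ ∧
      |planarIm f₁ f₂ ε y v - planarIm f₁ f₂ ε y₀ v₀| ≤ (3 + 8 * L) * θ := by
  have hεθ : 0 ≤ ε * θ := by positivity
  have d : ∀ f : X, ‖f‖ = 1 → |inner ℝ f y - inner ℝ f y₀| ≤ ε * θ := fun f hf => by
    rw [← inner_sub_right]; exact (abs_inner_le_of_norm_eq_one hf _).trans hy
  have dv : ∀ f : X, ‖f‖ = 1 → |inner ℝ f v - inner ℝ f v₀| ≤ ε * θ := fun f hf => by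
    rw [← inner_sub_right]; exact (abs_inner_le_of_norm_eq_one hf _).trans hvv
  have bv : ∀ f : X, ‖f‖ = 1 → |inner ℝ f v| ≤ 1 := fun f hf =>
    hv ▸ abs_inner_le_of_norm_eq_one hf v
  have bv₀ : ∀ f : X, ‖f‖ = 1 → |inner ℝ f v₀| ≤ 1 := fun f hf =>
    hv₀ ▸ abs_inner_le_of_norm_eq_one hf v₀
  have by₀ : ∀ f : X, ‖f‖ = 1 → |inner ℝ f y₀| ≤ L * ε := fun f hf =>
    (abs_inner_le_of_norm_eq_one hf y₀).trans hy₀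
  have prod : ∀ a b a' b' : ℝ, |a| ≤ 1 → |b'| ≤ 1 → |a - a'| ≤ ε * θ → |b - b'| ≤ ε * θ →
      |a * b - a' * b'| ≤ 2 * (ε * θ) := by
    intro a b a' b' h₁ h₂ h₃ h₄
    rw [show a * b - a' * b' = a * (b - b') + (a - a') * b' by ring]
    refine (abs_add_le _ _).trans ?_
    rw [abs_mul, abs_mul]
    nlinarith [abs_nonneg a, abs_nonneg b', abs_nonneg (a - a'), abs_nonneg (b - b')]
  have p₁₁ := abs_le.1 (prod _ _ _ _ (bv _ h₁) (bv₀ _ h₁) (dv _ h₁) (dv _ h₁))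
  have p₂₂ := abs_le.1 (prod _ _ _ _ (bv _ h₂) (bv₀ _ h₂) (dv _ h₂) (dv _ h₂))
  have p₁₂ := abs_le.1 (prod _ _ _ _ (bv _ h₁) (bv₀ _ h₂) (dv _ h₁) (dv _ h₂))
  have hn : ∀ a b : ℝ, |a| ≤ 1 → |b| ≤ 1 → |a ^ 2 - b ^ 2| ≤ 1 := fun a b ha hb => by
    have := (sq_le_one_iff_abs_le_one a).2 ha
    have := (sq_le_one_iff_abs_le_one b).2 hb
    rw [abs_le]; constructor <;> nlinarith [sq_nonneg a, sq_nonneg b]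
  have hq₁ := hn _ _ (bv _ h₁) (bv _ h₂)
  have hq₂ : |2 * inner ℝ f₁ v * inner ℝ f₂ v| ≤ 2 := by
    rw [abs_mul, abs_mul, abs_two]
    nlinarith [bv _ h₁, bv _ h₂, abs_nonneg (inner ℝ f₁ v), abs_nonneg (inner ℝ f₂ v)]
  have D₁ : |(inner ℝ f₁ v ^ 2 - inner ℝ f₂ v ^ 2) - (inner ℝ f₁ v₀ ^ 2 - inner ℝ f₂ v₀ ^ 2)|
      ≤ 4 * (ε * θ) := by rw [abs_le]; constructor <;> nlinarith
  have D₂ : |2 * inner ℝ f₁ v * inner ℝ f₂ v - 2 * inner ℝ f₁ v₀ * inner ℝ f₂ v₀|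
      ≤ 4 * (ε * θ) := by rw [abs_le]; constructor <;> nlinarith
  have k : ∀ y q y' q' m : ℝ, |q| ≤ m → |y - y'| ≤ ε * θ → |y'| ≤ L * ε → |q - q'| ≤ 4 * (ε * θ) →
      |ε⁻¹ * (y * q) - ε⁻¹ * (y' * q')| ≤ (m + 4 * L) * θ := by
    intro y q y' q' m k₁ k₂ k₃ k₄
    rw [← mul_sub, abs_mul, abs_inv, abs_of_pos hε, inv_mul_le_iff₀ hε,
      show y * q - y' * q' = (y - y') * q + y' * (q - q') by ring]
    refine (abs_add_le _ _).trans ?_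
    rw [abs_mul, abs_mul]
    have l₁ : |y - y'| * |q| ≤ ε * θ * m := by gcongr
    have l₂ : |y'| * |q - q'| ≤ L * ε * (4 * (ε * θ)) := by gcongr
    have l₃ : L * ε * (4 * (ε * θ)) ≤ L * 1 * (4 * (ε * θ)) := by gcongr
    linarith
  have a₁ := abs_le.1 (k _ _ _ _ _ hq₁ (d _ h₁) (by₀ _ h₁) D₁)
  have a₂ := abs_le.1 (k _ _ _ _ _ hq₂ (d _ h₂) (by₀ _ h₂) D₂)
  have a₃ := abs_le.1 (k _ _ _ _ _ hq₁ (d _ h₂) (by₀ _ h₂) D₁)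
  have a₄ := abs_le.1 (k _ _ _ _ _ hq₂ (d _ h₁) (by₀ _ h₁) D₂)
  unfold planarRe planarIm
  rw [mul_add, mul_add, mul_sub, mul_sub]
  constructor <;> rw [abs_le] <;> constructor <;> linarith

/-- Directions for which the rotating coordinates take prescribed values. -/
theorem exists_unit_planar_eq (h₁ : ‖f₁‖ = 1) (h₂ : ‖f₂‖ = 1) (h : inner ℝ f₁ f₂ = 0)
    {ε a b : ℝ} (hε : 0 < ε) (hab : 0 < a ^ 2 + b ^ 2) {y : X} (hy : planePerp f₁ f₂ y = 0)
    (hyn : ‖y‖ ^ 2 = ε ^ 2 * (a ^ 2 + b ^ 2)) :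
    ∃ v : X, ‖v‖ = 1 ∧ planePerp f₁ f₂ v = 0 ∧ planarRe f₁ f₂ ε y v = a ∧
      planarIm f₁ f₂ ε y v = b := by
  have ho' : inner ℝ f₂ f₁ = 0 := by rw [real_inner_comm]; exact h
  have hn := norm_sq_eq_add_planePerp h₁ h₂ h y
  rw [hy, hyn] at hn
  set y₁ := inner ℝ f₁ y with hy₁
  set y₂ := inner ℝ f₂ y with hy₂
  have hn' : y₁ ^ 2 + y₂ ^ 2 = ε ^ 2 * (a ^ 2 + b ^ 2) := by simp at hn; linarith
  obtain ⟨v₁, v₂, hv, hv₁, hv₂⟩ := exists_half_angle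
    (p := (a * y₁ + b * y₂) / (ε * (a ^ 2 + b ^ 2)))
    (q := (a * y₂ - b * y₁) / (ε * (a ^ 2 + b ^ 2))) (by
      rw [div_pow, div_pow, ← add_div, div_eq_one_iff_eq (by positivity)]
      linear_combination (a ^ 2 + b ^ 2) * hn')
  have i₁ : inner ℝ f₁ (v₁ • f₁ + v₂ • f₂) = v₁ := by
    simp [inner_add_right, inner_smul_right, h₁, h]
  have i₂ : inner ℝ f₂ (v₁ • f₁ + v₂ • f₂) = v₂ := by
    simp [inner_add_right, inner_smul_right, h₂, ho']
  have hp : planePerp f₁ f₂ (v₁ • f₁ + v₂ • f₂) = 0 := by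
    rw [planePerp, i₁, i₂]; abel
  refine ⟨v₁ • f₁ + v₂ • f₂, ?_, hp, ?_, ?_⟩
  · have := norm_sq_eq_add_planePerp h₁ h₂ h (v₁ • f₁ + v₂ • f₂)
    rw [hp, i₁, i₂, hv] at this
    rw [← sq_eq_sq₀ (norm_nonneg _) zero_le_one, this]; simp
  · rw [planarRe, i₁, i₂, hv₁, hv₂, ← hy₁, ← hy₂]
    field_simp
    linear_combination a * hn'
  · rw [planarIm, i₁, i₂, hv₁, hv₂, ← hy₁, ← hy₂]
    field_simp
    linear_combination b * hn'

section Derivatives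

variable {y v : ℝ → X} {Y V : X} {t : ℝ}

theorem hasDerivAt_inner_const_left (hv : HasDerivAt v V t) (f : X) :
    HasDerivAt (fun t => inner ℝ f (v t)) (inner ℝ f V) t := by
  simpa using (hasDerivAt_const t f).inner ℝ hv

theorem hasDerivAt_norm_planePerp_sq (h₁ : ‖f₁‖ = 1) (h₂ : ‖f₂‖ = 1) (h : inner ℝ f₁ f₂ = 0)
    (hv : HasDerivAt v V t) :
    HasDerivAt (fun t => ‖planePerp f₁ f₂ (v t)‖ ^ 2) (2 * inner ℝ (planePerp f₁ f₂ (v t)) V) t := by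
  have hd : HasDerivAt (fun t => planePerp f₁ f₂ (v t)) (planePerp f₁ f₂ V) t :=
    (hv.sub ((hasDerivAt_inner_const_left hv f₁).smul_const f₁)).sub ((hasDerivAt_inner_const_left hv f₂).smul_const f₂)
  have e₁ := inner_left_planePerp h₁ h (v t)
  have e₂ := inner_right_planePerp h₂ h (v t)
  rw [real_inner_comm] at e₁ e₂
  have e : inner ℝ (planePerp f₁ f₂ (v t)) (planePerp f₁ f₂ V)
      = inner ℝ (planePerp f₁ f₂ (v t)) V := by
    conv_rhs => rw [eq_add_planePerp f₁ f₂ V]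
    simp only [inner_add_right, inner_smul_right, e₁, e₂]
    ring
  rw [← e]
  exact hd.norm_sq

theorem hasDerivAt_planarRe (ε : ℝ) (hy : HasDerivAt y Y t) (hv : HasDerivAt v V t) :
    HasDerivAt (fun t => planarRe f₁ f₂ ε (y t) (v t))
      (ε⁻¹ * (inner ℝ f₁ Y * (inner ℝ f₁ (v t) ^ 2 - inner ℝ f₂ (v t) ^ 2)
        + inner ℝ f₂ Y * (2 * inner ℝ f₁ (v t) * inner ℝ f₂ (v t))
        + inner ℝ f₁ (y t) * (2 * (inner ℝ f₁ (v t) * inner ℝ f₁ V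
            - inner ℝ f₂ (v t) * inner ℝ f₂ V))
        + inner ℝ f₂ (y t) * (2 * (inner ℝ f₁ (v t) * inner ℝ f₂ V
            + inner ℝ f₂ (v t) * inner ℝ f₁ V)))) t := by
  have a := hasDerivAt_inner_const_left hv f₁
  have b := hasDerivAt_inner_const_left hv f₂
  have := (((hasDerivAt_inner_const_left hy f₁).mul ((a.pow 2).sub (b.pow 2))).add
    ((hasDerivAt_inner_const_left hy f₂).mul ((a.const_mul 2).mul b))).const_mul ε⁻¹
  refine this.congr_deriv ?_
  simp only [Pi.sub_apply, Pi.pow_apply, Pi.mul_apply]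
  push_cast
  ring

theorem hasDerivAt_planarIm (ε : ℝ) (hy : HasDerivAt y Y t) (hv : HasDerivAt v V t) :
    HasDerivAt (fun t => planarIm f₁ f₂ ε (y t) (v t))
      (ε⁻¹ * (inner ℝ f₂ Y * (inner ℝ f₁ (v t) ^ 2 - inner ℝ f₂ (v t) ^ 2)
        - inner ℝ f₁ Y * (2 * inner ℝ f₁ (v t) * inner ℝ f₂ (v t))
        + inner ℝ f₂ (y t) * (2 * (inner ℝ f₁ (v t) * inner ℝ f₁ V
            - inner ℝ f₂ (v t) * inner ℝ f₂ V))
        - inner ℝ f₁ (y t) * (2 * (inner ℝ f₁ (v t) * inner ℝ f₂ V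
            + inner ℝ f₂ (v t) * inner ℝ f₁ V)))) t := by
  have a := hasDerivAt_inner_const_left hv f₁
  have b := hasDerivAt_inner_const_left hv f₂
  have := (((hasDerivAt_inner_const_left hy f₂).mul ((a.pow 2).sub (b.pow 2))).sub
    ((hasDerivAt_inner_const_left hy f₁).mul ((a.const_mul 2).mul b))).const_mul ε⁻¹
  refine this.congr_deriv ?_
  simp only [Pi.sub_apply, Pi.pow_apply, Pi.mul_apply]
  push_cast
  ring

end Derivatives

end Coordinates

namespace IsNearIsotropic

variable {X : Type*} [NormedAddCommGroup X] [InnerProductSpace ℝ X]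
  {g : X → X} {B : X → X →L[ℝ] X} {z f₁ f₂ : X} {μ κ γ c s C R δ : ℝ}

theorem rotating_coordinates_velocity (h : IsNearIsotropic g B z f₁ f₂ μ κ γ c s C R δ)
    (hC : 1 ≤ C) (hδ : 0 ≤ δ) (hc : |c| ≤ 1) (hs : |s| ≤ 1) {ε D K : ℝ} (hε : 0 < ε) (hD : 1 ≤ D)
    (hK : 0 ≤ K) (hεδ : ε + δ ≤ 1) {y v : X} (hv : ‖v‖ = 1) (hy : ‖y‖ ≤ D * ε) (hyR : ‖y‖ ≤ R)
    (hw : ‖planePerp f₁ f₂ v‖ ^ 2 ≤ ε + δ) (hwK : ‖planePerp f₁ f₂ v‖ ≤ K * (ε * (ε + δ)))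
    {Y V : X} (hY : Y = -(g (z + y) - (2 * inner ℝ v (g (z + y))) • v))
    (hV : V = (ε ^ 2)⁻¹ • -(B (z + y) v - inner ℝ v (B (z + y) v) • v)) :
    |ε * (ε⁻¹ * (inner ℝ f₁ Y * (inner ℝ f₁ v ^ 2 - inner ℝ f₂ v ^ 2)
        + inner ℝ f₂ Y * (2 * inner ℝ f₁ v * inner ℝ f₂ v)
        + inner ℝ f₁ y * (2 * (inner ℝ f₁ v * inner ℝ f₁ V - inner ℝ f₂ v * inner ℝ f₂ V))
        + inner ℝ f₂ y * (2 * (inner ℝ f₁ v * inner ℝ f₂ V + inner ℝ f₂ v * inner ℝ f₁ V))))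
      - (c - 2 * planarIm f₁ f₂ ε y v ^ 2)|
      ≤ (4 + 8 * D) * (18 * C * D ^ 2 + 4 * C * K) * (ε + δ) ∧
    |ε * (ε⁻¹ * (inner ℝ f₂ Y * (inner ℝ f₁ v ^ 2 - inner ℝ f₂ v ^ 2)
        - inner ℝ f₁ Y * (2 * inner ℝ f₁ v * inner ℝ f₂ v)
        + inner ℝ f₂ y * (2 * (inner ℝ f₁ v * inner ℝ f₁ V - inner ℝ f₂ v * inner ℝ f₂ V))
        - inner ℝ f₁ y * (2 * (inner ℝ f₁ v * inner ℝ f₂ V + inner ℝ f₂ v * inner ℝ f₁ V))))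
      - (-s + 2 * planarRe f₁ f₂ ε y v * planarIm f₁ f₂ ε y v)|
      ≤ (4 + 8 * D) * (18 * C * D ^ 2 + 4 * C * K) * (ε + δ) := by
  obtain ⟨p₁, p₂⟩ := h.planar_position_velocity hC hδ hc hs hε.le hD hεδ hv hy hyR hw
  obtain ⟨n₁, n₂⟩ := h.planar_direction_velocity hC hδ hε.le hD hv hy hyR hw hwK
  rw [← hY] at p₁ p₂
  have hθ : 0 ≤ ε + δ := by linarith
  have hCD : 1 ≤ C * D ^ 2 := by nlinarith
  have hCK : 0 ≤ C * K := by positivity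
  have c₁ : 10 * C * D ^ 2 * (ε + δ) ≤ (18 * C * D ^ 2 + 4 * C * K) * (ε + δ) := by
    gcongr; linarith
  have c₂ : ε⁻¹ * ((8 * C * D ^ 2 + 4 * C * K) * (ε * (ε + δ)))
      ≤ (18 * C * D ^ 2 + 4 * C * K) * (ε + δ) := by
    rw [show ε⁻¹ * ((8 * C * D ^ 2 + 4 * C * K) * (ε * (ε + δ)))
      = (8 * C * D ^ 2 + 4 * C * K) * (ε + δ) by field_simp]
    gcongr; linarith
  have c₃ : ε + δ ≤ (18 * C * D ^ 2 + 4 * C * K) * (ε + δ) := by nlinarith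
  have hz : ∀ f : X, ‖f‖ = 1 → |ε⁻¹ * inner ℝ f y| ≤ D := fun f hf => by
    rw [abs_mul, abs_inv, abs_of_pos hε, inv_mul_le_iff₀ hε]
    calc _ ≤ ‖y‖ := abs_inner_le_of_norm_eq_one hf y
      _ ≤ ε * D := by linarith
  have hN : ∀ f : X, ε * inner ℝ f V
      = ε⁻¹ * inner ℝ f (-(B (z + y) v - inner ℝ v (B (z + y) v) • v)) := fun f => by
    rw [hV, inner_smul_right]; field_simp
  have hn := norm_sq_eq_add_planePerp h.norm_left h.norm_right h.orth v
  rw [hv, one_pow] at hn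
  have key := planar_model_velocity (ζ₁ := ε⁻¹ * inner ℝ f₁ y) (ζ₂ := ε⁻¹ * inner ℝ f₂ y)
    (N₁ := ε * inner ℝ f₁ V) (N₂ := ε * inner ℝ f₂ V) hc hs (by linarith) (hz _ h.norm_left)
    (hz _ h.norm_right) (sq_nonneg _) (hw.trans c₃) hn (p₁.trans c₁) (p₂.trans c₁)
    (by
      rw [hN]
      refine le_trans (le_of_eq_of_le ?_ (mul_le_mul_of_nonneg_left n₁ (inv_nonneg.2 hε.le))) c₂
      rw [← abs_of_pos (inv_pos.2 hε), ← abs_mul, abs_of_pos (inv_pos.2 hε)]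
      congr 1; ring)
    (by
      rw [hN]
      refine le_trans (le_of_eq_of_le ?_ (mul_le_mul_of_nonneg_left n₂ (inv_nonneg.2 hε.le))) c₂
      rw [← abs_of_pos (inv_pos.2 hε), ← abs_mul, abs_of_pos (inv_pos.2 hε)]
      congr 1; ring)
  rw [mul_assoc (4 + 8 * D)]
  refine ⟨le_of_eq_of_le ?_ key.1, le_of_eq_of_le ?_ key.2⟩
  · congr 1
    unfold planarIm
    field_simp
  · congr 1
    unfold planarIm planarRe
    field_simp

end IsNearIsotropic

theorem abs_le_of_planar_lyapunov_le {k u h r : ℝ} (hk : |k| ≤ 1 / 2) (hr : 0 ≤ r)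
    (hQ : u ^ 2 + 2 * h ^ 2 + 2 * k * u * h ≤ r ^ 2) : |u| ≤ 2 * r ∧ |h| ≤ 2 * r := by
  have h1 : |k * (u * h)| ≤ 1 / 2 * |u * h| := by rw [abs_mul]; gcongr
  have h2 : |u * h| ≤ (u ^ 2 + h ^ 2) / 2 := by
    rw [abs_le]; constructor <;> nlinarith [sq_nonneg (u + h), sq_nonneg (u - h)]
  have h3 := neg_abs_le (k * (u * h))
  constructor <;> refine abs_le_of_sq_le_sq ?_ (by linarith) <;>
    nlinarith [sq_nonneg u, sq_nonneg h]

/-- Numerical constants for the trapping region around the limit cycle. -/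
structure IsTrappingConstants (a b k η c s C R κ γ D Kv Ky K θ : ℝ) : Prop where
  left : 2 * b ^ 2 = c
  right : 2 * a * b = s
  abs_c : |c| ≤ 1
  abs_s : |s| ≤ 1
  abs_k : |k| ≤ 1 / 2
  lyapunov : ∀ u h : ℝ, 2 * u * (-4 * b * h) + 4 * h * (2 * b * u + 2 * a * h)
    + 2 * k * ((-4 * b * h) * h + u * (2 * b * u + 2 * a * h)) ≤ -η * (u ^ 2 + h ^ 2)
  C_ge : 1 ≤ C
  D_eq : D = 2 * (|a| + |b| + 3)
  Kv_ge : 1 ≤ Kv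
  Ky_ge : 1 ≤ Ky
  K_pos : 0 < K
  theta_pos : 0 < θ
  theta_le : θ ≤ 1
  Kv_large : 2 * C * D ^ 2 < γ / 2 * Kv
  Ky_large : C * D ^ 2 + 10 * C * D ^ 2 * Kv < κ * Ky
  Kv_small : Kv * θ ≤ 1 / 2
  Ky_small : Ky * θ ≤ 1
  K_small : 2 * (K * θ) ≤ 1
  radius : D * θ ≤ R
  gap_small : θ * (6 * D + 2 * C * D ^ 2 + 2 * C) ≤ γ / 2
  lyapunov_small : 128 * (K * θ) ^ 2
    + 16 * ((4 + 8 * D) * (18 * C * D ^ 2 + 4 * C * Kv) * θ) < η / 3 * (K * θ)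

namespace IsTrappingConstants

variable {X : Type*} [NormedAddCommGroup X] [InnerProductSpace ℝ X]
  {g : X → X} {B : X → X →L[ℝ] X} {z f₁ f₂ : X} {μ κ γ c s C R δ : ℝ}
  {a b k η D Kv Ky K ε : ℝ}

theorem perp_le (hT : IsTrappingConstants a b k η c s C R κ γ D Kv Ky K (ε + δ))
    (hε : 0 < ε) {w : ℝ} (hw : w ≤ Kv * (ε * (ε + δ))) :
    w ≤ ε / 2 := by
  have := mul_le_mul_of_nonneg_left hT.Kv_small hε.le
  linarith

/-- In the trapping region, positions stay at distance `O(ε)`. -/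
theorem norm_le (h : IsNearIsotropic g B z f₁ f₂ μ κ γ c s C R δ)
    (hT : IsTrappingConstants a b k η c s C R κ γ D Kv Ky K (ε + δ)) (hε : 0 < ε) (hδ : 0 ≤ δ)
    {y v : X} (hv : ‖v‖ = 1) (hw : ‖planePerp f₁ f₂ v‖ ≤ Kv * (ε * (ε + δ)))
    (hyp : ‖planePerp f₁ f₂ y‖ ≤ Ky * (ε * (ε + δ)))
    (hQ : (planarRe f₁ f₂ ε y v - a) ^ 2 + 2 * (planarIm f₁ f₂ ε y v - b) ^ 2
      + 2 * k * (planarRe f₁ f₂ ε y v - a) * (planarIm f₁ f₂ ε y v - b) ≤ (K * (ε + δ)) ^ 2) :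
    ‖y‖ ≤ D * ε ∧ |‖y‖ - ε * √(a ^ 2 + b ^ 2)| ≤ (4 * K + D + Ky) * ε * (ε + δ) := by
  have hw2 := hT.perp_le hε hw
  have hε1 : ε ≤ 1 := by linarith [hT.theta_le]
  have hKθ : 0 ≤ K * (ε + δ) := mul_nonneg hT.K_pos.le hT.theta_pos.le
  obtain ⟨hu, hh⟩ := abs_le_of_planar_lyapunov_le hT.abs_k hKθ hQ
  have hKs := hT.K_small
  have hy2 : ‖planePerp f₁ f₂ y‖ ≤ ε := by
    have := mul_le_mul_of_nonneg_left hT.Ky_small hε.le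
    linarith
  have hW0 := norm_nonneg (planePerp f₁ f₂ v)
  have hW : ‖planePerp f₁ f₂ v‖ ^ 2 ≤ 1 / 4 := by nlinarith
  have hA : |planarRe f₁ f₂ ε y v| ≤ |a| + 1 := by
    have := abs_sub_abs_le_abs_sub (planarRe f₁ f₂ ε y v) a; linarith
  have hB : |planarIm f₁ f₂ ε y v| ≤ |b| + 1 := by
    have := abs_sub_abs_le_abs_sub (planarIm f₁ f₂ ε y v) b; linarith
  have hyD : ‖y‖ ≤ D * ε := by
    have k₁ := abs_norm_sub_radius_le h.norm_left h.norm_right h.orth hε (y := y) hv 0 0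
    simp only [ne_eq, OfNat.ofNat_ne_zero, not_false_eq_true, zero_pow, add_zero, Real.sqrt_zero,
      mul_zero, sub_zero, abs_norm] at k₁
    have k₂ : ‖y‖ * ‖planePerp f₁ f₂ v‖ ^ 2 ≤ ‖y‖ * (1 / 4) := by gcongr
    have k₃ : ε * (|planarRe f₁ f₂ ε y v| + |planarIm f₁ f₂ ε y v|)
        ≤ ε * ((|a| + 1) + (|b| + 1)) := by gcongr
    rw [hT.D_eq]
    have : 0 ≤ ε * (|a| + |b| + 3) := by positivity
    linarith
  refine ⟨hyD, ?_⟩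
  refine (abs_norm_sub_radius_le h.norm_left h.norm_right h.orth hε (y := y) hv a b).trans ?_
  have k₁ : ε * (|planarRe f₁ f₂ ε y v - a| + |planarIm f₁ f₂ ε y v - b|)
      ≤ ε * (2 * (K * (ε + δ)) + 2 * (K * (ε + δ))) := by gcongr
  have k₂ : ‖y‖ * ‖planePerp f₁ f₂ v‖ ^ 2 ≤ D * ε * (ε + δ) := by
    have : ‖planePerp f₁ f₂ v‖ ^ 2 ≤ ε + δ := by nlinarith
    have hD : 0 ≤ D := by rw [hT.D_eq]; positivity
    gcongr
  linarith

/-- The vector field points inward on the boundary of the trapping region. -/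
theorem velocity_inward (h : IsNearIsotropic g B z f₁ f₂ μ κ γ c s C R δ)
    (hT : IsTrappingConstants a b k η c s C R κ γ D Kv Ky K (ε + δ)) (hε : 0 < ε) (hδ : 0 ≤ δ)
    {y v : X} (hv : ‖v‖ = 1) (hw : ‖planePerp f₁ f₂ v‖ ≤ Kv * (ε * (ε + δ)))
    (hyp : ‖planePerp f₁ f₂ y‖ ≤ Ky * (ε * (ε + δ)))
    (hQ : (planarRe f₁ f₂ ε y v - a) ^ 2 + 2 * (planarIm f₁ f₂ ε y v - b) ^ 2
      + 2 * k * (planarRe f₁ f₂ ε y v - a) * (planarIm f₁ f₂ ε y v - b) ≤ (K * (ε + δ)) ^ 2)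
    {Y V : X} (hY : Y = -(g (z + y) - (2 * inner ℝ v (g (z + y))) • v))
    (hV : V = (ε ^ 2)⁻¹ • -(B (z + y) v - inner ℝ v (B (z + y) v) • v)) :
    (‖planePerp f₁ f₂ v‖ = Kv * (ε * (ε + δ)) → inner ℝ (planePerp f₁ f₂ v) V < 0) ∧
    (‖planePerp f₁ f₂ y‖ = Ky * (ε * (ε + δ)) → inner ℝ (planePerp f₁ f₂ y) Y < 0) ∧
    ((planarRe f₁ f₂ ε y v - a) ^ 2 + 2 * (planarIm f₁ f₂ ε y v - b) ^ 2
      + 2 * k * (planarRe f₁ f₂ ε y v - a) * (planarIm f₁ f₂ ε y v - b) = (K * (ε + δ)) ^ 2 →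
      ∀ A' B', A' = (ε⁻¹ * (inner ℝ f₁ Y * (inner ℝ f₁ v ^ 2 - inner ℝ f₂ v ^ 2)
        + inner ℝ f₂ Y * (2 * inner ℝ f₁ v * inner ℝ f₂ v)
        + inner ℝ f₁ y * (2 * (inner ℝ f₁ v * inner ℝ f₁ V - inner ℝ f₂ v * inner ℝ f₂ V))
        + inner ℝ f₂ y * (2 * (inner ℝ f₁ v * inner ℝ f₂ V + inner ℝ f₂ v * inner ℝ f₁ V)))) →
      B' = (ε⁻¹ * (inner ℝ f₂ Y * (inner ℝ f₁ v ^ 2 - inner ℝ f₂ v ^ 2)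
        - inner ℝ f₁ Y * (2 * inner ℝ f₁ v * inner ℝ f₂ v)
        + inner ℝ f₂ y * (2 * (inner ℝ f₁ v * inner ℝ f₁ V - inner ℝ f₂ v * inner ℝ f₂ V))
        - inner ℝ f₁ y * (2 * (inner ℝ f₁ v * inner ℝ f₂ V + inner ℝ f₂ v * inner ℝ f₁ V)))) →
      2 * (planarRe f₁ f₂ ε y v - a) * A' + 4 * (planarIm f₁ f₂ ε y v - b) * B'
        + 2 * k * (A' * (planarIm f₁ f₂ ε y v - b) + (planarRe f₁ f₂ ε y v - a) * B') < 0) := by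
  obtain ⟨hyD, -⟩ := norm_le h hT hε hδ hv hw hyp hQ
  have hw2 := hT.perp_le hε hw
  have hθ := hT.theta_pos
  have hεθ : 0 < ε * (ε + δ) := mul_pos hε hθ
  have hε1 : ε ≤ 1 := by linarith [hT.theta_le]
  have hD : 1 ≤ D := by rw [hT.D_eq]; nlinarith [abs_nonneg a, abs_nonneg b]
  have hCD : 1 ≤ C * D ^ 2 := by have := hT.C_ge; nlinarith
  have hyR : ‖y‖ ≤ R := by
    refine hyD.trans (le_trans ?_ hT.radius); gcongr; linarith
  have hKθ : 0 < K * (ε + δ) := mul_pos hT.K_pos hθ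
  refine ⟨fun hb => ?_, fun hb => ?_, fun hb A' B' hA hB => ?_⟩
  · have hsm : ε * (6 * D + 2 * C * D ^ 2 + 2 * C) ≤ γ / 2 := by
      refine le_trans ?_ hT.gap_small
      have := hT.C_ge
      gcongr; linarith
    have key := h.perp_velocity_le hT.C_ge hδ hε.le hD hT.theta_le hv hyD hyR (by linarith) hsm
    have e : inner ℝ (planePerp f₁ f₂ v) V = (ε ^ 2)⁻¹ *
        (-inner ℝ (planePerp f₁ f₂ v) (B (z + y) v)
        + inner ℝ v (B (z + y) v) * ‖planePerp f₁ f₂ v‖ ^ 2) := by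
      rw [hV, inner_smul_right, inner_neg_right, inner_sub_right, inner_smul_right,
        inner_planePerp_self h.norm_left h.norm_right h.orth]
      ring
    rw [e]
    refine mul_neg_of_pos_of_neg (by positivity) (key.trans_lt ?_)
    have hpos : 0 < ‖planePerp f₁ f₂ v‖ := by
      rw [hb]; exact mul_pos (by linarith [hT.Kv_ge]) hεθ
    refine mul_neg_of_pos_of_neg hpos ?_
    rw [hb]
    linarith [mul_lt_mul_of_pos_right hT.Kv_large hεθ]
  · rw [hY]
    refine (h.perp_position_le hT.C_ge hδ hT.abs_c hT.abs_s hε.le hD hT.theta_le hv hyD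
      hyR).trans_lt ?_
    have hpos : 0 < ‖planePerp f₁ f₂ y‖ := by
      rw [hb]; exact mul_pos (by linarith [hT.Ky_ge]) hεθ
    refine mul_neg_of_pos_of_neg hpos ?_
    rw [hb]
    have k₁ := mul_lt_mul_of_pos_right hT.Ky_large hεθ
    have k₂ : 10 * C * D ^ 2 * ‖planePerp f₁ f₂ v‖ ≤ 10 * C * D ^ 2 * (Kv * (ε * (ε + δ))) :=
      mul_le_mul_of_nonneg_left hw (by linarith)
    have k₃ : C * D ^ 2 * ε ^ 2 ≤ C * D ^ 2 * (ε * (ε + δ)) :=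
      mul_le_mul_of_nonneg_left (by nlinarith) (by linarith)
    linarith
  · obtain ⟨hu, hh⟩ := abs_le_of_planar_lyapunov_le hT.abs_k hKθ.le hQ
    have hW : ‖planePerp f₁ f₂ v‖ ^ 2 ≤ ε + δ := by nlinarith [norm_nonneg (planePerp f₁ f₂ v)]
    obtain ⟨r₁, r₂⟩ := h.rotating_coordinates_velocity hT.C_ge hδ hT.abs_c hT.abs_s hε hD
      (by linarith [hT.Kv_ge]) hT.theta_le hv hyD hyR hW hw hY hV
    rw [← hA] at r₁
    rw [← hB] at r₂
    have key := planar_lyapunov_deriv_neg hT.left hT.right hT.abs_k hT.lyapunov hKθ hu hh hb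
      (A := ε * A') (Bd := ε * B') (by rw [add_sub_cancel]; exact r₁)
      (by rw [add_sub_cancel, add_sub_cancel]; exact r₂) hT.lyapunov_small
    refine neg_of_mul_neg_right (a := ε) ?_ hε.le
    linarith

/-- Trajectories that start in the trapping region stay there. -/
theorem trapped (h : IsNearIsotropic g B z f₁ f₂ μ κ γ c s C R δ)
    (hT : IsTrappingConstants a b k η c s C R κ γ D Kv Ky K (ε + δ)) (hε : 0 < ε) (hδ : 0 ≤ δ)
    {x v : ℝ → X} (hx : ContinuousOn x (Ici 0)) (hvc : ContinuousOn v (Ici 0))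
    (hv : ∀ t, 0 ≤ t → ‖v t‖ = 1)
    (hd : ∀ t, 0 < t → ‖x t - z‖ ≤ R →
      HasDerivAt x (-(g (x t) - (2 * inner ℝ (v t) (g (x t))) • v t)) t ∧
      HasDerivAt v ((ε ^ 2)⁻¹ • -(B (x t) (v t) - inner ℝ (v t) (B (x t) (v t)) • v t)) t)
    (hw₀ : ‖planePerp f₁ f₂ (v 0)‖ < Kv * (ε * (ε + δ)))
    (hy₀ : ‖planePerp f₁ f₂ (x 0 - z)‖ < Ky * (ε * (ε + δ)))
    (hQ₀ : (planarRe f₁ f₂ ε (x 0 - z) (v 0) - a) ^ 2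
      + 2 * (planarIm f₁ f₂ ε (x 0 - z) (v 0) - b) ^ 2
      + 2 * k * (planarRe f₁ f₂ ε (x 0 - z) (v 0) - a) * (planarIm f₁ f₂ ε (x 0 - z) (v 0) - b)
      < (K * (ε + δ)) ^ 2) :
    ∀ t, 0 ≤ t → ‖x t - z‖ ≤ R ∧
      |‖x t - z‖ - ε * √(a ^ 2 + b ^ 2)| ≤ (4 * K + D + Ky) * ε * (ε + δ) := by
  have hKv : 0 ≤ Kv * (ε * (ε + δ)) := (norm_nonneg _).trans hw₀.le
  have hKy : 0 ≤ Ky * (ε * (ε + δ)) := (norm_nonneg _).trans hy₀.le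
  set A : ℝ → ℝ := fun t => planarRe f₁ f₂ ε (x t - z) (v t) with hA
  set Bf : ℝ → ℝ := fun t => planarIm f₁ f₂ ε (x t - z) (v t) with hBf
  set Y : ℝ → X := fun t => -(g (x t) - (2 * inner ℝ (v t) (g (x t))) • v t) with hY
  set V : ℝ → X := fun t =>
    (ε ^ 2)⁻¹ • -(B (x t) (v t) - inner ℝ (v t) (B (x t) (v t)) • v t) with hV
  set A' : ℝ → ℝ := fun t => ε⁻¹ * (inner ℝ f₁ (Y t) * (inner ℝ f₁ (v t) ^ 2 - inner ℝ f₂ (v t) ^ 2)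
        + inner ℝ f₂ (Y t) * (2 * inner ℝ f₁ (v t) * inner ℝ f₂ (v t))
        + inner ℝ f₁ (x t - z) * (2 * (inner ℝ f₁ (v t) * inner ℝ f₁ (V t)
            - inner ℝ f₂ (v t) * inner ℝ f₂ (V t)))
        + inner ℝ f₂ (x t - z) * (2 * (inner ℝ f₁ (v t) * inner ℝ f₂ (V t)
            + inner ℝ f₂ (v t) * inner ℝ f₁ (V t)))) with hA'
  set B' : ℝ → ℝ := fun t => ε⁻¹ * (inner ℝ f₂ (Y t) * (inner ℝ f₁ (v t) ^ 2 - inner ℝ f₂ (v t) ^ 2)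
        - inner ℝ f₁ (Y t) * (2 * inner ℝ f₁ (v t) * inner ℝ f₂ (v t))
        + inner ℝ f₂ (x t - z) * (2 * (inner ℝ f₁ (v t) * inner ℝ f₁ (V t)
            - inner ℝ f₂ (v t) * inner ℝ f₂ (V t)))
        - inner ℝ f₁ (x t - z) * (2 * (inner ℝ f₁ (v t) * inner ℝ f₂ (V t)
            + inner ℝ f₂ (v t) * inner ℝ f₁ (V t)))) with hB'
  let φ : Fin 3 → ℝ → ℝ := ![fun t => ‖planePerp f₁ f₂ (v t)‖ ^ 2 - (Kv * (ε * (ε + δ))) ^ 2,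
    fun t => ‖planePerp f₁ f₂ (x t - z)‖ ^ 2 - (Ky * (ε * (ε + δ))) ^ 2,
    fun t => (A t - a) ^ 2 + 2 * (Bf t - b) ^ 2 + 2 * k * (A t - a) * (Bf t - b)
      - (K * (ε + δ)) ^ 2]
  let φ' : Fin 3 → ℝ → ℝ := ![fun t => 2 * inner ℝ (planePerp f₁ f₂ (v t)) (V t),
    fun t => 2 * inner ℝ (planePerp f₁ f₂ (x t - z)) (Y t),
    fun t => 2 * (A t - a) * A' t + 4 * (Bf t - b) * B' t
      + 2 * k * (A' t * (Bf t - b) + (A t - a) * B' t)]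
  have region : ∀ t, (∀ j, φ j t ≤ 0) → ‖planePerp f₁ f₂ (v t)‖ ≤ Kv * (ε * (ε + δ)) ∧
      ‖planePerp f₁ f₂ (x t - z)‖ ≤ Ky * (ε * (ε + δ)) ∧
      (A t - a) ^ 2 + 2 * (Bf t - b) ^ 2 + 2 * k * (A t - a) * (Bf t - b)
        ≤ (K * (ε + δ)) ^ 2 := by
    intro t ht
    have t0 : ‖planePerp f₁ f₂ (v t)‖ ^ 2 - (Kv * (ε * (ε + δ))) ^ 2 ≤ 0 := ht 0
    have t1 : ‖planePerp f₁ f₂ (x t - z)‖ ^ 2 - (Ky * (ε * (ε + δ))) ^ 2 ≤ 0 := ht 1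
    have t2 : (A t - a) ^ 2 + 2 * (Bf t - b) ^ 2 + 2 * k * (A t - a) * (Bf t - b)
      - (K * (ε + δ)) ^ 2 ≤ 0 := ht 2
    exact ⟨abs_le_of_sq_le_sq' (by linarith) hKv |>.2, abs_le_of_sq_le_sq' (by linarith) hKy |>.2,
      by linarith⟩
  have hR : ∀ t, 0 ≤ t → (∀ j, φ j t ≤ 0) → ‖x t - z‖ ≤ R ∧
      |‖x t - z‖ - ε * √(a ^ 2 + b ^ 2)| ≤ (4 * K + D + Ky) * ε * (ε + δ) := by
    intro t ht hj
    obtain ⟨r₁, r₂, r₃⟩ := region t hj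
    obtain ⟨n₁, n₂⟩ := norm_le h hT hε hδ (hv t ht) r₁ r₂ r₃
    refine ⟨n₁.trans (le_trans ?_ hT.radius), n₂⟩
    have hD : 0 ≤ D := by rw [hT.D_eq]; positivity
    gcongr; linarith
  have main := forall_neg_of_barrier φ φ' ?_ ?_ ?_
  · exact fun t ht => hR t ht fun j => (main t ht j).le
  · have cy : ContinuousOn (fun t => x t - z) (Ici 0) := hx.sub continuousOn_const
    have ci : ∀ f : X, ∀ u : ℝ → X, ContinuousOn u (Ici 0) →
        ContinuousOn (fun t => inner ℝ f (u t)) (Ici 0) := fun f u hu =>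
      continuousOn_const.inner hu
    have c₁ := ci f₁ _ cy
    have c₂ := ci f₂ _ cy
    have c₃ := ci f₁ _ hvc
    have c₄ := ci f₂ _ hvc
    have cA : ContinuousOn A (Ici 0) := by simp only [hA, planarRe]; fun_prop
    have cB : ContinuousOn Bf (Ici 0) := by simp only [hBf, planarIm]; fun_prop
    intro i
    fin_cases i
    · change ContinuousOn (fun t => ‖planePerp f₁ f₂ (v t)‖ ^ 2 - (Kv * (ε * (ε + δ))) ^ 2) _
      simp only [planePerp]; fun_prop
    · change ContinuousOn (fun t => ‖planePerp f₁ f₂ (x t - z)‖ ^ 2 - (Ky * (ε * (ε + δ))) ^ 2) _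
      simp only [planePerp]; fun_prop
    · change ContinuousOn (fun t => (A t - a) ^ 2 + 2 * (Bf t - b) ^ 2
        + 2 * k * (A t - a) * (Bf t - b) - (K * (ε + δ)) ^ 2) _
      fun_prop
  · intro i
    fin_cases i
    · change ‖planePerp f₁ f₂ (v 0)‖ ^ 2 - (Kv * (ε * (ε + δ))) ^ 2 < 0
      have := pow_lt_pow_left₀ hw₀ (norm_nonneg _) two_ne_zero
      linarith
    · change ‖planePerp f₁ f₂ (x 0 - z)‖ ^ 2 - (Ky * (ε * (ε + δ))) ^ 2 < 0
      have := pow_lt_pow_left₀ hy₀ (norm_nonneg _) two_ne_zero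
      linarith
    · change (A 0 - a) ^ 2 + 2 * (Bf 0 - b) ^ 2 + 2 * k * (A 0 - a) * (Bf 0 - b)
        - (K * (ε + δ)) ^ 2 < 0
      linarith
  · intro t ht hj
    obtain ⟨r₁, r₂, r₃⟩ := region t hj
    obtain ⟨dx, dv⟩ := hd t ht (hR t ht.le hj).1
    have dy : HasDerivAt (fun t => x t - z) (Y t) t := dx.sub_const z
    have dA : HasDerivAt A (A' t) t := hasDerivAt_planarRe ε dy dv
    have dB : HasDerivAt Bf (B' t) t := hasDerivAt_planarIm ε dy dv
    obtain ⟨i₁, i₂, i₃⟩ := velocity_inward h hT hε hδ (hv t ht.le) r₁ r₂ r₃ (Y := Y t) (V := V t)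
      (by rw [add_sub_cancel]) (by rw [add_sub_cancel])
    intro i hi
    fin_cases i
    · change ‖planePerp f₁ f₂ (v t)‖ ^ 2 - (Kv * (ε * (ε + δ))) ^ 2 = 0 at hi
      refine ⟨(hasDerivAt_norm_planePerp_sq h.norm_left h.norm_right h.orth dv).sub_const _, ?_⟩
      have := i₁ ((pow_left_inj₀ (norm_nonneg _) hKv two_ne_zero).1 (by linarith))
      change 2 * _ < (0 : ℝ)
      linarith
    · change ‖planePerp f₁ f₂ (x t - z)‖ ^ 2 - (Ky * (ε * (ε + δ))) ^ 2 = 0 at hi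
      refine ⟨(hasDerivAt_norm_planePerp_sq h.norm_left h.norm_right h.orth dy).sub_const _, ?_⟩
      have := i₂ ((pow_left_inj₀ (norm_nonneg _) hKy two_ne_zero).1 (by linarith))
      change 2 * _ < (0 : ℝ)
      linarith
    · change (A t - a) ^ 2 + 2 * (Bf t - b) ^ 2 + 2 * k * (A t - a) * (Bf t - b)
        - (K * (ε + δ)) ^ 2 = 0 at hi
      refine ⟨?_, i₃ (by linarith) _ _ rfl rfl⟩
      have d := ((((dA.sub_const a).pow 2).add (((dB.sub_const b).pow 2).const_mul 2)).add
        (((dA.sub_const a).const_mul (2 * k)).mul (dB.sub_const b))).sub_const ((K * (ε + δ)) ^ 2)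
      refine d.congr_deriv ?_
      change _ = 2 * (A t - a) * A' t + 4 * (Bf t - b) * B' t
        + 2 * k * (A' t * (Bf t - b) + (A t - a) * B' t)
      push_cast
      ring

end IsTrappingConstants

set_option maxHeartbeats 1600000 in
theorem exists_trappingConstants {c s C R κ γ : ℝ} (hc : 0 < c) (hs : s ≠ 0)
    (hcs : c ^ 2 + s ^ 2 = 1) (hC : 1 ≤ C) (hR : 0 < R) (hκ : 0 < κ) (hγ : 0 < γ) :
    ∃ a b k η D Kv Ky K θ₀ : ℝ, a ^ 2 + b ^ 2 = 1 / (2 * c) ∧ 0 < θ₀ ∧ 1 < Kv ∧ 1 < Ky ∧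
      2 * (3 + 8 * √(a ^ 2 + b ^ 2)) < K ∧
      ∀ θ, 0 < θ → θ ≤ θ₀ → IsTrappingConstants a b k η c s C R κ γ D Kv Ky K θ := by
  obtain ⟨a, b, hab₁, hab₂, ha, hb, hab⟩ := exists_planar_fixedPoint hc hs hcs
  obtain ⟨k, η, hk, hη, hL⟩ := exists_planar_lyapunov ha hb
  obtain ⟨D, hD⟩ : ∃ D, D = 2 * (|a| + |b| + 3) := ⟨_, rfl⟩
  have hD1 : 1 ≤ D := by rw [hD]; linarith [abs_nonneg a, abs_nonneg b]
  have hCD : 1 ≤ C * D ^ 2 := by nlinarith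
  obtain ⟨Kv, hKv⟩ : ∃ Kv, Kv = (4 * (C * D ^ 2)) / γ + 2 := ⟨_, rfl⟩
  have hKv2 : 2 ≤ Kv := by rw [hKv]; have : 0 ≤ (4 * (C * D ^ 2)) / γ := by positivity
                           linarith
  obtain ⟨Ky, hKy⟩ : ∃ Ky, Ky = (C * D ^ 2 + 10 * (C * D ^ 2) * Kv) / κ + 2 := ⟨_, rfl⟩
  have hKy2 : 2 ≤ Ky := by
    rw [hKy]
    have : 0 ≤ (C * D ^ 2 + 10 * (C * D ^ 2) * Kv) / κ := by positivity
    linarith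
  obtain ⟨P, hP⟩ : ∃ P, P = (4 + 8 * D) * (18 * C * D ^ 2 + 4 * C * Kv) := ⟨_, rfl⟩
  have hP0 : 0 ≤ P := by rw [hP]; positivity
  obtain ⟨K, hK⟩ : ∃ K, K = 96 * P / η + 2 * (3 + 8 * √(a ^ 2 + b ^ 2)) + 1 := ⟨_, rfl⟩
  have hPη : 0 ≤ 96 * P / η := by positivity
  have hω := Real.sqrt_nonneg (a ^ 2 + b ^ 2)
  have hK0 : 0 < K := by rw [hK]; linarith
  obtain ⟨G, hG⟩ : ∃ G, G = 6 * D + 2 * C * D ^ 2 + 2 * C := ⟨_, rfl⟩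
  have hG0 : 0 ≤ G := by rw [hG]; positivity
  obtain ⟨S, hS⟩ : ∃ S, S = 1 + 2 * Kv + Ky + 2 * K + D / R + 2 * G / γ + 768 * K / η := ⟨_, rfl⟩
  have t₁ : 0 ≤ D / R := by positivity
  have t₂ : 0 ≤ 2 * G / γ := by positivity
  have t₃ : 0 ≤ 768 * K / η := by positivity
  have hS0 : 0 < S := by rw [hS]; linarith
  refine ⟨a, b, k, η, D, Kv, Ky, K, 1 / S, hab, by positivity, by linarith, by linarith,
    by rw [hK]; linarith, fun θ hθ hθS => ?_⟩
  have hsmall : ∀ r, r ≤ S → r * θ ≤ 1 := fun r hr => by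
    rw [le_div_iff₀ hS0] at hθS
    nlinarith
  have d₁ := hsmall (D / R) (by rw [hS]; linarith)
  have d₂ := hsmall (2 * G / γ) (by rw [hS]; linarith)
  have d₃ := hsmall (768 * K / η) (by rw [hS]; linarith)
  rw [div_mul_eq_mul_div, div_le_one (by assumption)] at d₁ d₂ d₃
  refine ⟨hab₁, hab₂, ?_, ?_, hk, hL, hC, hD, by linarith, by linarith, hK0, hθ, ?_, ?_, ?_, ?_, ?_,
    ?_, d₁, ?_, ?_⟩
  · exact abs_le_of_sq_le_sq (by nlinarith [sq_nonneg s]) zero_le_one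
  · exact abs_le_of_sq_le_sq (by nlinarith [sq_nonneg c]) zero_le_one
  · simpa using hsmall 1 (by rw [hS]; linarith)
  · have : γ / 2 * Kv = 2 * C * D ^ 2 + γ := by rw [hKv]; field_simp; ring
    linarith
  · have : κ * Ky = C * D ^ 2 + 10 * C * D ^ 2 * Kv + 2 * κ := by rw [hKy]; field_simp
    linarith
  · linarith [hsmall (2 * Kv) (by rw [hS]; linarith)]
  · exact hsmall Ky (by rw [hS]; linarith)
  · linarith [hsmall (2 * K) (by rw [hS]; linarith)]
  · rw [← hG]; linarith
  · rw [← hP]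
    have e : η * K = 96 * P + η * (2 * (3 + 8 * √(a ^ 2 + b ^ 2)) + 1) := by
      rw [hK]; field_simp; ring
    have e' : 96 * P < η * K := by rw [e]; nlinarith
    have f₁ := mul_le_mul_of_nonneg_left d₃ (mul_pos hK0 hθ).le
    have f₂ := mul_lt_mul_of_pos_right e' hθ
    linarith

/-- Uniform trapping of the trajectories of the gentlest ascent dynamics near an isotropic
singularity, for solutions with `‖v‖ = 1` of any system which agrees with the gentlest ascent
dynamics on the ball of radius `R`. -/
theorem exists_trapping_bounds {X : Type*} [NormedAddCommGroup X] [InnerProductSpace ℝ X]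
    {c s C R κ γ : ℝ} (hc : 0 < c) (hs : s ≠ 0)
    (hcs : c ^ 2 + s ^ 2 = 1) (hC : 1 ≤ C) (hR : 0 < R) (hκ : 0 < κ) (hγ : 0 < γ) :
    ∃ θ₀ M : ℝ, 0 < θ₀ ∧ 0 < M ∧ ∀ ε δ : ℝ, 0 < ε → 0 ≤ δ → ε + δ ≤ θ₀ →
      ∀ (g : X → X) (B : X → X →L[ℝ] X) (z f₁ f₂ : X) (μ : ℝ),
      IsNearIsotropic g B z f₁ f₂ μ κ γ c s C R δ →
      ∀ x₀ : X, planePerp f₁ f₂ (x₀ - z) = 0 → ‖x₀ - z‖ = ε / √(2 * c) →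
      ∃ v₀ : X, ‖v₀‖ = 1 ∧ ∀ x v : ℝ → X, ContinuousOn x (Ici 0) → ContinuousOn v (Ici 0) →
        (∀ t, 0 ≤ t → ‖v t‖ = 1) →
        ‖x 0 - x₀‖ ≤ ε * (ε + δ) → ‖v 0 - v₀‖ ≤ ε * (ε + δ) →
        (∀ t, 0 < t → ‖x t - z‖ ≤ R →
          HasDerivAt x (-(g (x t) - (2 * inner ℝ (v t) (g (x t))) • v t)) t ∧
          HasDerivAt v ((ε ^ 2)⁻¹ • -(B (x t) (v t) - inner ℝ (v t) (B (x t) (v t)) • v t)) t) →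
        ∀ t, 0 ≤ t → ‖x t - z‖ ≤ R ∧ |‖x t - z‖ - ε / √(2 * c)| ≤ M * ε * (ε + δ) := by
  obtain ⟨a, b, k, η, D, Kv, Ky, K, θ₀, hab, hθ₀, hKv, hKy, hK, hT⟩ :=
    exists_trappingConstants hc hs hcs hC hR hκ hγ
  have hω : √(a ^ 2 + b ^ 2) = 1 / √(2 * c) := by rw [hab, Real.sqrt_div zero_le_one]; simp
  have hT₀ := hT θ₀ hθ₀ le_rfl
  have hD : 0 ≤ D := by rw [hT₀.D_eq]; positivity
  refine ⟨θ₀, 4 * K + D + Ky, hθ₀, by linarith [hT₀.K_pos], ?_⟩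
  intro ε δ hε hδ hεδ g B z f₁ f₂ μ h x₀ hx₀ hx₀n
  have hθ : 0 < ε + δ := by linarith
  have hT' := hT _ hθ hεδ
  have hεθ : 0 < ε * (ε + δ) := mul_pos hε hθ
  have hε1 : ε ≤ 1 := by linarith [hT'.theta_le]
  have hx₀n' : ‖x₀ - z‖ = √(a ^ 2 + b ^ 2) * ε := by rw [hx₀n, hω]; ring
  obtain ⟨v₀, hv₀, hv₀p, hA₀, hB₀⟩ := exists_unit_planar_eq h.norm_left h.norm_right h.orth hε
    (a := a) (b := b) (by rw [hab]; positivity) hx₀ (by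
      rw [hx₀n', mul_pow, Real.sq_sqrt (by positivity)]; ring)
  refine ⟨v₀, hv₀, fun x v hx hvc hv hx0 hv0 hd => ?_⟩
  have hdiff : (x 0 - z) - (x₀ - z) = x 0 - x₀ := by abel
  obtain ⟨q₁, q₂⟩ := planarRe_sub_le h.norm_left h.norm_right hε hε1 hθ.le
    (Real.sqrt_nonneg (a ^ 2 + b ^ 2)) (hv 0 le_rfl) hv₀ hx₀n'.le (by rwa [hdiff]) hv0
  rw [hA₀] at q₁
  rw [hB₀] at q₂
  have perp_sub : ∀ u u₀ : X, planePerp f₁ f₂ u₀ = 0 →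
      planePerp f₁ f₂ u = planePerp f₁ f₂ (u - u₀) := fun u u₀ hu => by
    have : planePerp f₁ f₂ (u - u₀) = planePerp f₁ f₂ u - planePerp f₁ f₂ u₀ := by
      simp only [planePerp, inner_sub_right]; module
    rw [this, hu, sub_zero]
  have main := hT'.trapped h hε hδ hx hvc hv hd ?_ ?_ ?_
  · rw [hω, mul_one_div] at main
    exact main
  · rw [perp_sub _ _ hv₀p]
    refine (norm_planePerp_le h.norm_left h.norm_right h.orth _).trans_lt (hv0.trans_lt ?_)
    nlinarith
  · rw [perp_sub _ _ hx₀, hdiff]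
    refine (norm_planePerp_le h.norm_left h.norm_right h.orth _).trans_lt (hx0.trans_lt ?_)
    nlinarith
  · set u := planarRe f₁ f₂ ε (x 0 - z) (v 0) - a
    set w := planarIm f₁ f₂ ε (x 0 - z) (v 0) - b
    set L := (3 + 8 * √(a ^ 2 + b ^ 2)) * (ε + δ) with hL
    have hL0 : 0 ≤ L := (abs_nonneg _).trans q₁
    have hLK : 2 * L < K * (ε + δ) := by rw [hL, ← mul_assoc]; gcongr
    have hu : u ^ 2 ≤ L ^ 2 := sq_le_sq' (abs_le.1 q₁).1 (abs_le.1 q₁).2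
    have hw : w ^ 2 ≤ L ^ 2 := sq_le_sq' (abs_le.1 q₂).1 (abs_le.1 q₂).2
    have huw : |k * (u * w)| ≤ 1 / 2 * (L * L) := by
      rw [abs_mul, abs_mul]
      exact mul_le_mul hT'.abs_k (mul_le_mul q₁ q₂ (abs_nonneg _) hL0) (by positivity) (by norm_num)
    have hfin : (2 * L) ^ 2 < (K * (ε + δ)) ^ 2 := pow_lt_pow_left₀ hLK (by positivity) two_ne_zero
    linarith [le_abs_self (k * (u * w))]

/-- A bounded Lipschitz vector field has global integral curves. -/
theorem exists_hasDerivAt_of_lipschitzWith_of_bounded {Y : Type*} [NormedAddCommGroup Y]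
    [NormedSpace ℝ Y] [CompleteSpace Y] {F : Y → Y} {K : NNReal} (hF : LipschitzWith K F) {L : NNReal}
    (hL : ∀ y, ‖F y‖ ≤ L) (y₀ : Y) :
    ∃ u : ℝ → Y, u 0 = y₀ ∧ ∀ t, HasDerivAt u (F (u t)) t := by
  have hex : ∀ T : ℝ, ∃ u : ℝ → Y, u 0 = y₀ ∧ ∀ t ∈ Ioo (-T) T, HasDerivAt u (F (u t)) t := by
    intro T
    rcases le_or_gt T 0 with hT | hT
    · exact ⟨fun _ => y₀, rfl, fun t ht => by linarith [ht.1, ht.2]⟩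
    have hpl : IsPicardLindelof (fun _ => F) (tmin := -T) (tmax := T)
        ⟨0, by constructor <;> linarith⟩ y₀ (L * T.toNNReal) 0 L K :=
      IsPicardLindelof.of_time_independent (fun y _ => hL y) hF.lipschitzOnWith (by
        simp [hT.le])
    obtain ⟨u, hu0, hu⟩ := hpl.exists_eq_forall_mem_Icc_hasDerivWithinAt₀
    exact ⟨u, hu0, fun t ht =>
      (hu t (Ioo_subset_Icc_self ht)).hasDerivAt (Icc_mem_nhds ht.1 ht.2)⟩
  choose u hu0 hu using hex
  have huniq : ∀ T T' : ℝ, 0 < T → T ≤ T' → EqOn (u T) (u T') (Ioo (-T) T) := by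
    intro T T' hT hTT'
    refine ODE_solution_unique_of_mem_Ioo (v := fun _ => F) (s := fun _ => univ) (K := K)
      (t₀ := 0) (fun t _ => hF.lipschitzOnWith) ⟨by linarith, hT⟩
      (fun t ht => ⟨hu T t ht, mem_univ _⟩)
      (fun t ht => ⟨hu T' t ⟨by linarith [ht.1], by linarith [ht.2]⟩, mem_univ _⟩) (by rw [hu0, hu0])
  refine ⟨fun t => u (|t| + 1) t, by simp [hu0], fun t => ?_⟩
  have hT : 0 < |t| + 1 := by positivity
  have ht : t ∈ Ioo (-(|t| + 1)) (|t| + 1) := abs_lt.1 (lt_add_one _)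
  refine (hu (|t| + 1) t ht).congr_of_eventuallyEq ?_
  filter_upwards [Ioo_mem_nhds ht.1 ht.2] with τ hτ
  have hτ' : |τ| < |t| + 1 := abs_lt.2 hτ
  rcases le_total (|τ| + 1) (|t| + 1) with h | h
  · exact huniq _ _ (by positivity) h (abs_lt.1 (lt_add_one _))
  · exact (huniq _ _ hT h hτ).symm

/-- Integral curves of a continuously differentiable vector field are unique forward in time. -/
theorem eqOn_Ico_of_hasDerivWithinAt {Y : Type*} [NormedAddCommGroup Y] [NormedSpace ℝ Y]
    [ProperSpace Y] {F : Y → Y} (hF : ContDiff ℝ 1 F) {T : ℝ} {u w : ℝ → Y}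
    (hu : ∀ t ∈ Ico 0 T, HasDerivWithinAt u (F (u t)) (Ico 0 T) t)
    (hw : ∀ t ∈ Ico 0 T, HasDerivWithinAt w (F (w t)) (Ico 0 T) t) (h0 : u 0 = w 0) :
    EqOn u w (Ico 0 T) := by
  intro t ht
  have hsub : Icc 0 t ⊆ Ico 0 T := fun τ hτ => ⟨hτ.1, hτ.2.trans_lt ht.2⟩
  have cu : ContinuousOn u (Icc 0 t) := fun τ hτ => (hu τ (hsub hτ)).continuousWithinAt.mono hsub
  have cw : ContinuousOn w (Icc 0 t) := fun τ hτ => (hw τ (hsub hτ)).continuousWithinAt.mono hsub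
  obtain ⟨r, hr⟩ := ((isCompact_Icc.image_of_continuousOn cu).union
    (isCompact_Icc.image_of_continuousOn cw)).isBounded.subset_closedBall 0
  obtain ⟨K, hK⟩ := (hF.contDiffOn (s := Metric.closedBall 0 r)).exists_lipschitzOnWith one_ne_zero
    (convex_closedBall 0 r) (isCompact_closedBall 0 r)
  have hmem : ∀ τ ∈ Ico 0 t, Ico 0 T ∈ 𝓝[≥] τ := fun τ hτ =>
    mem_of_superset (Ico_mem_nhdsGE (hτ.2.trans ht.2)) (Ico_subset_Ico_left hτ.1)
  exact ODE_solution_unique_of_mem_Icc_right (v := fun _ => F) (s := fun _ => Metric.closedBall 0 r)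
    (K := K) (fun _ _ => hK) cu
    (fun τ hτ => (hu τ (hsub (Ico_subset_Icc_self hτ))).mono_of_mem_nhdsWithin (hmem τ hτ))
    (fun τ hτ => hr (Or.inl (mem_image_of_mem u (Ico_subset_Icc_self hτ)))) cw
    (fun τ hτ => (hw τ (hsub (Ico_subset_Icc_self hτ))).mono_of_mem_nhdsWithin (hmem τ hτ))
    (fun τ hτ => hr (Or.inr (mem_image_of_mem w (Ico_subset_Icc_self hτ)))) h0
    (right_mem_Icc.2 ht.1)

/-- The vector field of the gentlest ascent dynamics for a gradient `g` and a Hessian `B`. -/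
noncomputable def gadField {X : Type*} [NormedAddCommGroup X] [InnerProductSpace ℝ X]
    (g : X → X) (B : X → X →L[ℝ] X) (ε : ℝ) (p : X × X) : X × X :=
  (-(g p.1 - (2 * inner ℝ p.2 (g p.1)) • p.2),
    (ε ^ 2)⁻¹ • -(B p.1 p.2 - inner ℝ p.2 (B p.1 p.2) • p.2))

section GadField

variable {X : Type*} [NormedAddCommGroup X] [InnerProductSpace ℝ X]
  {g : X → X} {B : X → X →L[ℝ] X}

theorem contDiff_gadField (hg : ContDiff ℝ 1 g) (hB : ContDiff ℝ 1 B) (ε : ℝ) :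
    ContDiff ℝ 1 (gadField g B ε) := by
  unfold gadField
  have h₁ : ContDiff ℝ 1 fun p : X × X => g p.1 := hg.comp contDiff_fst
  have h₂ : ContDiff ℝ 1 fun p : X × X => B p.1 p.2 :=
    (hB.comp contDiff_fst).clm_apply contDiff_snd
  have h₃ : ContDiff ℝ 1 fun p : X × X => inner ℝ p.2 (g p.1) := contDiff_snd.inner ℝ h₁
  have h₄ : ContDiff ℝ 1 fun p : X × X => inner ℝ p.2 (B p.1 p.2) := contDiff_snd.inner ℝ h₂
  exact ((h₁.sub ((contDiff_const.mul h₃).smul contDiff_snd)).neg).prodMk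
    (((h₂.sub (h₄.smul contDiff_snd)).neg).const_smul _)

/-- Curves with `‖v‖ = 1` that solve the gentlest ascent dynamics as long as they remain in a given
ball. -/
theorem exists_gad_curve [FiniteDimensional ℝ X] (hg : ContDiff ℝ 1 g) (hB : ContDiff ℝ 1 B)
    (ε R : ℝ) (hR : 0 < R) (z xi vi : X) (hvi : ‖vi‖ = 1) :
    ∃ x v : ℝ → X, x 0 = xi ∧ v 0 = vi ∧ Continuous x ∧ Continuous v ∧
      (∀ t, 0 ≤ t → ‖v t‖ = 1) ∧ ∀ t, 0 ≤ t → ‖x t - z‖ ≤ R →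
        HasDerivAt x (-(g (x t) - (2 * inner ℝ (v t) (g (x t))) • v t)) t ∧
        HasDerivAt v ((ε ^ 2)⁻¹ • -(B (x t) (v t) - inner ℝ (v t) (B (x t) (v t)) • v t)) t := by
  have hF := contDiff_gadField hg hB ε
  let χ : ContDiffBump ((z, 0) : X × X) := ⟨R + 1, R + 2, by linarith, by linarith⟩
  have hG : ContDiff ℝ 1 fun p => χ p • gadField g B ε p := χ.contDiff.smul hF
  have hGc : HasCompactSupport fun p => χ p • gadField g B ε p :=
    χ.hasCompactSupport.smul_right
  obtain ⟨K, hK⟩ := hG.lipschitzWith_of_hasCompactSupport hGc one_ne_zero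
  obtain ⟨L, hL⟩ := hGc.exists_bound_of_continuous hG.continuous
  obtain ⟨u, hu0, hu⟩ := exists_hasDerivAt_of_lipschitzWith_of_bounded hK (L := L.toNNReal)
    (fun p => (hL p).trans (Real.le_coe_toNNReal L)) (xi, vi)
  have huc : Continuous u := continuous_iff_continuousAt.2 fun t => (hu t).continuousAt
  have dx : ∀ t, HasDerivAt (fun t => (u t).1) (χ (u t) • (gadField g B ε (u t)).1) t := fun t =>
    (ContinuousLinearMap.fst ℝ X X).hasFDerivAt.comp_hasDerivAt t (hu t)
  have dv : ∀ t, HasDerivAt (fun t => (u t).2) (χ (u t) • (gadField g B ε (u t)).2) t := fun t =>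
    (ContinuousLinearMap.snd ℝ X X).hasFDerivAt.comp_hasDerivAt t (hu t)
  have hnorm : ∀ t, 0 ≤ t → ‖(u t).2‖ = 1 := by
    intro T hT
    have dh : ∀ t, HasDerivAt (fun t => ‖(u t).2‖ ^ 2 - 1)
        (2 * χ (u t) * (ε ^ 2)⁻¹ * inner ℝ (u t).2 (B (u t).1 (u t).2) * (‖(u t).2‖ ^ 2 - 1)) t := by
      intro t
      refine ((dv t).norm_sq.sub_const 1).congr_deriv ?_
      simp only [gadField, inner_smul_right, inner_neg_right, inner_sub_right,
        real_inner_self_eq_norm_sq]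
      ring
    have cc : Continuous fun t => 2 * χ (u t) * (ε ^ 2)⁻¹ * inner ℝ (u t).2 (B (u t).1 (u t).2) := by
      have c₁ : Continuous fun t => B (u t).1 (u t).2 :=
        (hB.continuous.comp huc.fst).clm_apply huc.snd
      have c₂ : Continuous fun t => χ (u t) := χ.continuous.comp huc
      have c₃ := huc.snd.inner c₁ (𝕜 := ℝ)
      exact ((continuous_const.mul c₂).mul continuous_const).mul c₃
    obtain ⟨Kc, hKc⟩ := isCompact_Icc.exists_bound_of_continuousOn (s := Icc 0 T) cc.continuousOn
    have := eq_zero_of_abs_deriv_le_mul_abs_self_of_eq_zero_right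
      (f := fun t => ‖(u t).2‖ ^ 2 - 1) (K := Kc) (a := 0) (b := T)
      (by fun_prop) (fun t _ => (dh t).hasDerivWithinAt) (by simp [hu0, hvi])
      (fun t ht => by
        rw [norm_mul]
        exact mul_le_mul_of_nonneg_right (hKc t (Ico_subset_Icc_self ht)) (norm_nonneg _))
      T ⟨hT, le_rfl⟩
    have h1 : ‖(u T).2‖ ^ 2 = 1 := by linarith
    exact (pow_eq_one_iff_of_nonneg (norm_nonneg _) two_ne_zero).1 h1
  refine ⟨fun t => (u t).1, fun t => (u t).2, by simp [hu0], by simp [hu0], huc.fst, huc.snd, hnorm,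
    fun t ht htR => ?_⟩
  have hχ : χ (u t) = 1 := by
    refine χ.one_of_mem_closedBall ?_
    rw [mem_closedBall_iff_norm, Prod.norm_def]
    refine max_le (htR.trans ?_) ?_
    · change R ≤ R + 1; linarith
    · change ‖(u t).2 - 0‖ ≤ R + 1
      rw [sub_zero, hnorm t ht]; linarith
  have h₁ := dx t
  have h₂ := dv t
  rw [hχ, one_smul] at h₁ h₂
  exact ⟨h₁, h₂⟩

end GadField

theorem contDiff_gradient {N : ℕ} {E : EuclideanSpace ℝ (Fin N) → ℝ} {m n : WithTop ℕ∞}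
    (hE : ContDiff ℝ n E) (hmn : m + 1 ≤ n) : ContDiff ℝ m (gradient E) :=
  (InnerProductSpace.toDual ℝ _).symm.contDiff.comp (hE.fderiv_right hmn)

theorem contDiff_hessian {N : ℕ} {E : EuclideanSpace ℝ (Fin N) → ℝ} {m n : WithTop ℕ∞}
    (hE : ContDiff ℝ n E) (hmn : m + 1 + 1 ≤ n) : ContDiff ℝ m (hessian E) :=
  (contDiff_gradient hE hmn).fderiv_right le_rfl

section Symmetry

variable {N : ℕ} {E : EuclideanSpace ℝ (Fin N) → ℝ}

theorem hasFDerivAt_gradient (hE : ContDiff ℝ 2 E) (x : EuclideanSpace ℝ (Fin N)) :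
    HasFDerivAt (gradient E) (hessian E x) x :=
  ((contDiff_gradient hE (m := 1) (by norm_num)).differentiable one_ne_zero x).hasFDerivAt

theorem hasFDerivAt_hessian (hE : ContDiff ℝ 3 E) (x : EuclideanSpace ℝ (Fin N)) :
    HasFDerivAt (hessian E) (fderiv ℝ (hessian E) x) x :=
  ((contDiff_hessian hE (m := 1) (by norm_num)).differentiable one_ne_zero x).hasFDerivAt

theorem inner_hessian_comm (hE : ContDiff ℝ 2 E) (x u w : EuclideanSpace ℝ (Fin N)) :
    inner ℝ (hessian E x u) w = inner ℝ u (hessian E x w) := by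
  have hs : IsSymmSndFDerivAt ℝ E x := hE.contDiffAt.isSymmSndFDerivAt (by simp)
  have key : ∀ u w, fderiv ℝ (fderiv ℝ E) x u w = inner ℝ (hessian E x u) w := by
    intro u w
    have e : (fun y => fderiv ℝ E y w) = fun y => inner ℝ (gradient E y) w :=
      funext fun y => inner_gradient_left.symm
    have h₁ : HasFDerivAt (fun y => fderiv ℝ E y w) ((fderiv ℝ (fderiv ℝ E) x).flip w) x := by
      have : HasFDerivAt (fderiv ℝ E) (fderiv ℝ (fderiv ℝ E) x) x :=
        ((hE.fderiv_right (m := 1) (by norm_num)).differentiable one_ne_zero x).hasFDerivAt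
      simpa using this.clm_apply (hasFDerivAt_const w x)
    rw [e] at h₁
    have h₂ := (hasFDerivAt_gradient hE x).inner ℝ (hasFDerivAt_const w x)
    simpa using congrArg (fun L => L u) (h₁.unique h₂)
  rw [← key, hs.eq, key, real_inner_comm]

theorem fderiv_hessian_comm (hE : ContDiff ℝ 3 E) (x u w : EuclideanSpace ℝ (Fin N)) :
    fderiv ℝ (hessian E) x u w = fderiv ℝ (hessian E) x w u := by
  have hs : IsSymmSndFDerivAt ℝ (gradient E) x :=
    (contDiff_gradient hE (m := 2) (by norm_num)).contDiffAt.isSymmSndFDerivAt (by simp)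
  exact hs.eq u w

theorem inner_fderiv_hessian_comm (hE : ContDiff ℝ 3 E) (x y u w : EuclideanSpace ℝ (Fin N)) :
    inner ℝ (fderiv ℝ (hessian E) x y u) w = inner ℝ u (fderiv ℝ (hessian E) x y w) := by
  have hd : ∀ u, HasFDerivAt (fun x => hessian E x u)
      ((fderiv ℝ (hessian E) x).flip u) x := fun u => by
    simpa using (hasFDerivAt_hessian hE x).clm_apply (hasFDerivAt_const u x)
  have h₁ := (hd u).inner ℝ (hasFDerivAt_const w x)
  have h₂ := (hasFDerivAt_const u x).inner ℝ (hd w)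
  have e : (fun x => inner ℝ (hessian E x u) w) = fun x => inner ℝ u (hessian E x w) :=
    funext fun x => inner_hessian_comm (hE.of_le (by norm_num)) x u w
  rw [e] at h₁
  have := congrArg (fun L => L y) (h₁.unique h₂)
  simpa using this

end Symmetry

theorem eq_zero_and_isLittleO_of_add_mul {a : ℝ} {h : ℝ → ℝ} (hc : ContinuousAt h 0) {k : ℕ}
    (H : (fun t => a + t * h t) =o[𝓝[≠] 0] fun t => t ^ (k + 1)) :
    a = 0 ∧ h =o[𝓝[≠] 0] fun t => t ^ k := by
  have hpow : Tendsto (fun t : ℝ => t ^ (k + 1)) (𝓝[≠] 0) (𝓝 0) := by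
    have : Tendsto (fun t : ℝ => t ^ (k + 1)) (𝓝 0) (𝓝 (0 ^ (k + 1))) :=
      (continuous_pow (k + 1)).tendsto 0
    rw [zero_pow (Nat.succ_ne_zero k)] at this
    exact this.mono_left nhdsWithin_le_nhds
  have h₁ : Tendsto (fun t => a + t * h t) (𝓝[≠] 0) (𝓝 0) := H.trans_tendsto hpow
  have h₂ : Tendsto (fun t => a + t * h t) (𝓝[≠] 0) (𝓝 (a + 0 * h 0)) :=
    Tendsto.mono_left (tendsto_const_nhds.add (tendsto_id.mul hc.tendsto)) nhdsWithin_le_nhds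
  have ha : a = 0 := by simpa using tendsto_nhds_unique h₂ h₁
  refine ⟨ha, ?_⟩
  have := (isBigO_refl (fun t : ℝ => t⁻¹) (𝓝[≠] 0)).mul_isLittleO H
  refine this.congr' ?_ ?_
  · filter_upwards [self_mem_nhdsWithin] with t ht
    have : t ≠ 0 := ht
    rw [ha, zero_add, inv_mul_cancel_left₀ this]
  · filter_upwards [self_mem_nhdsWithin] with t ht
    have : t ≠ 0 := ht
    rw [pow_succ', inv_mul_cancel_left₀ this]

theorem cubic_coeff_eq_zero {a₀ a₁ a₂ a₃ : ℝ}
    (H : (fun t : ℝ => a₀ + a₁ * t + a₂ * t ^ 2 + a₃ * t ^ 3) =o[𝓝 0] fun t => t ^ 3) :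
    a₀ = 0 ∧ a₁ = 0 ∧ a₂ = 0 ∧ a₃ = 0 := by
  have H₀ : (fun t : ℝ => a₀ + t * (a₁ + t * (a₂ + t * a₃))) =o[𝓝[≠] 0] fun t => t ^ 3 :=
    (H.mono nhdsWithin_le_nhds).congr_left fun t => by ring
  obtain ⟨e₀, H₁⟩ := eq_zero_and_isLittleO_of_add_mul (by fun_prop) H₀
  obtain ⟨e₁, H₂⟩ := eq_zero_and_isLittleO_of_add_mul (by fun_prop) H₁
  obtain ⟨e₂, H₃⟩ := eq_zero_and_isLittleO_of_add_mul (by fun_prop) H₂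
  exact ⟨e₀, e₁, e₂, by simpa using H₃⟩

/-- The third order Taylor coefficients of `E` along a line through the origin. -/
theorem taylor_coeff_along_line {N : ℕ} {E : EuclideanSpace ℝ (Fin N) → ℝ} (hE : ContDiff ℝ 4 E)
    (w : EuclideanSpace ℝ (Fin N)) {p₁ p₂ p₃ : ℝ}
    (H : (fun t : ℝ => E (t • w) - (p₁ * t + p₂ * t ^ 2 + p₃ * t ^ 3)) =o[𝓝 0] fun t => t ^ 3) :
    inner ℝ (gradient E 0) w = p₁ ∧ inner ℝ (hessian E 0 w) w = 2 * p₂ ∧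
      inner ℝ (fderiv ℝ (hessian E) 0 w w) w = 6 * p₃ := by
  have hl : ∀ t : ℝ, HasDerivAt (fun t : ℝ => t • w) w t := fun t => by
    simpa using (hasDerivAt_id t).smul_const w
  have d₁ : deriv (fun t : ℝ => E (t • w)) = fun t => inner ℝ (gradient E (t • w)) w := by
    funext t
    have h₁ : HasFDerivAt E (fderiv ℝ E (t • w)) (t • w) :=
      (hE.differentiable (by norm_num) _).hasFDerivAt
    have := (h₁.comp_hasDerivAt t (hl t)).deriv
    rw [inner_gradient_left]
    exact this
  have d₂ : deriv (fun t : ℝ => inner ℝ (gradient E (t • w)) w)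
      = fun t => inner ℝ (hessian E (t • w) w) w := by
    funext t
    have h₁ := (hasFDerivAt_gradient (hE.of_le (by norm_num)) (t • w)).comp_hasDerivAt t (hl t)
    have := (h₁.inner ℝ (hasDerivAt_const t w)).deriv
    simpa using this
  have d₃ : deriv (fun t : ℝ => inner ℝ (hessian E (t • w) w) w)
      = fun t => inner ℝ (fderiv ℝ (hessian E) (t • w) w w) w := by
    funext t
    have h₁ := (hasFDerivAt_hessian (hE.of_le (by norm_num)) (t • w)).comp_hasDerivAt t (hl t)
    have h₂ := h₁.clm_apply (hasDerivAt_const t w)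
    have := (h₂.inner ℝ (hasDerivAt_const t w)).deriv
    simpa using this
  have hφ : ContDiff ℝ 3 (fun t : ℝ => E (t • w)) :=
    (hE.of_le (by norm_num)).comp (contDiff_id.smul contDiff_const)
  have ht := taylor_isLittleO_univ (x₀ := 0) (n := 3) hφ
  simp only [sub_zero] at ht
  have hsum := ht.sub H
  have hpoly := cubic_coeff_eq_zero (a₀ := -E 0) (a₁ := p₁ - inner ℝ (gradient E 0) w)
    (a₂ := p₂ - inner ℝ (hessian E 0 w) w / 2)
    (a₃ := p₃ - inner ℝ (fderiv ℝ (hessian E) 0 w w) w / 6) (by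
      refine (hsum.congr (fun t => ?_) (fun t => ?_))
      · simp only [taylor_within_apply, Finset.sum_range_succ, Finset.sum_range_zero,
          iteratedDerivWithin_univ, iteratedDeriv_succ', iteratedDeriv_zero, d₁, d₂, d₃]
        simp [Nat.factorial]
        ring
      · simp)
  obtain ⟨-, e₁, e₂, e₃⟩ := hpoly
  exact ⟨by linarith, by linarith, by linarith⟩

section IsotropicForm

variable {n : ℕ} {E : EuclideanSpace ℝ (Fin (n + 2)) → ℝ} {α lam : ℝ}
  {H : Matrix (Fin n) (Fin n) ℝ} {G : Fin n → Fin n → Fin n → ℝ}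

theorem HasIsotropicForm.taylor_coeff (h : HasIsotropicForm E α lam H G) (hE : ContDiff ℝ 4 E)
    (w : EuclideanSpace ℝ (Fin (n + 2))) :
    inner ℝ (gradient E 0) w = Real.cos α * w 0 + Real.sin α * w 1 ∧
    inner ℝ (hessian E 0 w) w = lam * (w 0 ^ 2 + w 1 ^ 2)
      + ∑ i : Fin n, ∑ j : Fin n, H i j * w i.succ.succ * w j.succ.succ ∧
    inner ℝ (fderiv ℝ (hessian E) 0 w w) w = 3 * (w 0 ^ 3 + w 0 * w 1 ^ 2)
      + ∑ i : Fin n, ∑ j : Fin n, ∑ k : Fin n,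
        G i j k * w i.succ.succ * w j.succ.succ * w k.succ.succ := by
  have hline : (fun t : ℝ => E (t • w) - ((Real.cos α * w 0 + Real.sin α * w 1) * t
      + (lam / 2 * (w 0 ^ 2 + w 1 ^ 2)
        + 1 / 2 * ∑ i : Fin n, ∑ j : Fin n, H i j * w i.succ.succ * w j.succ.succ) * t ^ 2
      + (1 / 2 * (w 0 ^ 3 + w 0 * w 1 ^ 2)
        + 1 / 6 * ∑ i : Fin n, ∑ j : Fin n, ∑ k : Fin n,
          G i j k * w i.succ.succ * w j.succ.succ * w k.succ.succ) * t ^ 3))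
      =o[𝓝 0] fun t => t ^ 3 := by
    have ht : Tendsto (fun t : ℝ => t • w) (𝓝 0) (𝓝 0) := by
      have : Continuous fun t : ℝ => t • w := by fun_prop
      simpa using this.tendsto 0
    have h₁ := IsBigO.comp_tendsto h ht
    have h₂ : (fun t : ℝ => ‖t • w‖ ^ 4) =o[𝓝 0] fun t => t ^ 3 := by
      have : (fun t : ℝ => ‖w‖ ^ 4 * t ^ 4) =o[𝓝 0] fun t => t ^ 3 :=
        (isLittleO_pow_pow (by norm_num : 3 < 4)).const_mul_left _
      refine this.congr_left fun t => ?_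
      rw [norm_smul, mul_pow, Real.norm_eq_abs, (by decide : Even 4).pow_abs]; ring
    refine (h₁.trans_isLittleO h₂).congr_left fun t => ?_
    have s₂ : ∑ i : Fin n, ∑ j : Fin n, H i j * (t * w i.succ.succ) * (t * w j.succ.succ)
        = (∑ i : Fin n, ∑ j : Fin n, H i j * w i.succ.succ * w j.succ.succ) * t ^ 2 := by
      simp only [Finset.sum_mul]
      exact Finset.sum_congr rfl fun i _ => Finset.sum_congr rfl fun j _ => by ring
    have s₃ : ∑ i : Fin n, ∑ j : Fin n, ∑ k : Fin n,
          G i j k * (t * w i.succ.succ) * (t * w j.succ.succ) * (t * w k.succ.succ)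
        = (∑ i : Fin n, ∑ j : Fin n, ∑ k : Fin n,
          G i j k * w i.succ.succ * w j.succ.succ * w k.succ.succ) * t ^ 3 := by
      simp only [Finset.sum_mul]
      exact Finset.sum_congr rfl fun i _ => Finset.sum_congr rfl fun j _ =>
        Finset.sum_congr rfl fun k _ => by ring
    simp only [Function.comp, isotropicCubic, PiLp.smul_apply, smul_eq_mul, s₂, s₃]
    ring
  obtain ⟨e₁, e₂, e₃⟩ := taylor_coeff_along_line hE w hline
  exact ⟨e₁, by rw [e₂]; ring, by rw [e₃]; ring⟩

end IsotropicForm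

/-- The third order jet of the gradient `g` at the origin of an energy of isotropic singular form:
`A` is the Hessian, `T` its derivative, and `e₁`, `e₂` span the isotropic plane. -/
structure IsIsotropicJet {X : Type*} [NormedAddCommGroup X] [InnerProductSpace ℝ X]
    (g₀ : X) (A : X →L[ℝ] X) (T : X →L[ℝ] X →L[ℝ] X) (e₁ e₂ : X) (c s lam κ : ℝ) : Prop where
  norm_left : ‖e₁‖ = 1
  norm_right : ‖e₂‖ = 1
  orth : inner ℝ e₁ e₂ = 0
  grad : g₀ = c • e₁ + s • e₂
  symm : ∀ u w, inner ℝ (A u) w = inner ℝ u (A w)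
  hess_left : A e₁ = lam • e₁
  hess_right : A e₂ = lam • e₂
  third_left : ∀ y, T y e₁ = (3 * inner ℝ e₁ y) • e₁ + inner ℝ e₂ y • e₂
  third_right : ∀ y, T y e₂ = inner ℝ e₂ y • e₁ + inner ℝ e₁ y • e₂
  coercive : ∀ w, inner ℝ e₁ w = 0 → inner ℝ e₂ w = 0 → κ * ‖w‖ ^ 2 ≤ inner ℝ w (A w)
  pos : 0 < κ
  gap : lam < κ

theorem Matrix.PosDef.exists_coercive {n : ℕ} {M : Matrix (Fin n) (Fin n) ℝ} (hM : M.PosDef) :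
    ∃ κ : ℝ, 0 < κ ∧ ∀ u : EuclideanSpace ℝ (Fin n),
      κ * ‖u‖ ^ 2 ≤ ∑ i, ∑ j, M i j * u i * u j := by
  set q : EuclideanSpace ℝ (Fin n) → ℝ := fun u => ∑ i, ∑ j, M i j * u i * u j with hq
  have hqc : Continuous q := by simp only [hq]; fun_prop
  have hpos : ∀ u, u ≠ 0 → 0 < q u := by
    intro u hu
    have hu' : (u : Fin n → ℝ) ≠ 0 := fun h => hu (by ext i; exact congrFun h i)
    have := hM.dotProduct_mulVec_pos hu'
    refine this.trans_eq ?_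
    simp only [dotProduct, Matrix.mulVec, Finset.mul_sum, hq, star_trivial]
    exact Finset.sum_congr rfl fun i _ => Finset.sum_congr rfl fun j _ => by ring
  have hhom : ∀ (r : ℝ) u, q (r • u) = r ^ 2 * q u := by
    intro r u
    simp only [hq, PiLp.smul_apply, smul_eq_mul, Finset.mul_sum]
    exact Finset.sum_congr rfl fun i _ => Finset.sum_congr rfl fun j _ => by ring
  rcases (Metric.sphere (0 : EuclideanSpace ℝ (Fin n)) 1).eq_empty_or_nonempty with he | hne
  · refine ⟨1, one_pos, fun u => ?_⟩
    have hu : u = 0 := by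
      by_contra hu
      have : (‖u‖⁻¹ • u) ∈ Metric.sphere (0 : EuclideanSpace ℝ (Fin n)) 1 := by
        simp [norm_smul, hu]
      rw [he] at this; exact this
    simp [hu]
  · obtain ⟨u₀, hu₀, hmin⟩ := (isCompact_sphere _ _).exists_isMinOn hne hqc.continuousOn
    have hu₀' : u₀ ≠ 0 := by
      rintro rfl; simp at hu₀
    refine ⟨q u₀, hpos u₀ hu₀', fun u => ?_⟩
    change q u₀ * ‖u‖ ^ 2 ≤ q u
    rcases eq_or_ne u 0 with rfl | hu
    · simp [hq]
    have hn : ‖u‖ ≠ 0 := norm_ne_zero_iff.2 hu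
    have hmem : (‖u‖⁻¹ • u) ∈ Metric.sphere (0 : EuclideanSpace ℝ (Fin n)) 1 := by
      simp [norm_smul, hu]
    have := hmin hmem
    change q u₀ ≤ q (‖u‖⁻¹ • u) at this
    rw [hhom, inv_pow] at this
    calc q u₀ * ‖u‖ ^ 2 ≤ (‖u‖ ^ 2)⁻¹ * q u * ‖u‖ ^ 2 := by gcongr
      _ = q u := by field_simp

section IsotropicForm

variable {n : ℕ} {E : EuclideanSpace ℝ (Fin (n + 2)) → ℝ} {α lam : ℝ}
  {H : Matrix (Fin n) (Fin n) ℝ} {G : Fin n → Fin n → Fin n → ℝ}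

/-- Polarisation of the cubic form of the third derivative. -/
theorem inner_fderiv_hessian_polarization {N : ℕ} {E : EuclideanSpace ℝ (Fin N) → ℝ}
    (hE : ContDiff ℝ 3 E) (x u w e : EuclideanSpace ℝ (Fin N)) {d : EuclideanSpace ℝ (Fin N) → ℝ}
    (hd : ∀ w, inner ℝ (fderiv ℝ (hessian E) x w w) w = d w) :
    24 * inner ℝ (fderiv ℝ (hessian E) x u e) w = d (u + w + e) - d (u + w - e)
      - d (u - w + e) + d (u - w - e) := by
  have s₁ := fun u w => fderiv_hessian_comm hE x u w
  have s₂ := fun y u w => inner_fderiv_hessian_comm hE x y u w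
  simp only [← hd, map_add, map_sub, add_apply, sub_apply,
    inner_add_left, inner_add_right, inner_sub_left, inner_sub_right]
  have a₁ : ∀ a b c : EuclideanSpace ℝ (Fin N), inner ℝ (fderiv ℝ (hessian E) x a b) c
      = inner ℝ (fderiv ℝ (hessian E) x b a) c := fun a b c => by rw [s₁]
  have a₂ : ∀ a b c : EuclideanSpace ℝ (Fin N), inner ℝ (fderiv ℝ (hessian E) x a b) c
      = inner ℝ (fderiv ℝ (hessian E) x a c) b := fun a b c => by rw [s₂, real_inner_comm]
  linarith [a₁ u w e, a₂ u w e, a₁ u e w, a₂ w u e, a₁ w e u, a₂ e u w]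

theorem HasIsotropicForm.isIsotropicJet (h : HasIsotropicForm E α lam H G) (hE : ContDiff ℝ 4 E)
    (hH : (H - max 0 lam • (1 : Matrix (Fin n) (Fin n) ℝ)).PosDef) :
    ∃ κ : ℝ, IsIsotropicJet (gradient E 0) (hessian E 0) (fderiv ℝ (hessian E) 0)
      (EuclideanSpace.single 0 1) (EuclideanSpace.single 1 1) (Real.cos α) (Real.sin α) lam κ := by
  obtain ⟨κ, hκ, hco⟩ := hH.exists_coercive
  have in₁ : ∀ w : EuclideanSpace ℝ (Fin (n + 2)),
      inner ℝ (EuclideanSpace.single 0 (1 : ℝ)) w = w 0 := fun w => by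
    simp [EuclideanSpace.inner_single_left]
  have in₂ : ∀ w : EuclideanSpace ℝ (Fin (n + 2)),
      inner ℝ (EuclideanSpace.single 1 (1 : ℝ)) w = w 1 := fun w => by
    simp [EuclideanSpace.inner_single_left]
  have h01 : (0 : Fin (n + 2)) ≠ 1 := by simp
  have hss0 : ∀ i : Fin n, i.succ.succ ≠ (0 : Fin (n + 2)) := fun i => Fin.succ_ne_zero _
  have hss1 : ∀ i : Fin n, i.succ.succ ≠ (1 : Fin (n + 2)) := fun i => by
    rw [← Fin.succ_zero_eq_one]
    exact fun h => Fin.succ_ne_zero i (Fin.succ_injective _ h)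
  set e₁ : EuclideanSpace ℝ (Fin (n + 2)) := EuclideanSpace.single 0 1 with he₁
  set e₂ : EuclideanSpace ℝ (Fin (n + 2)) := EuclideanSpace.single 1 1 with he₂
  have e₁0 : e₁ 0 = 1 := by simp [he₁]
  have e₁1 : e₁ 1 = 0 := by simp [he₁]
  have e₂0 : e₂ 0 = 0 := by simp [he₂]
  have e₂1 : e₂ 1 = 1 := by simp [he₂]
  have e₁s : ∀ i : Fin n, e₁ i.succ.succ = 0 := fun i => by simp [he₁, hss0]
  have e₂s : ∀ i : Fin n, e₂ i.succ.succ = 0 := fun i => by simp [he₂, hss1]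
  have t₁ := fun w => (h.taylor_coeff hE w).1
  have t₂ := fun w => (h.taylor_coeff hE w).2.1
  have t₃ := fun w => (h.taylor_coeff hE w).2.2
  have symm := inner_hessian_comm (hE.of_le (by norm_num) : ContDiff ℝ 2 E) 0
  have pol₂ : ∀ u w, 4 * inner ℝ (hessian E 0 u) w
      = inner ℝ (hessian E 0 (u + w)) (u + w) - inner ℝ (hessian E 0 (u - w)) (u - w) := by
    intro u w
    simp only [map_add, map_sub, inner_add_left, inner_add_right, inner_sub_left, inner_sub_right]
    have : inner ℝ (hessian E 0 w) u = inner ℝ (hessian E 0 u) w := by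
      rw [symm, real_inner_comm]
    linarith
  have sym_sum : ∀ e w : EuclideanSpace ℝ (Fin (n + 2)), (∀ i : Fin n, e i.succ.succ = 0) →
      ∑ i : Fin n, ∑ j : Fin n, H i j * (e + w) i.succ.succ * (e + w) j.succ.succ
      = ∑ i : Fin n, ∑ j : Fin n, H i j * (e - w) i.succ.succ * (e - w) j.succ.succ := by
    intro e w he
    refine Finset.sum_congr rfl fun i _ => Finset.sum_congr rfl fun j _ => ?_
    simp [he]
  have pol₃ := fun u w e => inner_fderiv_hessian_polarization (hE.of_le (by norm_num) : ContDiff ℝ 3 E)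
    0 u w e t₃
  refine ⟨max 0 lam + κ, by simp [he₁], by simp [he₂], by rw [in₁, e₂0], ?_, symm, ?_, ?_, ?_, ?_,
    ?_, by linarith [le_max_left 0 lam], by linarith [le_max_right 0 lam]⟩
  · refine ext_inner_right ℝ fun w => ?_
    rw [t₁, inner_add_left, inner_smul_left, inner_smul_left, in₁, in₂]; simp
  · refine ext_inner_right ℝ fun w => ?_
    have := pol₂ e₁ w
    rw [t₂, t₂, sym_sum e₁ w e₁s] at this
    simp only [PiLp.add_apply, PiLp.sub_apply, e₁0, e₁1] at this
    rw [inner_smul_left, in₁]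
    simp only [RCLike.conj_to_real]
    linarith
  · refine ext_inner_right ℝ fun w => ?_
    have := pol₂ e₂ w
    rw [t₂, t₂, sym_sum e₂ w e₂s] at this
    simp only [PiLp.add_apply, PiLp.sub_apply, e₂0, e₂1] at this
    rw [inner_smul_left, in₂]
    simp only [RCLike.conj_to_real]
    linarith
  · refine fun y => ext_inner_right ℝ fun w => ?_
    have := pol₃ y w e₁
    simp only [PiLp.add_apply, PiLp.sub_apply, e₁0, e₁1, e₁s, add_zero, sub_zero] at this
    rw [inner_add_left, inner_smul_left, inner_smul_left, in₁, in₂, in₁, in₂]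
    simp only [RCLike.conj_to_real]
    linarith
  · refine fun y => ext_inner_right ℝ fun w => ?_
    have := pol₃ y w e₂
    simp only [PiLp.add_apply, PiLp.sub_apply, e₂0, e₂1, e₂s, add_zero, sub_zero] at this
    rw [inner_add_left, inner_smul_left, inner_smul_left, in₁, in₂, in₁, in₂]
    simp only [RCLike.conj_to_real]
    linarith
  · intro w hw₁ hw₂
    rw [in₁] at hw₁
    rw [in₂] at hw₂
    rw [real_inner_comm, t₂, hw₁, hw₂]
    let u : EuclideanSpace ℝ (Fin n) := WithLp.toLp 2 fun i => w i.succ.succ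
    have hu := hco u
    have hn : ‖w‖ ^ 2 = ∑ i : Fin n, w i.succ.succ ^ 2 := by
      rw [EuclideanSpace.norm_sq_eq, Fin.sum_univ_succ, Fin.sum_univ_succ]
      simp [hw₁, hw₂]
    have hnu : ‖u‖ ^ 2 = ∑ i : Fin n, w i.succ.succ ^ 2 := by
      rw [EuclideanSpace.norm_sq_eq]; simp [u]
    have hs : ∑ i, ∑ j, (H - max 0 lam • (1 : Matrix (Fin n) (Fin n) ℝ)) i j * u i * u j
        = ∑ i : Fin n, ∑ j : Fin n, H i j * w i.succ.succ * w j.succ.succ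
          - max 0 lam * ∑ i : Fin n, w i.succ.succ ^ 2 := by
      rw [Finset.mul_sum, ← Finset.sum_sub_distrib]
      refine Finset.sum_congr rfl fun i _ => ?_
      simp only [Matrix.sub_apply, Matrix.smul_apply, Matrix.one_apply, smul_eq_mul, sub_mul,
        Finset.sum_sub_distrib, u]
      congr 1
      simp
      ring
    rw [hs, hnu] at hu
    rw [hn]
    linarith

end IsotropicForm

/-- Quantitative local surjectivity from the inverse function theorem. -/
theorem exists_preimage_of_fderiv_injective {Y : Type*} [NormedAddCommGroup Y] [NormedSpace ℝ Y]
    [FiniteDimensional ℝ Y] {Φ : Y → Y} (hΦ : ContDiff ℝ 1 Φ) {y₀ : Y} (h0 : Φ y₀ = 0)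
    (hinj : Function.Injective (fderiv ℝ Φ y₀)) :
    ∃ K r : ℝ, 0 < K ∧ 0 < r ∧ ∀ w, ‖w‖ < r → ∃ y, Φ y = w ∧ ‖y - y₀‖ ≤ K * ‖w‖ := by
  have : CompleteSpace Y := FiniteDimensional.complete ℝ Y
  let L : Y ≃L[ℝ] Y := (LinearEquiv.ofInjectiveEndo (fderiv ℝ Φ y₀ : Y →ₗ[ℝ] Y)
    hinj).toContinuousLinearEquiv
  have hL : (L : Y →L[ℝ] Y) = fderiv ℝ Φ y₀ := by ext v; rfl
  have hs : HasStrictFDerivAt Φ (L : Y →L[ℝ] Y) y₀ := by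
    rw [hL]; exact hΦ.contDiffAt.hasStrictFDerivAt one_ne_zero
  have hO := hs.to_localInverse.hasFDerivAt.isBigO_sub
  obtain ⟨K, hK, hO⟩ := hO.exists_pos
  have hev := hO.bound.and hs.eventually_right_inverse
  rw [h0] at hev
  obtain ⟨r, hr, hball⟩ := Metric.eventually_nhds_iff.1 hev
  refine ⟨K, r, hK, hr, fun w hw => ?_⟩
  obtain ⟨b₁, b₂⟩ := hball (show dist w 0 < r by simpa using hw)
  refine ⟨hs.localInverse Φ L y₀ w, b₂, ?_⟩
  have := hs.localInverse_apply_image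
  rw [h0] at this
  rw [this] at b₁
  simpa using b₁

section Orthonormalization

variable {X : Type*} [NormedAddCommGroup X] [InnerProductSpace ℝ X]

theorem norm_normalize_sub_le {f e : X} {η : ℝ} (he : ‖e‖ = 1) (hη : η < 1) (h : ‖f - e‖ ≤ η) :
    0 < ‖f‖ ∧ ‖‖f‖⁻¹ • f - e‖ ≤ 2 * η := by
  have h₁ : |‖f‖ - ‖e‖| ≤ η := (abs_norm_sub_norm_le f e).trans h
  rw [he] at h₁
  have hpos : 0 < ‖f‖ := by linarith [(abs_le.1 h₁).1]
  refine ⟨hpos, ?_⟩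
  have e₁ : ‖‖f‖⁻¹ • f - f‖ = |‖f‖ - 1| := by
    have : ‖f‖⁻¹ • f - f = (‖f‖⁻¹ * (1 - ‖f‖)) • f := by
      rw [mul_sub, inv_mul_cancel₀ hpos.ne', sub_smul, mul_one, one_smul]
    rw [this, norm_smul, norm_mul, norm_inv, norm_norm, Real.norm_eq_abs, abs_sub_comm]
    field_simp
  calc _ = ‖(‖f‖⁻¹ • f - f) + (f - e)‖ := by congr 1; abel
    _ ≤ ‖‖f‖⁻¹ • f - f‖ + ‖f - e‖ := norm_add_le _ _
    _ ≤ 2 * η := by rw [e₁]; linarith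

/-- Gram-Schmidt for two vectors which are almost orthonormal. -/
theorem exists_orthonormal_pair_near {e₁ e₂ f₁ f₂ : X} {η : ℝ} (he₁ : ‖e₁‖ = 1) (he₂ : ‖e₂‖ = 1)
    (he : inner ℝ e₁ e₂ = 0) (hη : η ≤ 1 / 10) (h₁ : ‖f₁ - e₁‖ ≤ η) (h₂ : ‖f₂ - e₂‖ ≤ η) :
    ∃ d₁ d₂ : X, ‖d₁‖ = 1 ∧ ‖d₂‖ = 1 ∧ inner ℝ d₁ d₂ = 0 ∧ ‖d₁ - e₁‖ ≤ 10 * η ∧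
      ‖d₂ - e₂‖ ≤ 10 * η ∧ (∃ p : ℝ, d₁ = p • f₁) ∧ (∃ p q : ℝ, d₂ = p • f₁ + q • f₂) ∧
      (∃ p : ℝ, f₁ = p • d₁) ∧ ∃ p q : ℝ, f₂ = p • d₁ + q • d₂ := by
  have hη0 : 0 ≤ η := (norm_nonneg _).trans h₁
  obtain ⟨n₁, k₁⟩ := norm_normalize_sub_le he₁ (by linarith) h₁
  obtain ⟨d₁, hd₁⟩ : ∃ d, d = ‖f₁‖⁻¹ • f₁ := ⟨_, rfl⟩
  rw [← hd₁] at k₁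
  have hd₁n : ‖d₁‖ = 1 := by rw [hd₁, norm_smul, norm_inv, norm_norm, inv_mul_cancel₀ n₁.ne']
  obtain ⟨m, hm⟩ : ∃ m : ℝ, m = inner ℝ d₁ f₂ := ⟨_, rfl⟩
  have hm' : |m| ≤ 4 * η := by
    have e : m = inner ℝ (d₁ - e₁) f₂ + inner ℝ e₁ (f₂ - e₂) := by
      rw [hm, inner_sub_left, inner_sub_right, he]; ring
    have b₁ : |inner ℝ (d₁ - e₁) f₂| ≤ 2 * η * (1 + η) := by
      refine (abs_real_inner_le_norm _ _).trans ?_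
      have : ‖f₂‖ ≤ 1 + η := by
        have := norm_add_le e₂ (f₂ - e₂); rw [add_sub_cancel, he₂] at this; linarith
      gcongr
    have b₂ : |inner ℝ e₁ (f₂ - e₂)| ≤ η := by
      refine (abs_real_inner_le_norm _ _).trans ?_; rw [he₁, one_mul]; exact h₂
    rw [e]
    refine (abs_add_le _ _).trans ?_
    nlinarith
  obtain ⟨p, hp⟩ : ∃ p, p = f₂ - m • d₁ := ⟨_, rfl⟩
  have hpe : ‖p - e₂‖ ≤ 5 * η := by
    have : p - e₂ = (f₂ - e₂) - m • d₁ := by rw [hp]; abel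
    rw [this]
    refine (norm_sub_le _ _).trans ?_
    rw [norm_smul, hd₁n, Real.norm_eq_abs]; linarith
  obtain ⟨n₂, k₂⟩ := norm_normalize_sub_le he₂ (by linarith) hpe
  have hdp : inner ℝ d₁ p = 0 := by
    rw [hp, inner_sub_right, inner_smul_right, real_inner_self_eq_norm_sq, hd₁n, hm]; ring
  refine ⟨d₁, ‖p‖⁻¹ • p, hd₁n, ?_, ?_, by linarith, by linarith, ⟨_, hd₁⟩,
    ⟨-(‖p‖⁻¹ * m * ‖f₁‖⁻¹), ‖p‖⁻¹, ?_⟩, ⟨‖f₁‖, ?_⟩, ⟨m, ‖p‖, ?_⟩⟩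
  · rw [norm_smul, norm_inv, norm_norm, inv_mul_cancel₀ n₂.ne']
  · rw [inner_smul_right, hdp, mul_zero]
  · rw [hp, hd₁]; module
  · rw [hd₁, smul_smul, mul_inv_cancel₀ n₁.ne', one_smul]
  · rw [smul_smul, mul_inv_cancel₀ n₂.ne', one_smul, hp]; abel

end Orthonormalization

section Branch

variable {X : Type*} [NormedAddCommGroup X] [InnerProductSpace ℝ X]

/-- The equations for an isotropic singularity: with `f₁ = e₁ + u'`, `f₂ = e₂ + r'` (the primes
denoting components orthogonal to the plane), the plane of `f₁`, `f₂` is invariant under the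
Hessian and contains the gradient. -/
noncomputable def singularityMap (g₀ g₁ : X → X) (B₀ B₁ : X → X →L[ℝ] X) (e₁ e₂ : X)
    (p : ℝ × X × X × X) : X × X × X :=
  ((B₀ p.2.1 + p.1 • B₁ p.2.1) (e₁ + planePerp e₁ e₂ p.2.2.1)
      - inner ℝ e₁ p.2.2.1 • (e₁ + planePerp e₁ e₂ p.2.2.1)
      - inner ℝ e₂ p.2.2.1 • (e₂ + planePerp e₁ e₂ p.2.2.2),
    (B₀ p.2.1 + p.1 • B₁ p.2.1) (e₂ + planePerp e₁ e₂ p.2.2.2)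
      - inner ℝ e₁ p.2.2.1 • (e₂ + planePerp e₁ e₂ p.2.2.2),
    g₀ p.2.1 + p.1 • g₁ p.2.1 - inner ℝ e₁ p.2.2.2 • (e₁ + planePerp e₁ e₂ p.2.2.1)
      - inner ℝ e₂ p.2.2.2 • (e₂ + planePerp e₁ e₂ p.2.2.2))

theorem contDiff_planePerp (f₁ f₂ : X) : ContDiff ℝ 1 (planePerp f₁ f₂) := by
  have : ∀ f : X, ContDiff ℝ 1 fun v : X => inner ℝ f v • f := fun f =>
    (contDiff_const.inner ℝ contDiff_id).smul contDiff_const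
  exact (contDiff_id.sub (this f₁)).sub (this f₂)

theorem contDiff_singularityMap {g₀ g₁ : X → X} {B₀ B₁ : X → X →L[ℝ] X} (hg₀ : ContDiff ℝ 1 g₀)
    (hg₁ : ContDiff ℝ 1 g₁) (hB₀ : ContDiff ℝ 1 B₀) (hB₁ : ContDiff ℝ 1 B₁) (e₁ e₂ : X) :
    ContDiff ℝ 1 (singularityMap g₀ g₁ B₀ B₁ e₁ e₂) := by
  have c₁ : ContDiff ℝ 1 fun p : ℝ × X × X × X => p.1 := contDiff_fst
  have c₂ : ContDiff ℝ 1 fun p : ℝ × X × X × X => p.2.1 := contDiff_snd.fst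
  have c₃ : ContDiff ℝ 1 fun p : ℝ × X × X × X => p.2.2.1 := contDiff_snd.snd.fst
  have c₄ : ContDiff ℝ 1 fun p : ℝ × X × X × X => p.2.2.2 := contDiff_snd.snd.snd
  have f₁ := contDiff_const (c := e₁).add ((contDiff_planePerp e₁ e₂).comp c₃)
  have f₂ := contDiff_const (c := e₂).add ((contDiff_planePerp e₁ e₂).comp c₄)
  have b := (hB₀.comp c₂).add (c₁.smul (hB₁.comp c₂))
  have i : ∀ (e : X) {q : ℝ × X × X × X → X}, ContDiff ℝ 1 q →
      ContDiff ℝ 1 fun p => inner ℝ e (q p) := fun e q hq => contDiff_const.inner ℝ hq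
  exact (((b.clm_apply f₁).sub ((i e₁ c₃).smul f₁)).sub ((i e₂ c₃).smul f₂)).prodMk
    (((b.clm_apply f₂).sub ((i e₁ c₃).smul f₂)).prodMk
    ((((hg₀.comp c₂).add (c₁.smul (hg₁.comp c₂))).sub ((i e₁ c₄).smul f₁)).sub ((i e₂ c₄).smul f₂)))

end Branch

section Branch

variable {X : Type*} [NormedAddCommGroup X] [InnerProductSpace ℝ X]
  {g₀ g₁ : X → X} {B₀ B₁ : X → X →L[ℝ] X} {T : X →L[ℝ] X →L[ℝ] X} {e₁ e₂ : X} {c s lam κ : ℝ}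

theorem IsIsotropicJet.planePerp_lin
    (h : IsIsotropicJet (g₀ 0) (B₀ 0) T e₁ e₂ c s lam κ) (a b t : ℝ) (u : X) :
    planePerp e₁ e₂ (a • e₁ + b • e₂ + t • u) = t • planePerp e₁ e₂ u := by
  have ho' : inner ℝ e₂ e₁ = 0 := by rw [real_inner_comm]; exact h.orth
  simp only [planePerp, inner_add_right, inner_smul_right, real_inner_self_eq_norm_sq, h.norm_left,
    h.norm_right, h.orth, ho']
  module

theorem IsIsotropicJet.inner_lin
    (h : IsIsotropicJet (g₀ 0) (B₀ 0) T e₁ e₂ c s lam κ) (a b t : ℝ) (u : X) :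
    inner ℝ e₁ (a • e₁ + b • e₂ + t • u) = a + t * inner ℝ e₁ u ∧
      inner ℝ e₂ (a • e₁ + b • e₂ + t • u) = b + t * inner ℝ e₂ u := by
  have ho' : inner ℝ e₂ e₁ = 0 := by rw [real_inner_comm]; exact h.orth
  simp only [inner_add_right, inner_smul_right, real_inner_self_eq_norm_sq, h.norm_left,
    h.norm_right, h.orth, ho']
  constructor <;> ring

theorem singularityMap_base (h : IsIsotropicJet (g₀ 0) (B₀ 0) T e₁ e₂ c s lam κ) :
    singularityMap g₀ g₁ B₀ B₁ e₁ e₂ (0, 0, lam • e₁, c • e₁ + s • e₂) = 0 := by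
  have p₁ := h.planePerp_lin lam 0 0 0
  have p₂ := h.planePerp_lin c s 0 0
  obtain ⟨i₁, i₂⟩ := h.inner_lin lam 0 0 0
  obtain ⟨i₃, i₄⟩ := h.inner_lin c s 0 0
  simp only [zero_smul, add_zero, zero_mul] at p₁ p₂ i₁ i₂ i₃ i₄
  simp only [singularityMap, p₁, p₂, i₁, i₂, i₃, i₄, h.hess_left, h.hess_right, h.grad, zero_smul,
    add_zero]
  simp

/-- Directional derivatives of `singularityMap` at the unperturbed singularity. -/
theorem hasDerivAt_singularityMap (h : IsIsotropicJet (g₀ 0) (B₀ 0) T e₁ e₂ c s lam κ)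
    (hg : HasFDerivAt g₀ (B₀ 0) 0) (hB : HasFDerivAt B₀ T 0) (z u r : X) :
    HasDerivAt (fun t : ℝ => singularityMap g₀ g₁ B₀ B₁ e₁ e₂
        ((0, 0, lam • e₁, c • e₁ + s • e₂) + t • (0, z, u, r)))
      (T z e₁ + B₀ 0 (planePerp e₁ e₂ u) - inner ℝ e₁ u • e₁ - lam • planePerp e₁ e₂ u
          - inner ℝ e₂ u • e₂,
        T z e₂ + B₀ 0 (planePerp e₁ e₂ r) - inner ℝ e₁ u • e₂ - lam • planePerp e₁ e₂ r,
        B₀ 0 z - inner ℝ e₁ r • e₁ - c • planePerp e₁ e₂ u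
          - inner ℝ e₂ r • e₂ - s • planePerp e₁ e₂ r) 0 := by
  set U := planePerp e₁ e₂ u
  set V := planePerp e₁ e₂ r
  have hline : (fun t : ℝ => singularityMap g₀ g₁ B₀ B₁ e₁ e₂
      ((0, 0, lam • e₁, c • e₁ + s • e₂) + t • (0, z, u, r)))
      = fun t : ℝ => (B₀ (t • z) (e₁ + t • U) - (lam + t * inner ℝ e₁ u) • (e₁ + t • U)
          - (t * inner ℝ e₂ u) • (e₂ + t • V),
        B₀ (t • z) (e₂ + t • V) - (lam + t * inner ℝ e₁ u) • (e₂ + t • V),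
        g₀ (t • z) - (c + t * inner ℝ e₁ r) • (e₁ + t • U)
          - (s + t * inner ℝ e₂ r) • (e₂ + t • V)) := by
    funext t
    have p₁ := h.planePerp_lin lam 0 t u
    have p₂ := h.planePerp_lin c s t r
    obtain ⟨i₁, i₂⟩ := h.inner_lin lam 0 t u
    obtain ⟨i₃, i₄⟩ := h.inner_lin c s t r
    simp only [zero_smul, add_zero, zero_add] at p₁ i₁ i₂
    simp only [singularityMap, Prod.smul_mk, Prod.mk_add_mk, smul_zero, zero_add, zero_smul,
      add_zero, p₁, p₂, i₁, i₂, i₃, i₄, U, V]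
  rw [hline]
  have lin : ∀ w : X, HasDerivAt (fun t : ℝ => t • w) w 0 := fun w => by
    simpa using (hasDerivAt_id (0 : ℝ)).smul_const w
  have linr : ∀ a b : ℝ, HasDerivAt (fun t : ℝ => a + t * b) b 0 := fun a b => by
    simpa using ((hasDerivAt_id (0 : ℝ)).mul_const b).const_add a
  have dB : HasDerivAt (fun t : ℝ => B₀ (t • z)) (T z) 0 := by
    have : HasFDerivAt B₀ T ((0 : ℝ) • z) := by rwa [zero_smul]
    exact this.comp_hasDerivAt 0 (lin z)
  have dg : HasDerivAt (fun t : ℝ => g₀ (t • z)) (B₀ 0 z) 0 := by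
    have : HasFDerivAt g₀ (B₀ 0) ((0 : ℝ) • z) := by rwa [zero_smul]
    exact this.comp_hasDerivAt 0 (lin z)
  have d₁ : HasDerivAt (fun t : ℝ => e₁ + t • U) U 0 := (lin U).const_add e₁
  have d₂ : HasDerivAt (fun t : ℝ => e₂ + t • V) V 0 := (lin V).const_add e₂
  have dl : HasDerivAt (fun t : ℝ => t * inner ℝ e₂ u) (inner ℝ e₂ u) 0 := by
    simpa using linr 0 (inner ℝ e₂ u)
  have D₁ := ((dB.clm_apply d₁).sub ((linr lam (inner ℝ e₁ u)).smul d₁)).sub (dl.smul d₂)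
  have D₂ := (dB.clm_apply d₂).sub ((linr lam (inner ℝ e₁ u)).smul d₂)
  have D₃ := (dg.sub ((linr c (inner ℝ e₁ r)).smul d₁)).sub ((linr s (inner ℝ e₂ r)).smul d₂)
  refine (D₁.prodMk (D₂.prodMk D₃)).congr_deriv ?_
  simp only [zero_smul, add_zero, zero_mul]
  refine Prod.ext ?_ (Prod.ext ?_ ?_)
  · simp only; abel
  · simp only; abel
  · simp only; abel

theorem singularityMap_deriv_injective (h : IsIsotropicJet (g₀ 0) (B₀ 0) T e₁ e₂ c s lam κ)
    {z u r : X}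
    (h₁ : T z e₁ + B₀ 0 (planePerp e₁ e₂ u) - inner ℝ e₁ u • e₁ - lam • planePerp e₁ e₂ u
          - inner ℝ e₂ u • e₂ = 0)
    (h₂ : T z e₂ + B₀ 0 (planePerp e₁ e₂ r) - inner ℝ e₁ u • e₂ - lam • planePerp e₁ e₂ r = 0)
    (h₃ : B₀ 0 z - inner ℝ e₁ r • e₁ - c • planePerp e₁ e₂ u
          - inner ℝ e₂ r • e₂ - s • planePerp e₁ e₂ r = 0) : z = 0 ∧ u = 0 ∧ r = 0 := by
  have ho' : inner ℝ e₂ e₁ = 0 := by rw [real_inner_comm]; exact h.orth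
  have perp : ∀ w : X, inner ℝ e₁ w = 0 → inner ℝ e₂ w = 0 →
      inner ℝ e₁ (B₀ 0 w) = 0 ∧ inner ℝ e₂ (B₀ 0 w) = 0 := fun w k₁ k₂ => by
    rw [← h.symm, ← h.symm, h.hess_left, h.hess_right, inner_smul_left, inner_smul_left, k₁, k₂]
    simp
  have perp_zero : ∀ w : X, inner ℝ e₁ w = 0 → inner ℝ e₂ w = 0 → ∀ l < κ,
      inner ℝ w (B₀ 0 w) = l * ‖w‖ ^ 2 → w = 0 := fun w k₁ k₂ l hl k₃ => by
    have := h.coercive w k₁ k₂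
    by_contra hw
    have : 0 < ‖w‖ ^ 2 := by positivity
    nlinarith
  have U₁ := inner_left_planePerp h.norm_left h.orth u
  have U₂ := inner_right_planePerp h.norm_right h.orth u
  have V₁ := inner_left_planePerp h.norm_left h.orth r
  have V₂ := inner_right_planePerp h.norm_right h.orth r
  have hu := eq_add_planePerp e₁ e₂ u
  have hr := eq_add_planePerp e₁ e₂ r
  set U := planePerp e₁ e₂ u
  set V := planePerp e₁ e₂ r
  rw [h.third_left] at h₁
  rw [h.third_right] at h₂
  have expand : ∀ f : X, inner ℝ f _ = _ := fun f => congrArg (inner ℝ f) h₁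
  have expand' : ∀ f : X, inner ℝ f _ = _ := fun f => congrArg (inner ℝ f) h₂
  have a₁ := expand e₁
  have a₂ := expand e₂
  have a₃ := expand U
  have b₁ := expand' e₁
  have b₂ := expand' e₂
  have b₃ := expand' V
  have cU₁ : inner ℝ U e₁ = 0 := by rw [real_inner_comm]; exact U₁
  have cU₂ : inner ℝ U e₂ = 0 := by rw [real_inner_comm]; exact U₂
  have cV₁ : inner ℝ V e₁ = 0 := by rw [real_inner_comm]; exact V₁
  have cV₂ : inner ℝ V e₂ = 0 := by rw [real_inner_comm]; exact V₂
  simp only [inner_add_right, inner_sub_right, inner_smul_right, real_inner_self_eq_norm_sq,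
    h.norm_left, h.norm_right, h.orth, ho', U₁, U₂, V₁, V₂, cU₁, cU₂, cV₁, cV₂, inner_zero_right,
    (perp U U₁ U₂).1, (perp U U₁ U₂).2, (perp V V₁ V₂).1, (perp V V₁ V₂).2] at a₁ a₂ a₃ b₁ b₂ b₃
  have hU : U = 0 := perp_zero U U₁ U₂ lam h.gap (by linarith)
  have hV : V = 0 := perp_zero V V₁ V₂ lam h.gap (by linarith)
  have z₁ : inner ℝ e₁ z = 0 := by linarith
  have z₂ : inner ℝ e₂ z = 0 := by linarith
  have u₁ : inner ℝ e₁ u = 0 := by linarith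
  have u₂ : inner ℝ e₂ u = 0 := by linarith
  rw [hU, hV, smul_zero, smul_zero, sub_zero, sub_zero] at h₃
  have cz₁ : inner ℝ z e₁ = 0 := by rw [real_inner_comm]; exact z₁
  have cz₂ : inner ℝ z e₂ = 0 := by rw [real_inner_comm]; exact z₂
  have c₁ := congrArg (inner ℝ z) h₃
  have c₂ := congrArg (inner ℝ e₁) h₃
  have c₃ := congrArg (inner ℝ e₂) h₃
  simp only [inner_sub_right, inner_smul_right, real_inner_self_eq_norm_sq,
    h.norm_left, h.norm_right, h.orth, ho', cz₁, cz₂, (perp z z₁ z₂).1, (perp z z₁ z₂).2,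
    inner_zero_right] at c₁ c₂ c₃
  have hz : z = 0 := perp_zero z z₁ z₂ 0 h.pos (by linarith)
  have r₁ : inner ℝ e₁ r = 0 := by linarith
  have r₂ : inner ℝ e₂ r = 0 := by linarith
  refine ⟨hz, ?_, ?_⟩
  · rw [hu, hU, u₁, u₂]; simp
  · rw [hr, hV, r₁, r₂]; simp

/-- Persistence of the isotropic singularity under perturbations. -/
theorem exists_singularity_branch [FiniteDimensional ℝ X]
    (h : IsIsotropicJet (g₀ 0) (B₀ 0) T e₁ e₂ c s lam κ)
    (hg₀ : ContDiff ℝ 1 g₀) (hg₁ : ContDiff ℝ 1 g₁) (hB₀ : ContDiff ℝ 1 B₀) (hB₁ : ContDiff ℝ 1 B₁)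
    (hg : HasFDerivAt g₀ (B₀ 0) 0) (hB : HasFDerivAt B₀ T 0) :
    ∃ K δ₁ : ℝ, 0 < K ∧ 0 < δ₁ ∧ ∀ δ, 0 < δ → δ < δ₁ → ∃ z u r : X,
      singularityMap g₀ g₁ B₀ B₁ e₁ e₂ (δ, z, u, r) = 0 ∧ ‖z‖ ≤ K * δ ∧
      ‖u - lam • e₁‖ ≤ K * δ ∧ ‖r - (c • e₁ + s • e₂)‖ ≤ K * δ := by
  set S := singularityMap g₀ g₁ B₀ B₁ e₁ e₂ with hS
  set y₀ : ℝ × X × X × X := (0, 0, lam • e₁, c • e₁ + s • e₂) with hy₀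
  have hSc : ContDiff ℝ 1 S := contDiff_singularityMap hg₀ hg₁ hB₀ hB₁ e₁ e₂
  have hΦ : ContDiff ℝ 1 fun p : ℝ × X × X × X => (p.1, S p) := contDiff_fst.prodMk hSc
  have h0 : (fun p : ℝ × X × X × X => (p.1, S p)) y₀ = 0 := by
    simp only [hS, hy₀, singularityMap_base h]; rfl
  have hd : HasFDerivAt S (fderiv ℝ S y₀) y₀ := (hSc.differentiable one_ne_zero y₀).hasFDerivAt
  have hdΦ : fderiv ℝ (fun p : ℝ × X × X × X => (p.1, S p)) y₀
      = (ContinuousLinearMap.fst ℝ ℝ (X × X × X)).prod (fderiv ℝ S y₀) :=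
    (hasFDerivAt_fst.prodMk hd).fderiv
  have hinj : Function.Injective (fderiv ℝ (fun p : ℝ × X × X × X => (p.1, S p)) y₀) := by
    rw [hdΦ]
    refine (injective_iff_map_eq_zero _).2 ?_
    rintro ⟨d, z, u, r⟩ hp
    obtain ⟨hp₁, hp₂⟩ := Prod.ext_iff.1 hp
    change d = 0 at hp₁
    change fderiv ℝ S y₀ (d, z, u, r) = 0 at hp₂
    subst hp₁
    have hline : HasDerivAt (fun t : ℝ => y₀ + t • ((0, z, u, r) : ℝ × X × X × X)) (0, z, u, r) 0 := by
      simpa using ((hasDerivAt_id (0 : ℝ)).smul_const ((0, z, u, r) : ℝ × X × X × X)).const_add y₀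
    have hcomp : HasDerivAt (fun t : ℝ => S (y₀ + t • ((0, z, u, r) : ℝ × X × X × X)))
        (fderiv ℝ S y₀ (0, z, u, r)) 0 := by
      have hd' : HasFDerivAt S (fderiv ℝ S y₀) (y₀ + (0 : ℝ) • ((0, z, u, r) : ℝ × X × X × X)) := by
        rwa [zero_smul, add_zero]
      exact hd'.comp_hasDerivAt 0 hline
    have huniq := hcomp.unique (hasDerivAt_singularityMap h hg hB z u r)
    rw [hp₂] at huniq
    obtain ⟨q₁, q₂⟩ := Prod.ext_iff.1 huniq
    obtain ⟨q₂, q₃⟩ := Prod.ext_iff.1 q₂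
    obtain ⟨rfl, rfl, rfl⟩ := singularityMap_deriv_injective h q₁.symm q₂.symm q₃.symm
    rfl
  obtain ⟨K, ρ, hK, hρ, hsol⟩ := exists_preimage_of_fderiv_injective hΦ h0 hinj
  refine ⟨K, ρ, hK, hρ, fun δ hδ hδρ => ?_⟩
  have hn : ‖((δ, 0) : ℝ × X × X × X)‖ = δ := by
    rw [Prod.norm_def, norm_zero, Real.norm_eq_abs, abs_of_pos hδ]; exact max_eq_left hδ.le
  obtain ⟨⟨d, z, u, r⟩, hy, hyK⟩ := hsol (δ, 0) (by rw [hn]; exact hδρ)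
  obtain ⟨hd₁, hS0⟩ := Prod.ext_iff.1 hy
  change d = δ at hd₁
  subst hd₁
  rw [hn] at hyK
  have hb : ‖((d, z, u, r) : ℝ × X × X × X) - y₀‖
      = max ‖d - 0‖ (max ‖z - 0‖ (max ‖u - lam • e₁‖ ‖r - (c • e₁ + s • e₂)‖)) := rfl
  rw [hb] at hyK
  obtain ⟨-, hyK⟩ := max_le_iff.1 hyK
  obtain ⟨hz, hyK⟩ := max_le_iff.1 hyK
  obtain ⟨hu, hr⟩ := max_le_iff.1 hyK
  exact ⟨z, u, r, hS0, by simpa using hz, hu, hr⟩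

end Branch

section LocalEstimates

variable {X : Type*} [NormedAddCommGroup X] [InnerProductSpace ℝ X]

theorem exists_bound_on_closedBall [FiniteDimensional ℝ X] {Y : Type*} [NormedAddCommGroup Y]
    {f : X → Y} (hf : Continuous f) : ∃ K : ℝ, 0 ≤ K ∧ ∀ x, ‖x‖ ≤ 1 → ‖f x‖ ≤ K := by
  have : ProperSpace X := FiniteDimensional.proper ℝ X
  obtain ⟨K, hK⟩ := (isCompact_closedBall (0 : X) 1).exists_bound_of_continuousOn hf.continuousOn
  exact ⟨|K|, abs_nonneg K, fun x hx => (hK x (by simpa using hx)).trans (le_abs_self K)⟩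

/-- Taylor estimates near the origin, uniform in the perturbation parameter. -/
theorem exists_perturbation_estimates [FiniteDimensional ℝ X] {g₀ g₁ : X → X}
    {B₀ B₁ : X → X →L[ℝ] X} {D₀ D₁ : X → X →L[ℝ] X →L[ℝ] X}
    (hg₀ : ∀ x, HasFDerivAt g₀ (B₀ x) x) (hg₁ : ∀ x, HasFDerivAt g₁ (B₁ x) x)
    (hB₀ : ∀ x, HasFDerivAt B₀ (D₀ x) x) (hB₁ : ∀ x, HasFDerivAt B₁ (D₁ x) x)
    (hD₀ : ContDiff ℝ 1 D₀) (hD₁ : Continuous D₁) :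
    ∃ K : ℝ, 1 ≤ K ∧ ∀ δ : ℝ, 0 ≤ δ → δ ≤ 1 → ∀ z y : X, ‖z‖ ≤ 1 / 2 → ‖y‖ ≤ 1 / 2 →
      ‖g₀ z + δ • g₁ z - g₀ 0‖ ≤ K * (‖z‖ + δ) ∧
      ‖B₀ (z + y) + δ • B₁ (z + y)‖ ≤ K ∧
      ‖B₀ (z + y) + δ • B₁ (z + y) - B₀ 0‖ ≤ K * (‖z‖ + ‖y‖ + δ) ∧
      ‖(g₀ (z + y) + δ • g₁ (z + y)) - (g₀ z + δ • g₁ z) - (B₀ z + δ • B₁ z) y‖ ≤ K * ‖y‖ ^ 2 ∧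
      ‖(B₀ (z + y) + δ • B₁ (z + y)) - (B₀ z + δ • B₁ z) - D₀ 0 y‖
        ≤ K * ‖y‖ * (‖z‖ + ‖y‖ + δ) := by
  have cg₁ : Continuous g₁ := continuous_iff_continuousAt.2 fun x => (hg₁ x).continuousAt
  have cB₀ : Continuous B₀ := continuous_iff_continuousAt.2 fun x => (hB₀ x).continuousAt
  have cB₁ : Continuous B₁ := continuous_iff_continuousAt.2 fun x => (hB₁ x).continuousAt
  obtain ⟨k₁, p₁, b₁⟩ := exists_bound_on_closedBall cg₁
  obtain ⟨k₂, p₂, b₂⟩ := exists_bound_on_closedBall cB₀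
  obtain ⟨k₃, p₃, b₃⟩ := exists_bound_on_closedBall cB₁
  obtain ⟨k₄, p₄, b₄⟩ := exists_bound_on_closedBall hD₀.continuous
  obtain ⟨k₅, p₅, b₅⟩ := exists_bound_on_closedBall (Y := X →L[ℝ] X →L[ℝ] X) (f := D₁) hD₁
  obtain ⟨k₆, p₆, b₆⟩ := exists_bound_on_closedBall (hD₀.continuous_fderiv one_ne_zero)
  have hconv : Convex ℝ (Metric.closedBall (0 : X) 1) := convex_closedBall 0 1
  have mem : ∀ {x : X}, x ∈ Metric.closedBall (0 : X) 1 ↔ ‖x‖ ≤ 1 := by simp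
  have h0 : (0 : X) ∈ Metric.closedBall (0 : X) 1 := by simp
  have l₁ : ∀ x, ‖x‖ ≤ 1 → ‖g₀ x - g₀ 0‖ ≤ k₂ * ‖x‖ := fun x hx => by
    simpa using hconv.norm_image_sub_le_of_norm_hasFDerivWithin_le
      (fun y _ => (hg₀ y).hasFDerivWithinAt) (fun y hy => b₂ y (mem.1 hy)) h0 (mem.2 hx)
  have l₂ : ∀ x, ‖x‖ ≤ 1 → ‖B₀ x - B₀ 0‖ ≤ k₄ * ‖x‖ := fun x hx => by
    simpa using hconv.norm_image_sub_le_of_norm_hasFDerivWithin_le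
      (fun y _ => (hB₀ y).hasFDerivWithinAt) (fun y hy => b₄ y (mem.1 hy)) h0 (mem.2 hx)
  have l₃ : ∀ x, ‖x‖ ≤ 1 → ‖D₀ x - D₀ 0‖ ≤ k₆ * ‖x‖ := fun x hx => by
    simpa using hconv.norm_image_sub_le_of_norm_hasFDerivWithin_le
      (fun y _ => ((hD₀.differentiable one_ne_zero) y).hasFDerivAt.hasFDerivWithinAt)
      (fun y hy => b₆ y (mem.1 hy)) h0 (mem.2 hx)
  refine ⟨1 + k₁ + k₂ + k₃ + k₄ + k₅ + k₆, by linarith, fun δ hδ hδ1 z y hz hy => ?_⟩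
  set K := 1 + k₁ + k₂ + k₃ + k₄ + k₅ + k₆ with hK
  have sm : ∀ {Y : Type _} [NormedAddCommGroup Y] [NormedSpace ℝ Y] (a : Y) {k : ℝ}, ‖a‖ ≤ k →
      ‖δ • a‖ ≤ k * δ := fun a k h => by
    rw [norm_smul, Real.norm_eq_abs, abs_of_nonneg hδ, mul_comm]; gcongr
  have hzy : ‖z + y‖ ≤ ‖z‖ + ‖y‖ := norm_add_le _ _
  have hzy1 : ‖z + y‖ ≤ 1 := by linarith
  have hz1 : ‖z‖ ≤ 1 := by linarith
  have nz := norm_nonneg z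
  have ny := norm_nonneg y
  have gd : ∀ x, HasFDerivAt (fun x => g₀ x + δ • g₁ x) (B₀ x + δ • B₁ x) x := fun x =>
    (hg₀ x).add ((hg₁ x).const_smul δ)
  have Bd : ∀ x, HasFDerivAt (fun x => B₀ x + δ • B₁ x) (D₀ x + δ • D₁ x) x := fun x =>
    (hB₀ x).add ((hB₁ x).const_smul δ)
  set S := Metric.closedBall z ‖y‖ with hS
  have hSc : Convex ℝ S := convex_closedBall z ‖y‖
  have zS : z ∈ S := by simp [hS]
  have zyS : z + y ∈ S := by simp [hS]
  have nS : ∀ x ∈ S, ‖x‖ ≤ ‖z‖ + ‖y‖ := fun x hx => by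
    have h : ‖x - z‖ ≤ ‖y‖ := by simpa [hS, dist_eq_norm] using hx
    have := norm_add_le z (x - z)
    rw [add_sub_cancel] at this; linarith
  have Blip : ∀ x ∈ S, ‖(B₀ x + δ • B₁ x) - (B₀ z + δ • B₁ z)‖ ≤ K * ‖y‖ := fun x hx => by
    have h : ‖x - z‖ ≤ ‖y‖ := by simpa [hS, dist_eq_norm] using hx
    refine (hSc.norm_image_sub_le_of_norm_hasFDerivWithin_le (C := K)
      (fun y _ => (Bd y).hasFDerivWithinAt) (fun w hw => ?_) zS hx).trans ?_
    · have hw1 : ‖w‖ ≤ 1 := by linarith [nS w hw]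
      have := sm (D₁ w) (b₅ w hw1)
      have := b₄ w hw1
      have : k₅ * δ ≤ k₅ := by nlinarith
      linarith [norm_add_le (D₀ w) (δ • D₁ w)]
    · gcongr
  refine ⟨?_, ?_, ?_, ?_, ?_⟩
  · have e : g₀ z + δ • g₁ z - g₀ 0 = (g₀ z - g₀ 0) + δ • g₁ z := by abel
    rw [e]
    have := norm_add_le (g₀ z - g₀ 0) (δ • g₁ z)
    have := l₁ z hz1
    have := sm (g₁ z) (b₁ z hz1)
    have : k₂ * ‖z‖ ≤ K * ‖z‖ := by gcongr; linarith
    have : k₁ * δ ≤ K * δ := by gcongr; linarith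
    linarith
  · have := norm_add_le (B₀ (z + y)) (δ • B₁ (z + y))
    have := sm (B₁ (z + y)) (b₃ _ hzy1)
    have := b₂ _ hzy1
    have : k₃ * δ ≤ k₃ := by nlinarith
    linarith
  · have e : B₀ (z + y) + δ • B₁ (z + y) - B₀ 0 = (B₀ (z + y) - B₀ 0) + δ • B₁ (z + y) := by abel
    rw [e]
    have := norm_add_le (B₀ (z + y) - B₀ 0) (δ • B₁ (z + y))
    have := l₂ _ hzy1
    have := sm (B₁ (z + y)) (b₃ _ hzy1)
    have : k₄ * ‖z + y‖ ≤ K * (‖z‖ + ‖y‖) := by gcongr; linarith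
    have : k₃ * δ ≤ K * δ := by gcongr; linarith
    linarith
  · have := hSc.norm_image_sub_le_of_norm_hasFDerivWithin_le'
      (fun y _ => (gd y).hasFDerivWithinAt) Blip zS zyS
    rw [add_sub_cancel_left] at this
    refine this.trans_eq (by ring)
  · have := hSc.norm_image_sub_le_of_norm_hasFDerivWithin_le' (φ := D₀ 0)
      (C := K * (‖z‖ + ‖y‖ + δ)) (fun y _ => (Bd y).hasFDerivWithinAt) (fun w hw => ?_) zS zyS
    · rw [add_sub_cancel_left] at this
      refine this.trans_eq (by ring)
    · have nw := nS w hw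
      have hw1 : ‖w‖ ≤ 1 := by linarith
      have e : D₀ w + δ • D₁ w - D₀ 0 = (D₀ w - D₀ 0) + δ • D₁ w := by abel
      rw [e]
      have := norm_add_le (D₀ w - D₀ 0) (δ • D₁ w)
      have := l₃ _ hw1
      have := sm (D₁ w) (b₅ _ hw1)
      have : k₆ * ‖w‖ ≤ K * (‖z‖ + ‖y‖) := by gcongr; linarith
      have : k₅ * δ ≤ K * δ := by gcongr; linarith
      linarith

theorem norm_inner_smul_sub_inner_smul_le {d e b a : X} (hb : ‖b‖ = 1) (he : ‖e‖ = 1) {η : ℝ}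
    (h₁ : ‖d - e‖ ≤ η) (h₂ : ‖b - a‖ ≤ η) (y : X) :
    ‖inner ℝ d y • b - inner ℝ e y • a‖ ≤ 2 * η * ‖y‖ := by
  have e' : inner ℝ d y • b - inner ℝ e y • a
      = inner ℝ (d - e) y • b + inner ℝ e y • (b - a) := by
    rw [inner_sub_left]; module
  have i₁ : |inner ℝ (d - e) y| ≤ η * ‖y‖ := (abs_real_inner_le_norm _ _).trans (by gcongr)
  have i₂ := abs_inner_le_of_norm_eq_one he y
  rw [e']
  refine (norm_add_le _ _).trans ?_
  rw [norm_smul, norm_smul, hb, Real.norm_eq_abs, Real.norm_eq_abs]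
  have : |inner ℝ e y| * ‖b - a‖ ≤ ‖y‖ * η := by gcongr
  linarith

namespace IsIsotropicJet

variable {a : X} {A : X →L[ℝ] X} {T : X →L[ℝ] X →L[ℝ] X} {e₁ e₂ d₁ d₂ : X} {c s lam κ η : ℝ}

theorem norm_third_left_sub_le (h : IsIsotropicJet a A T e₁ e₂ c s lam κ) (n₁ : ‖d₁‖ = 1)
    (n₂ : ‖d₂‖ = 1) (h₁ : ‖d₁ - e₁‖ ≤ η) (h₂ : ‖d₂ - e₂‖ ≤ η) (y : X) :
    ‖T y d₁ - ((3 * inner ℝ d₁ y) • d₁ + inner ℝ d₂ y • d₂)‖ ≤ (‖T‖ + 8) * η * ‖y‖ := by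
  have i₁ := norm_inner_smul_sub_inner_smul_le n₁ h.norm_left h₁ h₁ y
  have i₂ := norm_inner_smul_sub_inner_smul_le n₂ h.norm_right h₂ h₂ y
  have i₃ : ‖T y (d₁ - e₁)‖ ≤ ‖T‖ * ‖y‖ * η := (T.le_opNorm₂ y _).trans (by gcongr)
  have e : T y d₁ - ((3 * inner ℝ d₁ y) • d₁ + inner ℝ d₂ y • d₂)
      = T y (d₁ - e₁) - (3 : ℝ) • (inner ℝ d₁ y • d₁ - inner ℝ e₁ y • e₁)
        - (inner ℝ d₂ y • d₂ - inner ℝ e₂ y • e₂) := by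
    rw [map_sub, h.third_left]; module
  rw [e]
  refine (norm_sub_le _ _).trans ?_
  have := norm_sub_le (T y (d₁ - e₁)) ((3 : ℝ) • (inner ℝ d₁ y • d₁ - inner ℝ e₁ y • e₁))
  rw [norm_smul, Real.norm_eq_abs, abs_of_nonneg (by norm_num : (0 : ℝ) ≤ 3)] at this
  linarith

theorem norm_third_right_sub_le (h : IsIsotropicJet a A T e₁ e₂ c s lam κ) (n₁ : ‖d₁‖ = 1)
    (n₂ : ‖d₂‖ = 1) (h₁ : ‖d₁ - e₁‖ ≤ η) (h₂ : ‖d₂ - e₂‖ ≤ η) (y : X) :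
    ‖T y d₂ - (inner ℝ d₂ y • d₁ + inner ℝ d₁ y • d₂)‖ ≤ (‖T‖ + 8) * η * ‖y‖ := by
  have i₁ := norm_inner_smul_sub_inner_smul_le n₁ h.norm_right h₂ h₁ y
  have i₂ := norm_inner_smul_sub_inner_smul_le n₂ h.norm_left h₁ h₂ y
  have i₃ : ‖T y (d₂ - e₂)‖ ≤ ‖T‖ * ‖y‖ * η := (T.le_opNorm₂ y _).trans (by gcongr)
  have e : T y d₂ - (inner ℝ d₂ y • d₁ + inner ℝ d₁ y • d₂)
      = T y (d₂ - e₂) - (inner ℝ d₂ y • d₁ - inner ℝ e₂ y • e₁)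
        - (inner ℝ d₁ y • d₂ - inner ℝ e₁ y • e₂) := by
    rw [map_sub, h.third_right]; module
  rw [e]
  refine (norm_sub_le _ _).trans ?_
  have := norm_sub_le (T y (d₂ - e₂)) (inner ℝ d₂ y • d₁ - inner ℝ e₂ y • e₁)
  have : 0 ≤ η * ‖y‖ := mul_nonneg ((norm_nonneg _).trans h₁) (norm_nonneg y)
  linarith

/-- Stability of the coercivity transverse to the isotropic plane. -/
theorem coercive_of_near (h : IsIsotropicJet a A T e₁ e₂ c s lam κ) (h₁ : ‖d₁ - e₁‖ ≤ η)
    (h₂ : ‖d₂ - e₂‖ ≤ η) {B : X →L[ℝ] X} {ρ : ℝ} (hB : ‖B - A‖ ≤ ρ) {w : X}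
    (hw₁ : inner ℝ d₁ w = 0) (hw₂ : inner ℝ d₂ w = 0) :
    (κ - 2 * (κ - lam) * η ^ 2 - ρ) * ‖w‖ ^ 2 ≤ inner ℝ w (B w) := by
  have b : ∀ {d e : X}, ‖d - e‖ ≤ η → inner ℝ d w = 0 → inner ℝ e w ^ 2 ≤ η ^ 2 * ‖w‖ ^ 2 := by
    intro d e hd hdw
    have e₁ : inner ℝ e w = - inner ℝ (d - e) w := by rw [inner_sub_left, hdw]; ring
    have : |inner ℝ (d - e) w| ≤ η * ‖w‖ := (abs_real_inner_le_norm _ _).trans (by gcongr)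
    rw [e₁, neg_sq, ← mul_pow, ← sq_abs]
    gcongr
  have b₁ := b h₁ hw₁
  have b₂ := b h₂ hw₂
  have q₁ := inner_left_planePerp h.norm_left h.orth w
  have q₂ := inner_right_planePerp h.norm_right h.orth w
  have hn := norm_sq_eq_add_planePerp h.norm_left h.norm_right h.orth w
  have hco := h.coercive _ q₁ q₂
  have eA : inner ℝ w (A w) = lam * (inner ℝ e₁ w ^ 2 + inner ℝ e₂ w ^ 2)
      + inner ℝ (planePerp e₁ e₂ w) (A (planePerp e₁ e₂ w)) := by
    have r₁ : inner ℝ e₁ (A (planePerp e₁ e₂ w)) = 0 := by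
      rw [← h.symm, h.hess_left, inner_smul_left, q₁, mul_zero]
    have r₂ : inner ℝ e₂ (A (planePerp e₁ e₂ w)) = 0 := by
      rw [← h.symm, h.hess_right, inner_smul_left, q₂, mul_zero]
    have e₀ : A w = (lam * inner ℝ e₁ w) • e₁ + (lam * inner ℝ e₂ w) • e₂
        + A (planePerp e₁ e₂ w) := by
      conv_lhs => rw [eq_add_planePerp e₁ e₂ w]
      simp only [map_add, map_smul, h.hess_left, h.hess_right]
      module
    have e₃ : inner ℝ w (A (planePerp e₁ e₂ w))
        = inner ℝ (planePerp e₁ e₂ w) (A (planePerp e₁ e₂ w)) := by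
      nth_rewrite 1 [eq_add_planePerp e₁ e₂ w]
      simp only [inner_add_left, inner_smul_left, r₁, r₂]
      ring
    rw [e₀, inner_add_right, inner_add_right, inner_smul_right, inner_smul_right, e₃,
      real_inner_comm e₁, real_inner_comm e₂]
    ring
  have hBA : |inner ℝ w ((B - A) w)| ≤ ρ * ‖w‖ ^ 2 := by
    refine (abs_real_inner_le_norm _ _).trans ?_
    have := (B - A).le_of_opNorm_le hB w
    calc ‖w‖ * ‖(B - A) w‖ ≤ ‖w‖ * (ρ * ‖w‖) := by gcongr
      _ = _ := by ring
  have eB : inner ℝ w (B w) = inner ℝ w (A w) + inner ℝ w ((B - A) w) := by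
    rw [sub_apply, inner_sub_right]; ring
  have hg := h.gap
  have : (κ - lam) * (inner ℝ e₁ w ^ 2 + inner ℝ e₂ w ^ 2)
      ≤ (κ - lam) * (2 * (η ^ 2 * ‖w‖ ^ 2)) :=
    mul_le_mul_of_nonneg_left (by linarith) (by linarith)
  have hκ : κ * ‖w‖ ^ 2 = κ * (inner ℝ e₁ w ^ 2 + inner ℝ e₂ w ^ 2)
      + κ * ‖planePerp e₁ e₂ w‖ ^ 2 := by rw [hn]; ring
  rw [eB, eA]
  linarith [(abs_le.1 hBA).1]

end IsIsotropicJet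

end LocalEstimates

section NearIsotropic

variable {X : Type*} [NormedAddCommGroup X] [InnerProductSpace ℝ X]
  {g₀ g₁ : X → X} {B₀ B₁ : X → X →L[ℝ] X} {T : X →L[ℝ] X →L[ℝ] X} {e₁ e₂ : X} {c s lam κ : ℝ}

theorem inner_eq_zero_of_mem_plane {f₁ f₂ v w : X} (h₁ : inner ℝ f₁ w = 0) (h₂ : inner ℝ f₂ w = 0)
    (hv : ∃ p q : ℝ, v = p • f₁ + q • f₂) : inner ℝ v w = 0 := by
  obtain ⟨p, q, rfl⟩ := hv
  rw [inner_add_left, inner_smul_left, inner_smul_left, h₁, h₂, mul_zero, mul_zero, add_zero]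

theorem IsIsotropicJet.norm_planePerp_le_of_norm_sub_le {a : X} {A : X →L[ℝ] X}
    (h : IsIsotropicJet a A T e₁ e₂ c s lam κ) {u : X} {p q η : ℝ}
    (hu : ‖u - (p • e₁ + q • e₂)‖ ≤ η) : ‖planePerp e₁ e₂ u‖ ≤ η := by
  have h' : inner ℝ e₂ e₁ = 0 := by rw [real_inner_comm]; exact h.orth
  have : planePerp e₁ e₂ u = planePerp e₁ e₂ (u - (p • e₁ + q • e₂)) := by
    simp only [planePerp, inner_sub_right, inner_add_right, inner_smul_right, h.orth, h',
      real_inner_self_eq_norm_sq, h.norm_left, h.norm_right]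
    module
  rw [this]
  exact (norm_planePerp_le h.norm_left h.norm_right h.orth _).trans hu

/-- The zeros of the singularity map carry an orthonormal basis of a double eigenspace of the
Hessian which contains the gradient. -/
theorem IsIsotropicJet.exists_eigenplane_of_singularityMap_eq_zero
    (h : IsIsotropicJet (g₀ 0) (B₀ 0) T e₁ e₂ c s lam κ)
    (hsym₀ : ∀ x u w, inner ℝ (B₀ x u) w = inner ℝ u (B₀ x w))
    (hsym₁ : ∀ x u w, inner ℝ (B₁ x u) w = inner ℝ u (B₁ x w))
    {δ η : ℝ} {z u r : X} (hΦ : singularityMap g₀ g₁ B₀ B₁ e₁ e₂ (δ, z, u, r) = 0)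
    (hη : η ≤ 1 / 10) (hu : ‖u - lam • e₁‖ ≤ η) (hr : ‖r - (c • e₁ + s • e₂)‖ ≤ η) :
    ∃ (d₁ d₂ : X) (μ : ℝ), ‖d₁‖ = 1 ∧ ‖d₂‖ = 1 ∧ inner ℝ d₁ d₂ = 0 ∧ ‖d₁ - e₁‖ ≤ 10 * η ∧
      ‖d₂ - e₂‖ ≤ 10 * η ∧ |μ - lam| ≤ η ∧ (B₀ z + δ • B₁ z) d₁ = μ • d₁ ∧
      (B₀ z + δ • B₁ z) d₂ = μ • d₂ ∧
      ∀ w, inner ℝ d₁ w = 0 → inner ℝ d₂ w = 0 → inner ℝ w (g₀ z + δ • g₁ z) = 0 := by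
  have hB : ∀ u w, inner ℝ ((B₀ z + δ • B₁ z) u) w = inner ℝ u ((B₀ z + δ • B₁ z) w) := by
    intro u w
    simp only [add_apply, smul_apply, inner_add_left, inner_add_right,
      inner_smul_left, inner_smul_right, hsym₀, hsym₁, RCLike.conj_to_real]
  obtain ⟨B, hBdef⟩ : ∃ B, B = B₀ z + δ • B₁ z := ⟨_, rfl⟩
  obtain ⟨F₁, hF₁⟩ : ∃ F, F = e₁ + planePerp e₁ e₂ u := ⟨_, rfl⟩
  obtain ⟨F₂, hF₂⟩ : ∃ F, F = e₂ + planePerp e₁ e₂ r := ⟨_, rfl⟩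
  simp only [singularityMap, Prod.mk_eq_zero] at hΦ
  obtain ⟨q₁, q₂, q₃⟩ := hΦ
  simp only [← hBdef] at q₁ q₂ hB ⊢
  rw [← hF₁, ← hF₂] at q₁ q₃
  rw [← hF₂] at q₂
  have k₁ : ‖F₁ - e₁‖ ≤ η := by
    rw [hF₁, add_sub_cancel_left]
    exact h.norm_planePerp_le_of_norm_sub_le (p := lam) (q := 0) (by simpa using hu)
  have k₂ : ‖F₂ - e₂‖ ≤ η := by
    rw [hF₂, add_sub_cancel_left]
    exact h.norm_planePerp_le_of_norm_sub_le hr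
  obtain ⟨d₁, d₂, n₁, n₂, o, b₁, b₂, ⟨p₁, m₁⟩, ⟨p₂, p₃, m₂⟩, ⟨p₄, m₃⟩, p₅, p₆, m₄⟩ :=
    exists_orthonormal_pair_near h.norm_left h.norm_right h.orth hη k₁ k₂
  set μ := inner ℝ e₁ u with hμ
  have E₂ : B F₂ = μ • F₂ := sub_eq_zero.1 q₂
  have E₁ : B F₁ = μ • F₁ + inner ℝ e₂ u • F₂ := by
    rw [sub_sub, sub_eq_zero] at q₁; exact q₁
  have hF₂0 : F₂ ≠ 0 := by
    rintro rfl
    rw [zero_sub, norm_neg, h.norm_right] at k₂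
    linarith
  have hτ : inner ℝ e₂ u = 0 := by
    have := hB F₁ F₂
    rw [E₁, E₂, inner_add_left, inner_smul_left, inner_smul_left, inner_smul_right,
      real_inner_self_eq_norm_sq] at this
    simp only [RCLike.conj_to_real, add_eq_left] at this
    exact (mul_eq_zero.1 this).resolve_right (by simpa using hF₂0)
  rw [hτ, zero_smul, add_zero] at E₁
  refine ⟨d₁, d₂, μ, n₁, n₂, o, b₁, b₂, ?_, ?_, ?_, fun w hw₁ hw₂ => ?_⟩
  · have : μ - lam = inner ℝ e₁ (u - lam • e₁) := by
      rw [inner_sub_right, inner_smul_right, real_inner_self_eq_norm_sq, h.norm_left]; ring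
    rw [this]
    exact (abs_inner_le_of_norm_eq_one h.norm_left _).trans hu
  · rw [m₁, map_smul, E₁, smul_comm]
  · rw [m₂, map_add, map_smul, map_smul, E₁, E₂]; module
  · have w₁ : inner ℝ F₁ w = 0 := by rw [m₃, inner_smul_left, hw₁, mul_zero]
    have w₂ : inner ℝ F₂ w = 0 := inner_eq_zero_of_mem_plane hw₁ hw₂ ⟨_, _, m₄⟩
    rw [real_inner_comm]
    refine inner_eq_zero_of_mem_plane w₁ w₂ ⟨inner ℝ e₁ r, inner ℝ e₂ r, ?_⟩
    rw [sub_sub, sub_eq_zero] at q₃; exact q₃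

set_option maxHeartbeats 800000 in
/-- Persistence of the isotropic singularity under perturbation. -/
theorem IsIsotropicJet.exists_isNearIsotropic [FiniteDimensional ℝ X]
    {D₀ D₁ : X → X →L[ℝ] X →L[ℝ] X}
    (h : IsIsotropicJet (g₀ 0) (B₀ 0) (D₀ 0) e₁ e₂ c s lam κ)
    (hg₀ : ∀ x, HasFDerivAt g₀ (B₀ x) x) (hg₁ : ∀ x, HasFDerivAt g₁ (B₁ x) x)
    (hB₀ : ∀ x, HasFDerivAt B₀ (D₀ x) x) (hB₁ : ∀ x, HasFDerivAt B₁ (D₁ x) x)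
    (hD₀ : ContDiff ℝ 1 D₀) (hD₁ : Continuous D₁) (cg₀ : ContDiff ℝ 1 g₀) (cg₁ : ContDiff ℝ 1 g₁)
    (cB₀ : ContDiff ℝ 1 B₀) (cB₁ : ContDiff ℝ 1 B₁)
    (hsym₀ : ∀ x u w, inner ℝ (B₀ x u) w = inner ℝ u (B₀ x w))
    (hsym₁ : ∀ x u w, inner ℝ (B₁ x u) w = inner ℝ u (B₁ x w)) :
    ∃ K C R κ' γ δ₁ : ℝ, 0 < K ∧ 1 ≤ C ∧ 0 < R ∧ 0 < κ' ∧ 0 < γ ∧ 0 < δ₁ ∧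
      ∀ δ, 0 < δ → δ < δ₁ → ∃ (z f₁ f₂ : X) (μ : ℝ), ‖z‖ ≤ K * δ ∧
        IsNearIsotropic (fun x => g₀ x + δ • g₁ x) (fun x => B₀ x + δ • B₁ x) z f₁ f₂ μ κ' γ c s
          C R δ := by
  obtain ⟨L, hL, est⟩ := exists_perturbation_estimates hg₀ hg₁ hB₀ hB₁ hD₀ hD₁
  obtain ⟨K, δ₁, hK, hδ₁, hbr⟩ :=
    exists_singularity_branch h cg₀ cg₁ cB₀ cB₁ (hg₀ 0) (hB₀ 0)
  obtain ⟨d, hd⟩ : ∃ d, d = κ - max 0 lam := ⟨_, rfl⟩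
  have hdpos : 0 < d := by rw [hd, sub_pos]; exact max_lt h.pos h.gap
  have hmax := le_max_right 0 lam
  have hmax0 := le_max_left 0 lam
  have hgap := h.gap
  set Q := ‖D₀ 0‖ with hQ
  have hQ0 : 0 ≤ Q := norm_nonneg (D₀ 0)
  set C := L * (K + 1) + 10 * K * (|c| + |s|) + (Q + 8) * (10 * K) with hC
  have hC₁ : L * (K + 1) ≤ C := by
    have : 0 ≤ 10 * K * (|c| + |s|) := by positivity
    have : 0 ≤ (Q + 8) * (10 * K) := by positivity
    linarith
  have hLC : L ≤ C := by nlinarith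
  set R := min (1 / 2) (d / (8 * L)) with hRdef
  have hR : 0 < R := by positivity
  have hRL : L * R ≤ d / 8 := by
    calc L * R ≤ L * (d / (8 * L)) := by gcongr; exact min_le_right _ _
      _ = d / 8 := by field_simp
  set θ := min (min δ₁ 1) (min (1 / (10 * K)) (min (d / (800 * (κ - lam) * K + 8 * L * (K + 1)))
    (d / (4 * K)))) with hθ
  have hkl : 0 < κ - lam := by linarith
  have hθpos : 0 < θ := by positivity
  refine ⟨K, C, R, κ - d / 2, d / 4, θ, hK, hL.trans hLC, hR, by linarith, by linarith, hθpos,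
    fun δ hδ hδθ => ?_⟩
  have t₁ : δ < δ₁ := hδθ.trans_le ((min_le_left _ _).trans (min_le_left _ _))
  have t₂ : δ < 1 := hδθ.trans_le ((min_le_left _ _).trans (min_le_right _ _))
  have t₃ : K * δ ≤ 1 / 10 := by
    have : δ ≤ 1 / (10 * K) := hδθ.le.trans ((min_le_right _ _).trans (min_le_left _ _))
    rw [le_div_iff₀ (by positivity)] at this; linarith
  have t₄ : δ * (800 * (κ - lam) * K + 8 * L * (K + 1)) ≤ d := by
    have : δ ≤ d / (800 * (κ - lam) * K + 8 * L * (K + 1)) :=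
      hδθ.le.trans ((min_le_right _ _).trans ((min_le_right _ _).trans (min_le_left _ _)))
    rwa [le_div_iff₀ (by positivity)] at this
  have t₅ : K * δ ≤ d / 4 := by
    have : δ ≤ d / (4 * K) :=
      hδθ.le.trans ((min_le_right _ _).trans ((min_le_right _ _).trans (min_le_right _ _)))
    rw [le_div_iff₀ (by positivity)] at this; linarith
  obtain ⟨z, u, r, hΦ, hz, hu, hr⟩ := hbr δ hδ t₁
  obtain ⟨d₁, d₂, μ, n₁, n₂, o, b₁, b₂, hμ, E₁, E₂, hmem⟩ :=
    h.exists_eigenplane_of_singularityMap_eq_zero hsym₀ hsym₁ hΦ t₃ hu hr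
  have hz2 : ‖z‖ ≤ 1 / 2 := by linarith
  have hKδ : 0 < K * δ := by positivity
  have est' := fun y (hy : ‖y‖ ≤ R) =>
    est δ hδ.le t₂.le z y hz2 (hy.trans (min_le_left _ _))
  have hdir : ∀ (y d' f : X), ‖y‖ ≤ R → ‖d'‖ = 1 → (B₀ z + δ • B₁ z) d' = μ • d' →
      ‖D₀ 0 y d' - f‖ ≤ (Q + 8) * (10 * (K * δ)) * ‖y‖ →
      ‖(B₀ (z + y) + δ • B₁ (z + y)) d' - μ • d' - f‖ ≤ C * ‖y‖ * (‖y‖ + δ) := by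
    intro y d' f hy hd' hE hf
    obtain ⟨-, -, -, -, j⟩ := est' y hy
    have e : (B₀ (z + y) + δ • B₁ (z + y)) d' - μ • d' - f
        = ((B₀ (z + y) + δ • B₁ (z + y)) - (B₀ z + δ • B₁ z) - D₀ 0 y) d' + (D₀ 0 y d' - f) := by
      rw [← hE, sub_apply, sub_apply]; abel
    have j' := (((B₀ (z + y) + δ • B₁ (z + y)) - (B₀ z + δ • B₁ z) - D₀ 0 y)).le_of_opNorm_le j d'
    rw [hd', mul_one] at j'
    rw [e]
    refine (norm_add_le _ _).trans ((add_le_add j' hf).trans ?_)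
    have y0 := norm_nonneg y
    have k₁ : ‖z‖ + ‖y‖ + δ ≤ (K + 1) * (‖y‖ + δ) := by nlinarith
    have k₂ : L * ‖y‖ * (‖z‖ + ‖y‖ + δ) ≤ L * ‖y‖ * ((K + 1) * (‖y‖ + δ)) := by gcongr
    have k₃ : (Q + 8) * (10 * (K * δ)) * ‖y‖ ≤ (Q + 8) * (10 * K) * ‖y‖ * (‖y‖ + δ) := by
      have : (Q + 8) * (10 * (K * δ)) * ‖y‖ = (Q + 8) * (10 * K) * ‖y‖ * δ := by ring
      rw [this]; gcongr; linarith
    have k₄ : (L * (K + 1) + (Q + 8) * (10 * K)) * (‖y‖ * (‖y‖ + δ)) ≤ C * (‖y‖ * (‖y‖ + δ)) := by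
      gcongr
      have : 0 ≤ 10 * K * (|c| + |s|) := by positivity
      linarith
    linarith
  refine ⟨z, d₁, d₂, μ, hz, n₁, n₂, o, ?_, hmem, ?_, E₁, E₂, ?_, ?_, ?_, ?_, ?_⟩
  · linarith [(abs_le.1 hμ).2]
  · obtain ⟨j, -⟩ := est' 0 (by simpa using hR.le)
    have e : g₀ z + δ • g₁ z - (c • d₁ + s • d₂)
        = (g₀ z + δ • g₁ z - g₀ 0) - c • (d₁ - e₁) - s • (d₂ - e₂) := by
      rw [h.grad]; module
    change ‖g₀ z + δ • g₁ z - (c • d₁ + s • d₂)‖ ≤ C * δ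
    rw [e]
    have k₁ := norm_sub_le ((g₀ z + δ • g₁ z - g₀ 0) - c • (d₁ - e₁)) (s • (d₂ - e₂))
    have k₂ := norm_sub_le (g₀ z + δ • g₁ z - g₀ 0) (c • (d₁ - e₁))
    have k₃ : ‖c • (d₁ - e₁)‖ ≤ |c| * (10 * (K * δ)) := by
      rw [norm_smul, Real.norm_eq_abs]; gcongr
    have k₄ : ‖s • (d₂ - e₂)‖ ≤ |s| * (10 * (K * δ)) := by
      rw [norm_smul, Real.norm_eq_abs]; gcongr
    have k₅ : L * (‖z‖ + δ) ≤ L * (K * δ + δ) := by gcongr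
    have k₆ : 0 ≤ (Q + 8) * (10 * K) * δ := by positivity
    rw [hC]
    linarith
  · intro y hy
    exact (est' y hy).2.1.trans hLC
  · intro y hy w hw₁ hw₂
    refine le_trans ?_ (h.coercive_of_near b₁ b₂ (est' y hy).2.2.1 hw₁ hw₂)
    refine mul_le_mul_of_nonneg_right ?_ (sq_nonneg _)
    have k₁ : L * (‖z‖ + ‖y‖ + δ) ≤ L * (K * δ + R + δ) := by gcongr
    have k₂ : 2 * (κ - lam) * (10 * (K * δ)) ^ 2 ≤ 2 * (κ - lam) * (10 * (K * δ)) := by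
      refine mul_le_mul_of_nonneg_left ?_ (by linarith)
      rw [sq]
      exact mul_le_of_le_one_right (by positivity) (by linarith)
    have : 0 ≤ (κ - lam) * (K * δ) := by positivity
    have : 0 ≤ L * (K + 1) * δ := by positivity
    linarith
  · intro y hy
    refine (est' y hy).2.2.2.1.trans ?_
    gcongr
  · intro y hy
    exact hdir y d₁ _ hy n₁ E₁ (h.norm_third_left_sub_le n₁ n₂ b₁ b₂ y)
  · intro y hy
    exact hdir y d₂ _ hy n₂ E₂ (h.norm_third_right_sub_le n₁ n₂ b₁ b₂ y)

end NearIsotropic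

namespace IsNearIsotropic

variable {X : Type*} [NormedAddCommGroup X] [InnerProductSpace ℝ X]
  {g : X → X} {B : X → X →L[ℝ] X} {z f₁ f₂ : X} {μ κ γ c s C R δ : ℝ}

/-- The Hessian at the singularity splits along the isotropic plane. -/
theorem hessian_apply_eq (h : IsNearIsotropic g B z f₁ f₂ μ κ γ c s C R δ) (w : X) :
    B z w = μ • (inner ℝ f₁ w • f₁ + inner ℝ f₂ w • f₂) + B z (planePerp f₁ f₂ w) := by
  conv_lhs => rw [eq_add_planePerp f₁ f₂ w]
  simp only [map_add, map_smul, h.eig_left, h.eig_right]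
  module

theorem planePerp_eq_zero_of_apply_eq_smul (h : IsNearIsotropic g B z f₁ f₂ μ κ γ c s C R δ)
    (hR : 0 ≤ R) (hγ : 0 < γ) {ν : ℝ} (hν : ν ≤ μ) {w : X} (hw : B z w = ν • w) :
    planePerp f₁ f₂ w = 0 := by
  have w₁ := inner_left_planePerp h.norm_left h.orth w
  have w₂ := inner_right_planePerp h.norm_right h.orth w
  have hco := h.coercive 0 (by simpa using hR) _ w₁ w₂
  rw [add_zero] at hco
  have e := h.hessian_apply_eq w
  have hi : inner ℝ (planePerp f₁ f₂ w) (B z w)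
      = inner ℝ (planePerp f₁ f₂ w) (B z (planePerp f₁ f₂ w)) := by
    rw [e, inner_add_right, inner_smul_right, inner_add_right, inner_smul_right, inner_smul_right,
      real_inner_comm f₁, real_inner_comm f₂, w₁, w₂]
    ring
  rw [hw, inner_smul_right, inner_planePerp_self h.norm_left h.norm_right h.orth] at hi
  have hg := h.gap
  by_contra hne
  have : 0 < ‖planePerp f₁ f₂ w‖ ^ 2 := by
    have := norm_pos_iff.2 hne; positivity
  nlinarith

theorem apply_eq_smul_iff (h : IsNearIsotropic g B z f₁ f₂ μ κ γ c s C R δ)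
    (hR : 0 ≤ R) (hγ : 0 < γ) {w : X} : B z w = μ • w ↔ planePerp f₁ f₂ w = 0 := by
  refine ⟨h.planePerp_eq_zero_of_apply_eq_smul hR hγ le_rfl, fun hw => ?_⟩
  have e := eq_add_planePerp f₁ f₂ w
  rw [hw, add_zero] at e
  rw [h.hessian_apply_eq, hw, map_zero, add_zero, ← e]

theorem eigenspace_eq_span (h : IsNearIsotropic g B z f₁ f₂ μ κ γ c s C R δ)
    (hR : 0 ≤ R) (hγ : 0 < γ) :
    Module.End.eigenspace (B z : Module.End ℝ X) μ = Submodule.span ℝ {f₁, f₂} := by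
  ext w
  rw [Module.End.mem_eigenspace_iff, Submodule.mem_span_pair]
  change B z w = μ • w ↔ _
  constructor
  · intro hw
    have e := eq_add_planePerp f₁ f₂ w
    rw [(h.apply_eq_smul_iff hR hγ).1 hw, add_zero] at e
    exact ⟨_, _, e.symm⟩
  · rintro ⟨p, q, rfl⟩
    rw [map_add, map_smul, map_smul, h.eig_left, h.eig_right]
    module

theorem finrank_eigenspace (h : IsNearIsotropic g B z f₁ f₂ μ κ γ c s C R δ)
    (hR : 0 ≤ R) (hγ : 0 < γ) :
    Module.finrank ℝ (Module.End.eigenspace (B z : Module.End ℝ X) μ) = 2 := by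
  have ho : Orthonormal ℝ ![f₁, f₂] := by
    have h' : inner ℝ f₂ f₁ = 0 := by rw [real_inner_comm]; exact h.orth
    refine ⟨fun i => ?_, fun i j hij => ?_⟩
    · fin_cases i
      · exact h.norm_left
      · exact h.norm_right
    · fin_cases i <;> fin_cases j
      · exact absurd rfl hij
      · exact h.orth
      · exact h'
      · exact absurd rfl hij
  have := finrank_span_eq_card ho.linearIndependent
  rw [h.eigenspace_eq_span hR hγ]
  rwa [Matrix.range_cons_cons_empty, Fintype.card_fin] at this

theorem isLeast_eigenvalue (h : IsNearIsotropic g B z f₁ f₂ μ κ γ c s C R δ)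
    (hR : 0 ≤ R) (hγ : 0 < γ) :
    IsLeast {ν : ℝ | Module.End.HasEigenvalue (B z : Module.End ℝ X) ν} μ := by
  constructor
  · refine Module.End.hasEigenvalue_of_hasEigenvector (x := f₁)
      ⟨Module.End.mem_eigenspace_iff.2 h.eig_left, ?_⟩
    rw [← norm_ne_zero_iff, h.norm_left]; exact one_ne_zero
  · intro ν hν
    obtain ⟨w, hw, hw0⟩ := hν.exists_hasEigenvector
    by_contra hlt
    have hw' : B z w = ν • w := Module.End.mem_eigenspace_iff.1 hw
    have hlt' : ν ≤ μ := (not_le.1 hlt).le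
    have h0 := h.planePerp_eq_zero_of_apply_eq_smul hR hγ hlt' hw'
    rw [← h.apply_eq_smul_iff hR hγ, hw', ← sub_eq_zero, ← sub_smul, smul_eq_zero] at h0
    rcases h0 with h0 | h0
    · exact hlt (by rw [sub_eq_zero.1 h0])
    · exact hw0 h0

theorem grad_mem_eigenspace (h : IsNearIsotropic g B z f₁ f₂ μ κ γ c s C R δ)
    (hR : 0 ≤ R) (hγ : 0 < γ) : g z ∈ Module.End.eigenspace (B z : Module.End ℝ X) μ := by
  refine Module.End.mem_eigenspace_iff.2 ((h.apply_eq_smul_iff hR hγ).2 ?_)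
  have := h.grad_mem _ (inner_left_planePerp h.norm_left h.orth (g z))
    (inner_right_planePerp h.norm_right h.orth (g z))
  rw [inner_planePerp_self h.norm_left h.norm_right h.orth] at this
  simpa using this

end IsNearIsotropic

section Perturbation

variable {N : ℕ} {E₀ ΔE : EuclideanSpace ℝ (Fin N) → ℝ}

theorem gradient_add_const_mul (hE₀ : ContDiff ℝ 4 E₀) (hΔE : ContDiff ℝ 4 ΔE) (δ : ℝ) :
    gradient (fun x => E₀ x + δ * ΔE x) = fun x => gradient E₀ x + δ • gradient ΔE x := by
  funext x
  have d₀ := (hE₀.differentiable (by norm_num) x).hasGradientAt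
  have d₁ := (hΔE.differentiable (by norm_num) x).hasGradientAt
  refine HasGradientAt.gradient ?_
  rw [hasGradientAt_iff_hasFDerivAt] at *
  rw [map_add, map_smul]
  exact d₀.add (d₁.const_mul δ)

theorem hessian_add_const_mul (hE₀ : ContDiff ℝ 4 E₀) (hΔE : ContDiff ℝ 4 ΔE) (δ : ℝ) :
    hessian (fun x => E₀ x + δ * ΔE x) = fun x => hessian E₀ x + δ • hessian ΔE x := by
  funext x
  rw [hessian, gradient_add_const_mul hE₀ hΔE]
  exact ((hasFDerivAt_gradient (hE₀.of_le (by norm_num)) x).add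
    ((hasFDerivAt_gradient (hΔE.of_le (by norm_num)) x).const_smul δ)).fderiv

end Perturbation

theorem IsGADSolutionOn.eqOn_Ico {N : ℕ} {E : EuclideanSpace ℝ (Fin N) → ℝ}
    (hE : ContDiff ℝ 4 E) {ε T : ℝ} {x v y w : ℝ → EuclideanSpace ℝ (Fin N)}
    (h : IsGADSolutionOn E ε x v (Ico 0 T)) (h' : IsGADSolutionOn E ε y w (Ico 0 T))
    (hx : y 0 = x 0) (hv : w 0 = v 0) : EqOn y x (Ico 0 T) ∧ EqOn w v (Ico 0 T) := by
  have hg := contDiff_gradient hE (m := 1) (by norm_num)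
  have hB := contDiff_hessian hE (m := 1) (by norm_num)
  have key := eqOn_Ico_of_hasDerivWithinAt (contDiff_gadField hg hB ε)
    (u := fun t => (y t, w t)) (w := fun t => (x t, v t)) (T := T)
    (fun t ht => (h' t ht).1.prodMk (h' t ht).2) (fun t ht => (h t ht).1.prodMk (h t ht).2)
    (by simp [hx, hv])
  exact ⟨fun t ht => congrArg Prod.fst (key ht), fun t ht => congrArg Prod.snd (key ht)⟩

end

theorem mainTheorem5 (n : ℕ) (E₀ ΔE : EuclideanSpace ℝ (Fin (n + 2)) → ℝ)
    (hE₀ : ContDiff ℝ 4 E₀) (hΔE : ContDiff ℝ 4 ΔE)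
    (α lam : ℝ) (H : Matrix (Fin n) (Fin n) ℝ) (G : Fin n → Fin n → Fin n → ℝ)
    (hcos : 0 < Real.cos α) (hsin : Real.sin α ≠ 0)
    (hform : HasIsotropicForm E₀ α lam H G)
    (hH : (H - max 0 lam • (1 : Matrix (Fin n) (Fin n) ℝ)).PosDef) :
    ∃ δ₀ ε₀ m M : ℝ, 0 < δ₀ ∧ 0 < ε₀ ∧ 0 < m ∧ 0 < M ∧ ∀ δ : ℝ, 0 < δ → δ < δ₀ →
      ∃ (z : EuclideanSpace ℝ (Fin (n + 2))) (μ : ℝ),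
        -- the singularity of the perturbed energy
        (‖z‖ ≤ M * δ ∧
          IsLowestHessianEigenvalue (fun x => E₀ x + δ * ΔE x) z μ ∧
          Module.finrank ℝ (hessianEigenspace (fun x => E₀ x + δ * ΔE x) z μ) = 2 ∧
          gradient (fun x => E₀ x + δ * ΔE x) z ∈
            hessianEigenspace (fun x => E₀ x + δ * ΔE x) z μ) ∧
        -- the trajectories around it
        ∀ ε : ℝ, 0 < ε → ε < ε₀ →
          ∀ x₀ : EuclideanSpace ℝ (Fin (n + 2)),
            x₀ - z ∈ hessianEigenspace (fun x => E₀ x + δ * ΔE x) z μ →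
            ‖x₀ - z‖ = ε / √(2 * Real.cos α) →
            ∃ v₀ : EuclideanSpace ℝ (Fin (n + 2)), ‖v₀‖ = 1 ∧
              ∀ xi vi : EuclideanSpace ℝ (Fin (n + 2)),
                ‖xi - x₀‖ ≤ m * ε * (δ + ε) → ‖vi - v₀‖ ≤ m * ε * (δ + ε) → ‖vi‖ = 1 →
                ∃ x v : ℝ → EuclideanSpace ℝ (Fin (n + 2)),
                  IsGADSolutionOn (fun x => E₀ x + δ * ΔE x) ε x v (Set.Ici 0) ∧
                  x 0 = xi ∧ v 0 = vi ∧
                  (∀ (T : ℝ) (y w : ℝ → EuclideanSpace ℝ (Fin (n + 2))), 0 < T →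
                    IsGADSolutionOn (fun x => E₀ x + δ * ΔE x) ε y w (Set.Ico 0 T) →
                    y 0 = xi → w 0 = vi →
                    Set.EqOn y x (Set.Ico 0 T) ∧ Set.EqOn w v (Set.Ico 0 T)) ∧
                  (∀ t : ℝ, 0 ≤ t → ‖v t‖ = 1) ∧
                  ∀ t : ℝ, 0 ≤ t →
                    |‖x t - z‖ - ε / √(2 * Real.cos α)| ≤ M * ε * (ε + δ) := by
  obtain ⟨κ₀, hjet⟩ := hform.isIsotropicJet hE₀ hH
  have hsym : ∀ {E : EuclideanSpace ℝ (Fin (n + 2)) → ℝ}, ContDiff ℝ 4 E → ∀ x u w,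
      inner ℝ (hessian E x u) w = inner ℝ u (hessian E x w) := fun hE =>
    inner_hessian_comm (hE.of_le (by norm_num))
  obtain ⟨K, C, R, κ, γ, δ₁, hK, hC, hR, hκ, hγ, hδ₁, hnear⟩ := hjet.exists_isNearIsotropic
    (hasFDerivAt_gradient (hE₀.of_le (by norm_num)))
    (hasFDerivAt_gradient (hΔE.of_le (by norm_num)))
    (hasFDerivAt_hessian (hE₀.of_le (by norm_num)))
    (hasFDerivAt_hessian (hΔE.of_le (by norm_num)))
    ((contDiff_hessian hE₀ (m := 2) (by norm_num)).fderiv_right (by norm_num))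
    ((contDiff_hessian hΔE (m := 2) (by norm_num)).continuous_fderiv (by norm_num))
    (contDiff_gradient hE₀ (by norm_num)) (contDiff_gradient hΔE (by norm_num))
    (contDiff_hessian hE₀ (by norm_num)) (contDiff_hessian hΔE (by norm_num))
    (hsym hE₀) (hsym hΔE)
  obtain ⟨θ, M, hθ, hM, htrap⟩ := exists_trapping_bounds
    (X := EuclideanSpace ℝ (Fin (n + 2))) hcos hsin (Real.cos_sq_add_sin_sq α) hC hR hκ hγ
  refine ⟨min δ₁ (θ / 2), θ / 2, 1, max K M, by positivity, by positivity, one_pos, by positivity,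
    fun δ hδ hδ' => ?_⟩
  obtain ⟨z, f₁, f₂, μ, hz, hiso⟩ := hnear δ hδ (hδ'.trans_le (min_le_left _ _))
  have hδθ : δ < θ / 2 := hδ'.trans_le (min_le_right _ _)
  have hE : ContDiff ℝ 4 (fun x => E₀ x + δ * ΔE x) := hE₀.add (contDiff_const.mul hΔE)
  rw [← gradient_add_const_mul hE₀ hΔE, ← hessian_add_const_mul hE₀ hΔE] at hiso
  refine ⟨z, μ, ⟨hz.trans (by gcongr; exact le_max_left _ _), hiso.isLeast_eigenvalue hR.le hγ,
    hiso.finrank_eigenspace hR.le hγ, hiso.grad_mem_eigenspace hR.le hγ⟩, fun ε hε hεθ x₀ hx₀ hn => ?_⟩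
  have hplane := (hiso.apply_eq_smul_iff hR.le hγ).1 (Module.End.mem_eigenspace_iff.1 hx₀)
  obtain ⟨v₀, hv₀, hv⟩ := htrap ε δ hε hδ.le (by linarith) _ _ _ _ _ _ hiso x₀ hplane hn
  refine ⟨v₀, hv₀, fun xi vi hxi hvi hvi₁ => ?_⟩
  obtain ⟨x, v, rfl, rfl, cx, cv, hv₁, hd⟩ := exists_gad_curve
    (contDiff_gradient hE (m := 1) (by norm_num)) (contDiff_hessian hE (m := 1) (by norm_num))
    ε R hR z xi vi hvi₁
  have hb := hv x v cx.continuousOn cv.continuousOn hv₁ (by rw [add_comm ε δ]; linarith)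
    (by rw [add_comm ε δ]; linarith) (fun t ht => hd t ht.le)
  have hsol : IsGADSolutionOn (fun x => E₀ x + δ * ΔE x) ε x v (Set.Ici 0) := fun t ht =>
    have := hd t ht (hb t ht).1
    ⟨this.1.hasDerivWithinAt, this.2.hasDerivWithinAt⟩
  refine ⟨x, v, hsol, rfl, rfl, fun T y w _ hyw hy hw => ?_, hv₁, fun t ht => ?_⟩
  · refine IsGADSolutionOn.eqOn_Ico hE (fun t ht => ?_) hyw hy hw
    have := hsol t ht.1
    exact ⟨this.1.mono Set.Ico_subset_Ici_self, this.2.mono Set.Ico_subset_Ici_self⟩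
  · refine (hb t ht).2.trans ?_
    gcongr
    exact le_max_right _ _
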